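/- **Setting.** Fix a horizon $T\in\mathbb N$ and a discount factor $\gamma\in(0,1]$. A unit has a trajectory $Z=(X_1,A_1,R_1,\dots,X_T,A_T,R_T,X_{T+1})$ with covariates $X_t\in\mathcal X_t$, actions $A_t$ in a measurable space $\mathcal A$ and real rewards $R_t$; $S_t=(X_1,A_1,R_1,\dots,A_{t-1},R_{t-1},X_t)$ is the history and $\Gamma_t=\sum_{k=t}^T\gamma^{k-t}R_k$. Let $\lambda$ be a $\sigma$-finite measure on $\mathcal A$ and $\mathcal A_t\subseteq\mathcal A$ measurable. A policy is a family of conditional densities $\pi_t(a\mid s)$ with respect to $\lambda|_{\mathcal A_t}$; the observed actions satisfy $A_t\sim\pi_t(\cdot\mid S_t)$. There are (jointly measurable) potential outcomes $X_{t+1}(a_{1:t}),R_t(a_{1:t})$ satisfying *consistency*, $(X_{t+1},R_t)=(X_{t+1}(A_{1:t}),R_t(A_{1:t}))$ a.s., and *sequential unconfoundedness*: for each $t$, given $S_t$, $A_t$ is independent of the family of all future potential outcomes $X_{k+1}(A_{1:t-1},a_t,\dots,a_k),\,R_k(A_{1:t-1},a_t,\dots,a_k)$, $k\ge t$ (as a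 jointly measurable family, i.e. there is a $\sigma$-algebra that is conditionally independent of $A_t$ given $S_t$ and for which the family is jointly measurable in the outcome and in $(a_t,\dots,a_T)$). For a policy $\tilde\pi$ let $\mathbb E_{\tilde\pi}$ be the expectation when all actions are drawn successively from $\tilde\pi$ and the potential outcomes evolve accordingly, and $\mathbb E$ the expectation for the observed data. Let $q_t^\star(s,a)=\mathbb E_\pi[\Gamma_t\mid S_t=s,\mathrm{do}(A_t=a)]$ on the support of $\pi$ and $V_t(s)=\int_{\mathcal A_t}q_t^\star(s,a)\pi_t(a\mid s)\,d\lambda(a)$. Let $(\pi_\varepsilon)$ be a *differentiable supported path*: policies with $\pi_0=\pi$ such that for some measurable $\pi_t'(a\mid s)$, for each $t$ and almost every $s$, $\pi_t'(\cdot\mid s)\in L^1(\lambda|_{\mathcal A_t})$ and $\int_{\mathcal A_t}\bigl|\tfrac{\pi_{t,\varepsilon}(a\mid s)-\pi_t(a\mid s)}{\varepsilon}-\pi_t'(a\mid s)\bigr|d\lambda(a)\to0$ as $\varepsilon\to0$; and for all small $|\varepsilon|$, for almost every $s$, $\pi_{t,\varepsilon}(\cdot\mid s)\ll\pi_t(\cdot\mid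 s)$. Put $H_t^\star=\pi_t'/\pi_t$ and $\mathbb E_\varepsilon=\mathbb E_{\pi_\varepsilon}$. Assume for each $t$: (i) $R_t$, $V_t(S_t)$, $q_t^\star(S_t,A_t)$ are square-integrable and $\mathbb E\int_{\mathcal A_t}|q_t^\star(S_t,a)\pi_t'(a\mid S_t)|\,d\lambda(a)<\infty$; (ii) there is an integrable $D_t$ such that, for all sufficiently small $\varepsilon\ne0$, a.s. $\int_{\mathcal A_t}\bigl|q_t^\star(S_t,a)\tfrac{\pi_{t,\varepsilon}(a\mid S_t)-\pi_t(a\mid S_t)}{\varepsilon}\bigr|d\lambda(a)\le D_t$; (iii) $\mathbb E[H_t^\star(S_t,A_t)^2\mid S_t]\le C_H$ a.s. for a constant $C_H<\infty$. For functions $q=(q_t)$, $H=(H_t)$ let $$\psi(z;q,H)=\sum_{t=1}^T\gamma^{t-1}\Bigl[\int_{\mathcal A_t}q_t(S_t,a)\pi_t'(a\mid S_t)\,d\lambda(a)+H_t(S_t,A_t)\{\Gamma_t-q_t(S_t,A_t)\}\Bigr],$$ assume $\psi(Z;q^\star,H^\star)$ has a finite second moment, and let $\sigma_\star^2$ be its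 variance. **Estimators.** Let $Z_1,Z_2,\dots$ be i.i.d. copies of $Z$. Let $K$ be fixed and, for each $n$, let $I_1,\dots,I_K$ be a partition of $\{1,\dots,n\}$. For each fold $k$ let $\hat q_t^{(-k)},\hat H_t^{(-k)}$ be functions of $(s,a)$ that are measurably constructed from the training sample $\{Z_i:i\notin I_k\}$. The cross-fitted ASRW estimator and the oracle estimator are $$\hat\Theta=\frac1n\sum_{k=1}^K\sum_{i\in I_k}\psi(Z_i;\hat q^{(-k)},\hat H^{(-k)}),\qquad \hat\Theta^\star=\frac1n\sum_{i=1}^n\psi(Z_i;q^\star,H^\star).$$ Assume $|R_t|\le R_{\max}$ a.s. for all $t$, and $\sup_{a\in\mathcal A_t}|\hat q_t^{(-k)}(S_{i,t},a)|\le R_{\max}\sum_{j=0}^{T-1}\gamma^j$ a.s. for all $t,k$ and $i\in I_k$. Assume that for all $t$ and $k$, with the expectation taken over an independent trajectory for fixed training sample, $$\mathbb E\bigl[(\hat q_t^{(-k)}(S_t,A_t)-q_t^\star(S_t,A_t))^2\bigr]=o_p(n^{-2\alpha_q}),\qquad \mathbb E\bigl[(\hat H_t^{(-k)}(S_t,A_t)-H_t^\star(S_t,A_t))^2\bigr]=o_p(n^{-2\alpha_H}),$$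 where $\alpha_q,\alpha_H\ge0$ and $\alpha_q+\alpha_H\ge\frac12$. **Theorem.** 1. $\sqrt n(\hat\Theta-\hat\Theta^\star)\to0$ in probability. 2. $\sqrt n(\hat\Theta-\Theta_0)\Rightarrow\mathcal N(0,\sigma_\star^2)$, where $\Theta_0=\sum_{t=1}^T\gamma^{t-1}\,\mathbb E\int_{\mathcal A_t}q_t^\star(S_t,a)\pi_t'(a\mid S_t)\,d\lambda(a)$ is the policy-gradient form of the target. 3. Suppose moreover that for each $t<T$ there is an integrable $D_t'$ such that, for all sufficiently small $\varepsilon\neq0$, a.s. $\int_{\mathcal A_t}\bigl|\tfrac{\pi_{t,\varepsilon}(a\mid S_t)-\pi_t(a\mid S_t)}{\varepsilon}\bigr|d\lambda(a)\le D_t'$ (no condition if $T=1$). Then the marginal policy effect $\Theta=\frac{d}{d\varepsilon}\mathbb E_\varepsilon\bigl[\sum_{k=1}^T\gamma^{k-1}R_k\bigr]\big|_{\varepsilon=0}$ exists, and $\sqrt n(\hat\Theta-\Theta)\Rightarrow\mathcal N(0,\sigma_\star^2)$. -/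

import Mathlib

open MeasureTheory ProbabilityTheory Filter Topology
open scoped ENNReal

noncomputable section

namespace MPE

/-! ### Histories and trajectories

Stages are numbered `0, …, T - 1`. `Hist X A t` is the space of tuples consisting of the covariates
of the first `t + 1` periods and the actions and rewards of the first `t` periods. It is the space of
the histories observed just before the action of stage `t` is taken, and `Hist X A T` is the space of
complete trajectories. -/

/-- Histories before the action of stage `t`; for `t = T`, complete trajectories. -/
abbrev Hist (X : ℕ → Type*) (A : Type*) (t : ℕ) : Type _ :=
  ((j : Fin (t + 1)) → X j) × (Fin t → A) × (Fin t → ℝ)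

section Hist

variable {X : ℕ → Type*} {A : Type*} {T : ℕ}

/-- The history `S_t` contained in a complete trajectory. -/
def stateAt (t : Fin T) (z : Hist X A T) : Hist X A t :=
  (fun j => z.1 (Fin.castLE (by omega) j),
    fun i => z.2.1 (Fin.castLE (by omega) i),
    fun i => z.2.2 (Fin.castLE (by omega) i))

/-- The action `A_t` contained in a complete trajectory. -/
def actionAt (t : Fin T) (z : Hist X A T) : A := z.2.1 t

/-- The discounted cumulative reward `Γ_t = ∑_{k ≥ t} γ ^ (k - t) R_k` of a trajectory. -/
def cumReward (γ : ℝ) (t : Fin T) (z : Hist X A T) : ℝ :=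
  ∑ k ∈ Finset.Ici t, γ ^ ((k : ℕ) - (t : ℕ)) * z.2.2 k

/-- The discounted welfare `∑_k γ ^ k R_k` of a trajectory. -/
def welfare (γ : ℝ) (z : Hist X A T) : ℝ := ∑ k : Fin T, γ ^ (k : ℕ) * z.2.2 k

variable [∀ j, MeasurableSpace (X j)] [MeasurableSpace A]

lemma measurable_stateAt (t : Fin T) :
    Measurable (stateAt (X := X) (A := A) t) := by
  refine Measurable.prodMk ?_ (Measurable.prodMk ?_ ?_)
  · exact measurable_pi_lambda _ fun j =>
      (measurable_pi_apply (Fin.castLE (by omega) j : Fin (T + 1))).comp measurable_fst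
  · exact measurable_pi_lambda _ fun j =>
      (measurable_pi_apply _).comp (measurable_fst.comp measurable_snd)
  · exact measurable_pi_lambda _ fun j =>
      (measurable_pi_apply _).comp (measurable_snd.comp measurable_snd)

end Hist

/-! ### Policies -/

/-- A stochastic history-dependent policy: at stage `t` the action is drawn from the density
`dens t s` with respect to the reference measure `lam` restricted to the action set `acts t`. -/
structure Policy (T : ℕ) (X : ℕ → Type*) (A : Type*) [∀ j, MeasurableSpace (X j)]
    [MeasurableSpace A] (lam : Measure A) (acts : Fin T → Set A) where
  /-- the conditional densities `π_t(a | s)` -/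
  dens : (t : Fin T) → Hist X A t → A → ℝ
  measurable_dens : ∀ t, Measurable (Function.uncurry (dens t))
  dens_nonneg : ∀ t s a, 0 ≤ dens t s a
  lintegral_dens : ∀ t s, ∫⁻ a in acts t, ENNReal.ofReal (dens t s a) ∂lam = 1

section Policy

variable {T : ℕ} {X : ℕ → Type*} {A : Type*} [∀ j, MeasurableSpace (X j)]
  [MeasurableSpace A] {lam : Measure A} [SigmaFinite lam] {acts : Fin T → Set A}

/-- The conditional action distribution `π_t(da | s)`. -/
def Policy.kernel (p : Policy T X A lam acts) (t : Fin T) : Kernel (Hist X A t) A :=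
  (Kernel.const (Hist X A t) (lam.restrict (acts t))).withDensity
    fun s a => ENNReal.ofReal (p.dens t s a)

instance (p : Policy T X A lam acts) (t : Fin T) : IsMarkovKernel (p.kernel t) := by
  refine ⟨fun s => ⟨?_⟩⟩
  have hm : Measurable (Function.uncurry fun s a => ENNReal.ofReal (p.dens t s a)) :=
    (p.measurable_dens t).ennreal_ofReal
  rw [Policy.kernel, Kernel.withDensity_apply' _ hm, Kernel.const_apply, Measure.restrict_univ]
  exact p.lintegral_dens t s

end Policy

/-! ### The causal model of a unit -/

/-- The first `m` entries of a vector of `T` actions. -/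
def firstActions {A : Type*} {T : ℕ} (m : ℕ) (h : m ≤ T) (a : Fin T → A) : Fin m → A :=
  fun i => a (Fin.castLE h i)

/-- The action vector that agrees with `b` before stage `t` and with `a` from stage `t` on. -/
def splice {A : Type*} {T : ℕ} (b : Fin T → A) (t : Fin T) (a : Fin T → A) : Fin T → A :=
  fun i => if i < t then b i else a i

/-- The observed variables of a generic unit, and its potential outcomes. The covariates numbered
`j` may depend on the first `j` actions and the reward of stage `t` on the first `t + 1` actions;
the potential outcome number `0` of the covariates depends on no action. -/
structure Model (T : ℕ) (X : ℕ → Type*) (A : Type*) (Ω : Type*) [∀ j, MeasurableSpace (X j)]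
    [MeasurableSpace A] [MeasurableSpace Ω] where
  /-- observed covariates -/
  cov : (j : Fin (T + 1)) → Ω → X j
  /-- observed actions -/
  act : Fin T → Ω → A
  /-- observed rewards -/
  rew : Fin T → Ω → ℝ
  /-- potential covariates -/
  covPO : (j : Fin (T + 1)) → Ω → (Fin j → A) → X j
  /-- potential rewards -/
  rewPO : (t : Fin T) → Ω → (Fin ((t : ℕ) + 1) → A) → ℝ
  measurable_cov : ∀ j, Measurable (cov j)
  measurable_act : ∀ t, Measurable (act t)
  measurable_rew : ∀ t, Measurable (rew t)
  measurable_covPO : ∀ j, Measurable (Function.uncurry (covPO j))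
  measurable_rewPO : ∀ t, Measurable (Function.uncurry (rewPO t))

/-- `m₁` and `m₂` are conditionally independent given `m'` under `P`. (On standard Borel spaces this
is Mathlib's `CondIndep`, by `condIndep_iff`.) -/
def CondIndepGiven {Ω : Type*} (m' m₁ m₂ : MeasurableSpace Ω) {mΩ : MeasurableSpace Ω}
    (P : Measure Ω) : Prop :=
  ∀ s u, MeasurableSet[m₁] s → MeasurableSet[m₂] u →
    P[(s ∩ u).indicator (fun _ => (1 : ℝ)) | m'] =ᵐ[P]
      P[s.indicator (fun _ => (1 : ℝ)) | m'] * P[u.indicator (fun _ => (1 : ℝ)) | m']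

namespace Model

variable {T : ℕ} {X : ℕ → Type*} {A : Type*} {Ω : Type*} [∀ j, MeasurableSpace (X j)]
  [MeasurableSpace A] [mΩ : MeasurableSpace Ω] (M : Model T X A Ω)

/-- The vector of observed actions. -/
def actions (ω : Ω) : Fin T → A := fun t => M.act t ω

/-- The observed trajectory. -/
def traj (ω : Ω) : Hist X A T := (fun j => M.cov j ω, M.actions ω, fun t => M.rew t ω)

/-- The observed history `S_t`. -/
def state (t : Fin T) (ω : Ω) : Hist X A t := stateAt t (M.traj ω)

/-- The trajectory of the unit `ω` if the actions are set to `a`. -/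
def poTraj (ω : Ω) (a : Fin T → A) : Hist X A T :=
  (fun j => M.covPO j ω (firstActions j (Nat.lt_succ_iff.mp j.2) a), a,
    fun t => M.rewPO t ω (firstActions (t + 1) t.2 a))

/-- **Consistency.** -/
def Consistency (P : Measure Ω) : Prop :=
  ∀ᵐ ω ∂P, M.traj ω = M.poTraj ω (M.actions ω)

/-- The sigma-algebra `𝒢` carries the information in the family of all the potential outcomes from
stage `t` on that are consistent with the realized past `A_0, …, A_{t-1}` (as a jointly measurable
family), and the action `A_t` is independent of `𝒢` given `S_t`. -/
structure UnconfoundedAt (t : Fin T) (𝒢 : MeasurableSpace Ω) {mΩ : MeasurableSpace Ω}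
    (M : Model T X A Ω) (P : Measure Ω) : Prop where
  le : 𝒢 ≤ mΩ
  measurable_cov : ∀ j : Fin (T + 1), (t : ℕ) < j →
    @Measurable _ _ (𝒢.prod MeasurableSpace.pi) _
      fun x : Ω × (Fin T → A) => (M.poTraj x.1 (splice (M.actions x.1) t x.2)).1 j
  measurable_rew : ∀ k : Fin T, t ≤ k →
    @Measurable _ _ (𝒢.prod MeasurableSpace.pi) _
      fun x : Ω × (Fin T → A) => (M.poTraj x.1 (splice (M.actions x.1) t x.2)).2.2 k
  condIndep : CondIndepGiven (MeasurableSpace.comap (M.state t) inferInstance)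
    (MeasurableSpace.comap (M.act t) inferInstance) 𝒢 P

/-- **Sequential unconfoundedness.** For every `t`, conditionally on `S_t`, the action `A_t` is
independent of all the future potential outcomes that are consistent with the realized past. For
countably many actions (with the discrete sigma-algebra), the family of potential outcomes is jointly
measurable for the sigma-algebra that it generates, so that this is independence of the family. -/
def SequentialUnconfoundedness (P : Measure Ω) : Prop :=
  ∀ t : Fin T, ∃ 𝒢 : MeasurableSpace Ω, UnconfoundedAt t 𝒢 M P

lemma measurable_traj : Measurable M.traj :=
  (measurable_pi_lambda _ M.measurable_cov).prodMk
    ((measurable_pi_lambda _ M.measurable_act).prodMk (measurable_pi_lambda _ M.measurable_rew))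

lemma measurable_poTraj :
    Measurable (fun x : Ω × (Fin T → A) => M.poTraj x.1 x.2) := by
  have hf : ∀ (m : ℕ) (h : m ≤ T),
      Measurable fun x : Ω × (Fin T → A) => (x.1, firstActions m h x.2) := fun m h =>
    measurable_fst.prodMk
      (measurable_pi_lambda _ fun i => (measurable_pi_apply _).comp measurable_snd)
  refine Measurable.prodMk ?_ (measurable_snd.prodMk ?_)
  · exact measurable_pi_lambda _ fun j => (M.measurable_covPO j).comp (hf _ _)
  · exact measurable_pi_lambda _ fun t => (M.measurable_rewPO t).comp (hf _ _)

variable {lam : Measure A} [SigmaFinite lam] {acts : Fin T → Set A}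

/-- In the observed data, the action `A_t` is drawn from the policy `p` given `S_t`. -/
def FollowsPolicy (P : Measure Ω) (p : Policy T X A lam acts) : Prop :=
  ∀ t : Fin T, P.map (fun ω => (M.state t ω, M.act t ω)) = (P.map (M.state t)) ⊗ₘ (p.kernel t)

/-! ### Evolution under a policy

A pair `(ω, a)` is a unit together with a vector of actions. -/

/-- Replace the action of stage `t` by a draw from the policy, given the history that the unit has
under the earlier actions. -/
def drawStep (p : Policy T X A lam acts) (t : Fin T) :
    Kernel (Ω × (Fin T → A)) (Ω × (Fin T → A)) :=
  (Kernel.id ×ₖ (p.kernel t).comap (fun x => stateAt t (M.poTraj x.1 x.2))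
      ((measurable_stateAt t).comp M.measurable_poTraj)).map
    fun y => (y.1.1, Function.update y.1.2 t y.2)

/-- Draw the actions of the stages `s, s + 1, …, T - 1` successively from the policy. -/
def rollout (p : Policy T X A lam acts) (s : ℕ) :
    Kernel (Ω × (Fin T → A)) (Ω × (Fin T → A)) :=
  if h : s < T then (rollout p (s + 1)) ∘ₖ (M.drawStep p ⟨s, h⟩) else Kernel.id
  termination_by T - s

/-- The law of the trajectory if all the actions are assigned by the policy `p`. The observed
actions serve only as a starting vector, all of whose entries are replaced. -/
def policyLaw (P : Measure Ω) (p : Policy T X A lam acts) : Measure (Hist X A T) :=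
  ((P.map fun ω => (ω, M.actions ω)).bind (M.rollout p 0)).map fun x => M.poTraj x.1 x.2

/-- Expected discounted welfare under the policy `p`. -/
def expectedWelfare (P : Measure Ω) (γ : ℝ) (p : Policy T X A lam acts) : ℝ :=
  ∫ z, welfare γ z ∂(M.policyLaw P p)

/-- The mean of `Γ_t` for the unit `ω` if the actions before `t` are the realized ones, `A_t` is set
to `a`, and the later actions are drawn from `p`. -/
def doMean (γ : ℝ) (p : Policy T X A lam acts) (t : Fin T) (a : A) (ω : Ω) : ℝ :=
  ∫ x, cumReward γ t (M.poTraj x.1 x.2)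
    ∂(M.rollout p ((t : ℕ) + 1) (ω, Function.update (M.actions ω) t a))

/-- `q` is the action-value function `q_t(s, a) = E_p[Γ_t | S_t = s, do(A_t = a)]`, on the support of
the policy `p`; its values outside of the support are arbitrary. -/
def IsActionValue (P : Measure Ω) (γ : ℝ) (p : Policy T X A lam acts)
    (q : (t : Fin T) → Hist X A t → A → ℝ) : Prop :=
  ∀ t : Fin T, Measurable (Function.uncurry (q t)) ∧
    ∀ᵐ a ∂(lam.restrict (acts t)),
      {ω | 0 < p.dens t (M.state t ω) a}.indicator (fun ω => q t (M.state t ω) a) =ᵐ[P]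
        P[{ω | 0 < p.dens t (M.state t ω) a}.indicator (M.doMean γ p t a) |
          MeasurableSpace.comap (M.state t) inferInstance]

/-! ### Policy paths -/

/-- `p` is a differentiable supported path around the policy `p 0`, with direction `dir`. Only small
values of the parameter matter. -/
structure DifferentiablePath (P : Measure Ω) (p : ℝ → Policy T X A lam acts)
    (dir : (t : Fin T) → Hist X A t → A → ℝ) : Prop where
  measurable_dir : ∀ t, Measurable (Function.uncurry (dir t))
  integrable_dir : ∀ t, ∀ᵐ s ∂(P.map (M.state t)), IntegrableOn (dir t s) (acts t) lam
  tendsto_dir : ∀ t, ∀ᵐ s ∂(P.map (M.state t)),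
    Tendsto (fun ε : ℝ => ∫⁻ a in acts t,
      ‖((p ε).dens t s a - (p 0).dens t s a) / ε - dir t s a‖ₑ ∂lam) (𝓝[≠] 0) (𝓝 0)
  supported : ∀ᶠ ε in 𝓝 (0 : ℝ), ∀ t, ∀ᵐ s ∂(P.map (M.state t)),
    (p ε).kernel t s ≪ (p 0).kernel t s

end Model

section Score

variable {T : ℕ} {X : ℕ → Type*} {A : Type*} [∀ j, MeasurableSpace (X j)]
  [MeasurableSpace A] {lam : Measure A} {acts : Fin T → Set A}

/-- The direction score `H_t(s, a) = π_t'(a | s) / π_t(a | s)`; the values where the denominator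
vanishes play no role. -/
def dirScore (p : Policy T X A lam acts) (dir : (t : Fin T) → Hist X A t → A → ℝ)
    (t : Fin T) (s : Hist X A t) (a : A) : ℝ :=
  dir t s a / p.dens t s a

/-- The value function `V_t(s) = ∫ q_t(s, a) π_t(a | s) dλ(a)`. -/
def valueFn (p : Policy T X A lam acts) (q : (t : Fin T) → Hist X A t → A → ℝ)
    (t : Fin T) (s : Hist X A t) : ℝ :=
  ∫ a in acts t, q t s a * p.dens t s a ∂lam

/-- The augmented per-trajectory summand
`∑_t γ^t (∫ q_t(S_t, a) π_t'(a | S_t) dλ(a) + H_t(S_t, A_t) (Γ_t - q_t(S_t, A_t)))`. -/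
def augScore (lam : Measure A) (acts : Fin T → Set A) (γ : ℝ)
    (dir q H : (t : Fin T) → Hist X A t → A → ℝ) (z : Hist X A T) : ℝ :=
  ∑ t : Fin T,
    (γ ^ (t : ℕ) * ∫ a in acts t, q t (stateAt t z) a * dir t (stateAt t z) a ∂lam
      + γ ^ (t : ℕ) * H t (stateAt t z) (actionAt t z) *
          (cumReward γ t z - q t (stateAt t z) (actionAt t z)))

end Score

namespace Model

variable {T : ℕ} {X : ℕ → Type*} {A : Type*} {Ω : Type*} [∀ j, MeasurableSpace (X j)]
  [MeasurableSpace A] [mΩ : MeasurableSpace Ω] (M : Model T X A Ω)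
  {lam : Measure A} [SigmaFinite lam] {acts : Fin T → Set A}

/-- The regularity conditions of the policy-gradient theorem, for the path `p` with direction `dir`
and the baseline action-value function `q`. -/
structure GradientConditions (P : Measure Ω) (p : ℝ → Policy T X A lam acts)
    (dir q : (t : Fin T) → Hist X A t → A → ℝ) : Prop where
  /-- square-integrable rewards -/
  memLp_rew : ∀ t, MemLp (M.rew t) 2 P
  /-- square-integrable values -/
  memLp_value : ∀ t, MemLp (fun ω => valueFn (p 0) q t (M.state t ω)) 2 P
  /-- square-integrable action-values -/
  memLp_q : ∀ t, MemLp (fun ω => q t (M.state t ω) (M.act t ω)) 2 P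
  /-- integrability of the action-value against the direction -/
  lintegral_q_dir : ∀ t,
    ∫⁻ ω, ∫⁻ a in acts t, ‖q t (M.state t ω) a * dir t (M.state t ω) a‖ₑ ∂lam ∂P < ∞
  /-- dominated convergence -/
  dominated : ∀ t, ∃ D : Ω → ℝ, Integrable D P ∧ ∀ᶠ ε in 𝓝[≠] (0 : ℝ), ∀ᵐ ω ∂P,
    ∫⁻ a in acts t, ‖q t (M.state t ω) a *
      (((p ε).dens t (M.state t ω) a - (p 0).dens t (M.state t ω) a) / ε)‖ₑ ∂lam
        ≤ ENNReal.ofReal (D ω)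
  /-- square-integrable direction score, with bounded conditional second moment given `S_t` -/
  score_bound : ∃ C : ℝ, ∀ t,
    MemLp (fun ω => dirScore (p 0) dir t (M.state t ω) (M.act t ω)) 2 P ∧
    ∀ᵐ ω ∂P, (P[fun ω' => dirScore (p 0) dir t (M.state t ω') (M.act t ω') ^ 2 |
      MeasurableSpace.comap (M.state t) inferInstance]) ω ≤ C

/-- The difference quotients of the policy densities are dominated in `L¹(λ)` at all stages before
the last one. -/
def DominatedPathBeforeLast (P : Measure Ω) (p : ℝ → Policy T X A lam acts) : Prop :=
  ∀ t : Fin T, (t : ℕ) + 1 < T → ∃ D : Ω → ℝ, Integrable D P ∧ ∀ᶠ ε in 𝓝[≠] (0 : ℝ), ∀ᵐ ω ∂P,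
    ∫⁻ a in acts t,
      ‖((p ε).dens t (M.state t ω) a - (p 0).dens t (M.state t ω) a) / ε‖ₑ ∂lam
        ≤ ENNReal.ofReal (D ω)

/-- The policy-gradient functional `∑_t γ^t E[∫ q_t(S_t, a) π_t'(a | S_t) dλ(a)]`. -/
def gradientFunctional (P : Measure Ω) (lam : Measure A) (acts : Fin T → Set A) (γ : ℝ)
    (dir q : (t : Fin T) → Hist X A t → A → ℝ) : ℝ :=
  ∑ t : Fin T, γ ^ (t : ℕ) *
    ∫ ω, ∫ a in acts t, q t (M.state t ω) a * dir t (M.state t ω) a ∂lam ∂P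

/-- The oracle variance. -/
def oracleVariance (P : Measure Ω) (γ : ℝ) (p : Policy T X A lam acts)
    (dir q : (t : Fin T) → Hist X A t → A → ℝ) : ℝ :=
  variance (fun ω => augScore lam acts γ dir q (dirScore p dir) (M.traj ω)) P

/-- The mean squared error `E[(f(S_t, A_t) - g(S_t, A_t))²]` over a generic trajectory. -/
def mse (P : Measure Ω) (t : Fin T) (f g : Hist X A t → A → ℝ) : ℝ≥0∞ :=
  ∫⁻ ω, ENNReal.ofReal
    ((f (M.state t ω) (M.act t ω) - g (M.state t ω) (M.act t ω)) ^ 2) ∂P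

end Model

/-! ### Cross-fitting -/

/-- A training sample for the fold `k`: the trajectories of the units `i < n` outside of fold `k`,
where `fold i` is the fold that contains the unit `i`. -/
abbrev Train (T : ℕ) (X : ℕ → Type*) (A : Type*) {n K : ℕ} (fold : Fin n → Fin K) (k : Fin K) :
    Type _ :=
  {i : Fin n // fold i ≠ k} → Hist X A T

/-- A learner: for every sample size `n` and fold `k`, it turns the training sample of fold `k` into
functions of the history and the action, one for each stage, in a measurable way. -/
structure Learner (T : ℕ) (X : ℕ → Type*) (A : Type*) [∀ j, MeasurableSpace (X j)]
    [MeasurableSpace A] {K : ℕ} (fold : (n : ℕ) → Fin n → Fin K) where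
  /-- the fitted function -/
  fit : (n : ℕ) → (k : Fin K) → Train T X A (fold n) k → (t : Fin T) → Hist X A t → A → ℝ
  measurable_fit : ∀ n k (t : Fin T), Measurable
    fun x : Train T X A (fold n) k × Hist X A t × A => fit n k x.1 t x.2.1 x.2.2

section CrossFit

variable {T : ℕ} {X : ℕ → Type*} {A : Type*} [∀ j, MeasurableSpace (X j)] [MeasurableSpace A]
  {K : ℕ} {fold : (n : ℕ) → Fin n → Fin K} {Ω' : Type*}

/-- The training sample of fold `k` at sample size `n`, from the sequence `Z` of trajectories. -/
def trainSample (fold : (n : ℕ) → Fin n → Fin K) (Z : ℕ → Ω' → Hist X A T) (n : ℕ) (k : Fin K)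
    (w : Ω') : Train T X A (fold n) k :=
  fun i => Z (i : Fin n) w

/-- The function fitted by the learner on the training sample of fold `k`. -/
def Learner.fitted (L : Learner T X A fold) (Z : ℕ → Ω' → Hist X A T) (n : ℕ) (k : Fin K) (w : Ω') :
    (t : Fin T) → Hist X A t → A → ℝ :=
  L.fit n k (trainSample fold Z n k w)

/-- The cross-fitted ASRW estimator. -/
def asrw (lam : Measure A) (acts : Fin T → Set A) (γ : ℝ)
    (dir : (t : Fin T) → Hist X A t → A → ℝ) (LQ LH : Learner T X A fold)
    (Z : ℕ → Ω' → Hist X A T) (n : ℕ) (w : Ω') : ℝ :=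
  (1 / (n : ℝ)) * ∑ k : Fin K, ∑ i : Fin n with fold n i = k,
    augScore lam acts γ dir (LQ.fitted Z n k w) (LH.fitted Z n k w) (Z i w)

/-- The oracle estimator, which uses the true nuisance functions. -/
def oracleEst (lam : Measure A) (acts : Fin T → Set A) (γ : ℝ)
    (dir q H : (t : Fin T) → Hist X A t → A → ℝ)
    (Z : ℕ → Ω' → Hist X A T) (n : ℕ) (w : Ω') : ℝ :=
  (1 / (n : ℝ)) * ∑ i : Fin n, augScore lam acts γ dir q H (Z i w)

end CrossFit

/-- `Y n = o_p(r n)` for nonnegative extended random variables `Y n` and positive rates `r n`. -/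
def IsLittleOp {Ω' : Type*} [MeasurableSpace Ω'] (Q : Measure Ω') (Y : ℕ → Ω' → ℝ≥0∞)
    (r : ℕ → ℝ) : Prop :=
  ∀ δ : ℝ, 0 < δ → Tendsto (fun n => Q {w | ENNReal.ofReal (δ * r n) < Y n w}) atTop (𝓝 0)

end MPE

end

/-! Causal side. Call the product of the density ratios `π_ε / π` over the stages from `s` on the
weight of stage `s`. Consistency and sequential unconfoundedness give the g-formula
`lintegral_iterVal_eq_weight`: redrawing the actions from stage `s` on from a supported policy
multiplies the observed law by this weight. It has two consequences. For the baseline policy the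
weight is 1, so redrawing changes nothing. Hence `q` is the regression of `Γ_t` on `(S_t, A_t)`
(`condExp_cumReward`), and the residual `Γ_t - q_t` is orthogonal to the integrable functions of
`(S_t, A_t)` (`integral_mul_sub`). For `π_ε`, removing the ratios one stage at a time telescopes the
change in welfare (`expectedWelfare_sub`). Dividing by `ε` and passing to `L¹` limits stage by stage
gives the policy gradient (`hasDerivAt_expectedWelfare`).

Statistical side. Put `Δq = q̂ - q` and `ΔH = Ĥ - H`. For a fixed training sample the error of the
summand is `L - C`. At each stage `L` is `∫ Δq π' dλ - Δq H + ΔH (Γ - q)` and `C` is `Δq ΔH`, both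
discounted.

The linear part `L` has mean zero: `∫ Δq π' dλ` is the conditional mean of `Δq H` given `S_t`,
because `H = π'/π`, and the last term is orthogonality of the residual. Its second moment tends to
zero without any rate. By Jensen's inequality it suffices to treat `Δq H` and `ΔH (Γ - q)`. In the
first, `Δq` is bounded and `H` is one fixed square-integrable function, so truncating `H` suffices;
in the second the residual is bounded. Chebyshev's inequality then makes the sum of `L` over a fold
`o_p(√n)` (`exists_linError_bound`, `measure_pi_sum_ge_le`).

The product part `C` is not centred, and the rates are needed only here: `|Δq ΔH| ≤ c Δq² + c⁻¹ ΔH²`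
with `c = n^(αq - αH)` makes its `L¹` norm `o(n^(-1/2))`, and Markov's inequality applies
(`lintegral_prodError_le`).

Cross-fitting makes a fold independent of its training sample, so these bounds for fixed nuisance
functions integrate by Fubini's theorem (`tendsto_fold_error`). The oracle average obeys the central
limit theorem, its mean is the policy-gradient functional (`integral_augScore_oracle`), and
Slutsky's theorem transfers the limit to the cross-fitted estimator. -/

noncomputable section

namespace MPE

set_option linter.unusedSectionVars false

/-! ### Successive draws of actions as iterated integrals -/

section IteratedValue

variable {T : ℕ} {X : ℕ → Type*} {A : Type*} [∀ j, MeasurableSpace (X j)]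
  [MeasurableSpace A] {lam : Measure A} [SigmaFinite lam] {acts : Fin T → Set A}

lemma Policy.measurable_lintegral_kernel (p : Policy T X A lam acts) (t : Fin T) {α : Type*}
    [MeasurableSpace α] {σ : α → Hist X A t} (hσ : Measurable σ) {F : α → A → ℝ≥0∞}
    (hF : Measurable (Function.uncurry F)) :
    Measurable fun x => ∫⁻ b, F x b ∂(p.kernel t (σ x)) :=
  Measurable.lintegral_kernel_prod_right (κ := (p.kernel t).comap σ hσ) hF

/-- The mean of `f` over the trajectories `τ a`, where the entries of `a` from stage `s` on are
drawn successively from the policy. -/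
def iterVal (p : Policy T X A lam acts) (f : Hist X A T → ℝ≥0∞) (s : ℕ)
    (τ : (Fin T → A) → Hist X A T) (a : Fin T → A) : ℝ≥0∞ :=
  if h : s < T then
    ∫⁻ b, iterVal p f (s + 1) τ (Function.update a ⟨s, h⟩ b)
      ∂(p.kernel ⟨s, h⟩ (stateAt ⟨s, h⟩ (τ a)))
  else f (τ a)
  termination_by T - s

lemma iterVal_of_lt (p : Policy T X A lam acts) (f : Hist X A T → ℝ≥0∞) {s : ℕ} (h : s < T)
    (τ : (Fin T → A) → Hist X A T) (a : Fin T → A) :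
    iterVal p f s τ a = ∫⁻ b, iterVal p f (s + 1) τ (Function.update a ⟨s, h⟩ b)
      ∂(p.kernel ⟨s, h⟩ (stateAt ⟨s, h⟩ (τ a))) := by
  rw [iterVal, dif_pos h]

lemma iterVal_of_le (p : Policy T X A lam acts) (f : Hist X A T → ℝ≥0∞) {s : ℕ} (h : T ≤ s)
    (τ : (Fin T → A) → Hist X A T) (a : Fin T → A) :
    iterVal p f s τ a = f (τ a) := by
  rw [iterVal, dif_neg (by omega)]

/-- Induction over the stages, from the last one to the first one. -/
lemma stage_induction {T : ℕ} {motive : ℕ → Prop} (h0 : ∀ s, T ≤ s → motive s)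
    (h1 : ∀ s, s < T → motive (s + 1) → motive s) (s : ℕ) : motive s := by
  induction hk : T - s generalizing s with
  | zero => exact h0 s (by omega)
  | succ k ih => exact h1 s (by omega) (ih (s + 1) (by omega))

/-- The parameter space is arbitrary because two are needed: `Ω` itself, and histories paired with a
space that carries only the sigma-algebra of the future potential outcomes. -/
lemma measurable_iterVal (p : Policy T X A lam acts) {f : Hist X A T → ℝ≥0∞} (hf : Measurable f)
    {α : Type*} [MeasurableSpace α] {τ : α → (Fin T → A) → Hist X A T}
    (hτ : Measurable (Function.uncurry τ)) (s : ℕ) :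
    Measurable fun x : α × (Fin T → A) => iterVal p f s (τ x.1) x.2 := by
  induction s using stage_induction (T := T) with
  | h0 s h =>
    simp_rw [iterVal_of_le p f h]
    exact hf.comp hτ
  | h1 s h ih =>
    simp_rw [iterVal_of_lt p f h]
    have h2 : Measurable fun y : (α × (Fin T → A)) × A =>
        (y.1.1, Function.update y.1.2 ⟨s, h⟩ y.2) := by
      refine (measurable_fst.comp measurable_fst).prodMk ?_
      exact measurable_update'.comp ((measurable_snd.comp measurable_fst).prodMk measurable_snd)
    exact p.measurable_lintegral_kernel ⟨s, h⟩ ((measurable_stateAt _).comp hτ) (ih.comp h2)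

/-- The history of stage `t` depends only on the actions before stage `t`. -/
def NonAnticipative (τ : (Fin T → A) → Hist X A T) : Prop :=
  ∀ (t : Fin T) (a a' : Fin T → A), (∀ i < t, a i = a' i) → stateAt t (τ a) = stateAt t (τ a')

/-- Entries from stage `s` on are overwritten before they can matter, and by non-anticipation the
history that determines the next draw does not see them. So both the tail of the action vector and
the values of the trajectory map at other pasts are irrelevant. -/
lemma iterVal_congr (p : Policy T X A lam acts) (f : Hist X A T → ℝ≥0∞)
    {τ τ' : (Fin T → A) → Hist X A T} (hτ : NonAnticipative τ) (s : ℕ) :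
    ∀ {a a' : Fin T → A}, (∀ i : Fin T, (i : ℕ) < s → a i = a' i) →
      (∀ c : Fin T → A, (∀ i : Fin T, (i : ℕ) < s → c i = a i) → τ' c = τ c) →
      iterVal p f s τ a = iterVal p f s τ' a' := by
  induction s using stage_induction (T := T) with
  | h0 s h =>
    intro a a' haa hc
    have : a = a' := funext fun i => haa i (by omega)
    subst this
    rw [iterVal_of_le p f h, iterVal_of_le p f h, hc a fun _ _ => rfl]
  | h1 s h ih =>
    intro a a' haa hc
    rw [iterVal_of_lt p f h, iterVal_of_lt p f h, hc a' fun i hi => (haa i hi).symm,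
      hτ ⟨s, h⟩ a a' fun i hi => haa i hi]
    refine lintegral_congr fun b => ih (fun i hi => ?_) fun c hcc => hc c fun i hi => ?_
    · by_cases his : i = ⟨s, h⟩
      · subst his; simp
      · have : (i : ℕ) ≠ s := fun h' => his (Fin.ext h')
        simp [Function.update_of_ne his, haa i (by omega)]
    · have his : i ≠ ⟨s, h⟩ := fun h' => by simp [h'] at hi
      rw [hcc i (by omega), Function.update_of_ne his]

/-- A factor fixed by the actions before stage `s` is constant under the remaining draws and comes
out of all the integrals; finiteness of `r` allows this without measurability. -/
lemma iterVal_mul (p : Policy T X A lam acts) (f g : Hist X A T → ℝ≥0∞)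
    (τ : (Fin T → A) → Hist X A T) {r : ℝ≥0∞} (hr : r ≠ ∞) (s : ℕ) :
    ∀ {a : Fin T → A},
      (∀ c : Fin T → A, (∀ i : Fin T, (i : ℕ) < s → c i = a i) → g (τ c) = r) →
      iterVal p (fun z => g z * f z) s τ a = r * iterVal p f s τ a := by
  induction s using stage_induction (T := T) with
  | h0 s h =>
    intro a hc
    rw [iterVal_of_le p _ h, iterVal_of_le p _ h, hc a fun _ _ => rfl]
  | h1 s h ih =>
    intro a hc
    rw [iterVal_of_lt p _ h, iterVal_of_lt p _ h, ← lintegral_const_mul' _ _ hr]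
    refine lintegral_congr fun b => ih fun c hcc => hc c fun i hi => ?_
    have his : i ≠ ⟨s, h⟩ := fun h' => by simp [h'] at hi
    rw [hcc i (by omega), Function.update_of_ne his]

namespace Model

variable {Ω : Type*} [mΩ : MeasurableSpace Ω] (M : Model T X A Ω)

lemma nonAnticipative_poTraj (ω : Ω) : NonAnticipative (M.poTraj ω) := by
  intro t a a' h
  have key : ∀ (m : ℕ) (hm : m ≤ T), m ≤ t → firstActions m hm a = firstActions m hm a' :=
    fun m hm hmt => funext fun i => h _ (Fin.lt_def.2 (by simp; omega))
  refine Prod.ext ?_ (Prod.ext ?_ ?_)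
  · funext j
    exact congrArg _ (key _ _ (by simp; omega))
  · funext i
    exact h _ (Fin.lt_def.2 (by simp))
  · funext i
    exact congrArg _ (key _ _ (by simp))

lemma lintegral_drawStep (p : Policy T X A lam acts) (t : Fin T) {g : Ω × (Fin T → A) → ℝ≥0∞}
    (hg : Measurable g) (ω : Ω) (a : Fin T → A) :
    ∫⁻ x, g x ∂(M.drawStep p t (ω, a)) =
      ∫⁻ b, g (ω, Function.update a t b) ∂(p.kernel t (stateAt t (M.poTraj ω a))) := by
  have h2 : Measurable fun y : (Ω × (Fin T → A)) × A =>
      (y.1.1, Function.update y.1.2 t y.2) := by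
    refine (measurable_fst.comp measurable_fst).prodMk ?_
    exact measurable_update'.comp ((measurable_snd.comp measurable_fst).prodMk measurable_snd)
  rw [drawStep, Kernel.lintegral_map _ h2 _ hg]
  exact (Kernel.lintegral_id_prod (hg.comp h2) _ _).trans (by rw [Kernel.comap_apply]; rfl)

/-- Bridge between the kernel definition of the evolution and the iterated integrals, in which all
later computations take place. -/
lemma lintegral_rollout (p : Policy T X A lam acts) {f : Hist X A T → ℝ≥0∞} (hf : Measurable f)
    (s : ℕ) : ∀ (ω : Ω) (a : Fin T → A),
    ∫⁻ x, f (M.poTraj x.1 x.2) ∂(M.rollout p s (ω, a)) = iterVal p f s (M.poTraj ω) a := by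
  have hfm : Measurable fun x : Ω × (Fin T → A) => f (M.poTraj x.1 x.2) :=
    hf.comp M.measurable_poTraj
  induction s using stage_induction (T := T) with
  | h0 s h =>
    intro ω a
    rw [rollout, dif_neg (by omega), iterVal_of_le p f h, Kernel.id_apply, lintegral_dirac' _ hfm]
  | h1 s h ih =>
    intro ω a
    rw [rollout, dif_pos h, iterVal_of_lt p f h, Kernel.lintegral_comp _ _ _ hfm]
    have : ∀ x : Ω × (Fin T → A), ∫⁻ y, f (M.poTraj y.1 y.2) ∂(M.rollout p (s + 1) x) =
        iterVal p f (s + 1) (M.poTraj x.1) x.2 := fun x => ih x.1 x.2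
    simp_rw [this]
    exact M.lintegral_drawStep p ⟨s, h⟩ (measurable_iterVal p hf M.measurable_poTraj (s + 1)) ω a

end Model

end IteratedValue

/-! ### Conditional independence as a disintegration -/

section Unconfounded

/-- If `U` is conditionally independent of `G` given `S`, and the conditional law of `U` given `S`
is the kernel `κ`, then the conditional law of `U` given `(S, G)` is `κ` as well. -/
lemma map_prodMk_of_condIndepGiven {Ω E S U : Type*} [MeasurableSpace E] [MeasurableSpace S]
    [MeasurableSpace U] [mΩ : MeasurableSpace Ω] {P : Measure Ω} [IsProbabilityMeasure P]
    {G : Ω → E} {Y : Ω → S} {V : Ω → U} (hG : Measurable G) (hY : Measurable Y)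
    (hV : Measurable V) (κ : Kernel S U) [IsMarkovKernel κ]
    (hκ : P.map (fun ω => (Y ω, V ω)) = (P.map Y) ⊗ₘ κ)
    (hci : CondIndepGiven (MeasurableSpace.comap Y inferInstance)
      (MeasurableSpace.comap V inferInstance) (MeasurableSpace.comap G inferInstance) P) :
    P.map (fun ω => ((Y ω, G ω), V ω)) =
      (P.map fun ω => (Y ω, G ω)) ⊗ₘ (κ.comap Prod.fst measurable_fst) := by
  have : IsProbabilityMeasure (P.map Y) := Measure.isProbabilityMeasure_map hY.aemeasurable
  have : IsProbabilityMeasure (P.map fun ω => (Y ω, G ω)) :=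
    Measure.isProbabilityMeasure_map (hY.prodMk hG).aemeasurable
  have : IsProbabilityMeasure (P.map (fun ω => ((Y ω, G ω), V ω))) :=
    Measure.isProbabilityMeasure_map ((hY.prodMk hG).prodMk hV).aemeasurable
  have hm : MeasurableSpace.comap Y inferInstance ≤ mΩ := hY.comap_le
  refine Measure.ext_prod₃_iff'.2 fun {s g u} hs hg hu => ?_
  have hκu : Measurable fun y => (κ y).real u := (κ.measurable_coe hu).ennreal_toReal
  -- The disintegration of the law of `(Y, V)`, tested on rectangles, identifies `κ (Y) u` as the
  -- conditional probability of `V ∈ u` given `Y`.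
  have hcu : (fun ω => (κ (Y ω)).real u) =ᵐ[P]
      P[(V ⁻¹' u).indicator (fun _ => (1 : ℝ)) | MeasurableSpace.comap Y inferInstance] := by
    refine ae_eq_condExp_of_forall_setIntegral_eq hm
      ((integrable_const 1).indicator (hV hu)) (fun s _ _ => ?_) ?_ ?_
    · refine Integrable.integrableOn (Integrable.of_bound (C := 1)
        (hκu.comp hY).aestronglyMeasurable (ae_of_all _ fun ω => ?_))
      simp only [Real.norm_eq_abs, abs_of_nonneg measureReal_nonneg]
      exact measureReal_le_one
    · rintro _ ⟨s, hs, rfl⟩ -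
      rw [← integral_indicator (hY hs), integral_indicator (hY hs), setIntegral_indicator (hV hu),
        setIntegral_const, smul_eq_mul, mul_one]
      have h1 := congrArg (fun μ => μ (s ×ˢ u)) hκ
      simp only [Measure.compProd_apply_prod hs hu] at h1
      rw [Measure.map_apply (hY.prodMk hV) (hs.prod hu), setLIntegral_map hs
        (κ.measurable_coe hu) hY] at h1
      rw [integral_eq_lintegral_of_nonneg_ae (ae_of_all _ fun _ => measureReal_nonneg)
        (hκu.comp hY).aestronglyMeasurable]
      simp only [measureReal_def, ENNReal.ofReal_toReal (measure_ne_top _ _)]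
      rw [← h1]
      rfl
    · exact (hκu.stronglyMeasurable.comp_measurable (comap_measurable Y)).aestronglyMeasurable
  have h2 := hci (V ⁻¹' u) (G ⁻¹' g) ⟨u, hu, rfl⟩ ⟨g, hg, rfl⟩
  have hint : Integrable ((V ⁻¹' u ∩ G ⁻¹' g).indicator fun _ => (1 : ℝ)) P :=
    (integrable_const 1).indicator ((hV hu).inter (hG hg))
  have hbd : Integrable ((fun ω => (κ (Y ω)).real u) *
      (G ⁻¹' g).indicator fun _ => (1 : ℝ)) P := by
    refine Integrable.of_bound (C := 1) (((hκu.comp hY).mul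
      (measurable_const.indicator (hG hg))).aestronglyMeasurable) (ae_of_all _ fun ω => ?_)
    by_cases hω : ω ∈ G ⁻¹' g <;> simp [hω, abs_of_nonneg, measureReal_le_one]
  have h3 := condExp_mul_of_stronglyMeasurable_left (m := MeasurableSpace.comap Y inferInstance)
    (μ := P) (hκu.stronglyMeasurable.comp_measurable (comap_measurable Y)) hbd
    ((integrable_const 1).indicator (hG hg))
  -- Given `Y`, the conditional probability of `V ∈ u, G ∈ g` factorizes; the factor `κ (Y) u` is
  -- `Y`-measurable and moves back inside the conditional expectation of the indicator of `G ∈ g`.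
  have h4 : P.real (Y ⁻¹' s ∩ (V ⁻¹' u ∩ G ⁻¹' g)) =
      ∫ ω in Y ⁻¹' s ∩ G ⁻¹' g, (κ (Y ω)).real u ∂P := by
    calc P.real (Y ⁻¹' s ∩ (V ⁻¹' u ∩ G ⁻¹' g))
        = ∫ ω in Y ⁻¹' s, (V ⁻¹' u ∩ G ⁻¹' g).indicator (fun _ => (1 : ℝ)) ω ∂P := by
          rw [setIntegral_indicator ((hV hu).inter (hG hg)), setIntegral_const, smul_eq_mul,
            mul_one]
      _ = ∫ ω in Y ⁻¹' s, ((fun ω => (κ (Y ω)).real u) *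
            (G ⁻¹' g).indicator fun _ => (1 : ℝ)) ω ∂P := by
          rw [← setIntegral_condExp hm hint ⟨s, hs, rfl⟩,
            ← setIntegral_condExp hm hbd ⟨s, hs, rfl⟩]
          refine integral_congr_ae (ae_restrict_of_ae ?_)
          filter_upwards [h2, h3, hcu] with ω e1 e2 e3
          refine e1.trans (Eq.trans ?_ e2.symm)
          rw [Pi.mul_apply, Pi.mul_apply, ← e3]
          rfl
      _ = _ := by
          rw [← setIntegral_indicator (hG hg)]
          refine integral_congr_ae (ae_of_all _ fun ω => ?_)
          by_cases hω : ω ∈ G ⁻¹' g <;> simp [hω]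
  rw [Measure.map_apply ((hY.prodMk hG).prodMk hV) ((hs.prod hg).prod hu),
    Measure.compProd_apply_prod (hs.prod hg) hu]
  simp only [Kernel.comap_apply]
  have h8 := setLIntegral_map (μ := P) (f := fun y : S × E => κ y.1 u) (hs.prod hg)
    ((κ.measurable_coe hu).comp measurable_fst) (hY.prodMk hG)
  rw [h8]
  have h5 : ∫⁻ ω in Y ⁻¹' s ∩ G ⁻¹' g, κ (Y ω) u ∂P =
      ENNReal.ofReal (∫ ω in Y ⁻¹' s ∩ G ⁻¹' g, (κ (Y ω)).real u ∂P) := by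
    rw [ofReal_integral_eq_lintegral_ofReal]
    · simp [measureReal_def]
    · refine Integrable.integrableOn (Integrable.of_bound (C := 1)
        (hκu.comp hY).aestronglyMeasurable (ae_of_all _ fun ω => ?_))
      simp [abs_of_nonneg, measureReal_le_one]
    · exact ae_of_all _ fun _ => measureReal_nonneg
  have h6 : (fun ω => ((Y ω, G ω), V ω)) ⁻¹' ((s ×ˢ g) ×ˢ u) =
      Y ⁻¹' s ∩ (V ⁻¹' u ∩ G ⁻¹' g) := by
    ext ω; simp; tauto
  have h7 : (fun ω => (Y ω, G ω)) ⁻¹' (s ×ˢ g) = Y ⁻¹' s ∩ G ⁻¹' g := rfl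
  rw [h6, h7, h5, ← h4, ofReal_measureReal]

end Unconfounded

/-! ### Policy densities and their ratios -/

section Density

variable {T : ℕ} {X : ℕ → Type*} {A : Type*} [∀ j, MeasurableSpace (X j)]
  [MeasurableSpace A] {lam : Measure A} {acts : Fin T → Set A}

lemma Policy.measurable_dens_left (p : Policy T X A lam acts) (t : Fin T) (s : Hist X A t) :
    Measurable (p.dens t s) :=
  (p.measurable_dens t).comp measurable_prodMk_left

/-- The ratio of the densities of two policies. -/
def ratio (p p₀ : Policy T X A lam acts) (t : Fin T) (s : Hist X A t) (a : A) : ℝ :=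
  p.dens t s a / p₀.dens t s a

lemma ratio_nonneg (p p₀ : Policy T X A lam acts) (t : Fin T) (s : Hist X A t) (a : A) :
    0 ≤ ratio p p₀ t s a :=
  div_nonneg (p.dens_nonneg t s a) (p₀.dens_nonneg t s a)

lemma measurable_ratio (p p₀ : Policy T X A lam acts) (t : Fin T) :
    Measurable (Function.uncurry (ratio p p₀ t)) :=
  (p.measurable_dens t).div (p₀.measurable_dens t)

/-- The product of the density ratios from stage `s` on. -/
def weight (p p₀ : Policy T X A lam acts) (s : ℕ) (z : Hist X A T) : ℝ :=
  ∏ k ∈ Finset.univ.filter fun k : Fin T => s ≤ (k : ℕ),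
    ratio p p₀ k (stateAt k z) (actionAt k z)

lemma weight_nonneg (p p₀ : Policy T X A lam acts) (s : ℕ) (z : Hist X A T) :
    0 ≤ weight p p₀ s z :=
  Finset.prod_nonneg fun _ _ => ratio_nonneg _ _ _ _ _

lemma weight_of_le (p p₀ : Policy T X A lam acts) {s : ℕ} (h : T ≤ s) (z : Hist X A T) :
    weight p p₀ s z = 1 := by
  rw [weight, Finset.filter_false_of_mem (fun k _ => by have := k.2; omega), Finset.prod_empty]

lemma weight_of_lt (p p₀ : Policy T X A lam acts) {s : ℕ} (h : s < T) (z : Hist X A T) :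
    weight p p₀ s z =
      ratio p p₀ ⟨s, h⟩ (stateAt ⟨s, h⟩ z) (actionAt ⟨s, h⟩ z) * weight p p₀ (s + 1) z := by
  have : (Finset.univ.filter fun k : Fin T => s ≤ (k : ℕ)) =
      insert ⟨s, h⟩ (Finset.univ.filter fun k : Fin T => s + 1 ≤ (k : ℕ)) := by
    ext k
    simp only [Finset.mem_filter, Finset.mem_univ, true_and, Finset.mem_insert, Fin.ext_iff]
    omega
  rw [weight, this, Finset.prod_insert (by simp)]
  rfl

lemma measurable_actionAt (t : Fin T) : Measurable (actionAt (X := X) (A := A) t) :=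
  (measurable_pi_apply t).comp (measurable_fst.comp measurable_snd)

lemma measurable_stage {β : Type*} [MeasurableSpace β] {t : Fin T} {f : Hist X A t → A → β}
    (hf : Measurable (Function.uncurry f)) :
    Measurable fun z : Hist X A T => f (stateAt t z) (actionAt t z) :=
  hf.comp ((measurable_stateAt t).prodMk (measurable_actionAt t))

lemma measurable_weight (p p₀ : Policy T X A lam acts) (s : ℕ) :
    Measurable (weight p p₀ s) :=
  Finset.measurable_fun_prod _ fun k _ => measurable_stage (measurable_ratio p p₀ k)

variable [SigmaFinite lam]

lemma Policy.kernel_apply (p : Policy T X A lam acts) (t : Fin T) (s : Hist X A t) :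
    p.kernel t s =
      (lam.restrict (acts t)).withDensity fun a => ENNReal.ofReal (p.dens t s a) := by
  have hm : Measurable (Function.uncurry fun s a => ENNReal.ofReal (p.dens t s a)) :=
    (p.measurable_dens t).ennreal_ofReal
  rw [Policy.kernel, Kernel.withDensity_apply _ hm, Kernel.const_apply]

lemma Policy.lintegral_kernel (p : Policy T X A lam acts) (t : Fin T) (s : Hist X A t)
    (F : A → ℝ≥0∞) :
    ∫⁻ b, F b ∂(p.kernel t s) =
      ∫⁻ b in acts t, ENNReal.ofReal (p.dens t s b) * F b ∂lam := by
  rw [p.kernel_apply, lintegral_withDensity_eq_lintegral_mul_non_measurable _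
    (p.measurable_dens_left t s).ennreal_ofReal (ae_of_all _ fun _ => ENNReal.ofReal_lt_top)]
  rfl

lemma Policy.ae_dens_pos (p : Policy T X A lam acts) (t : Fin T) (s : Hist X A t) :
    ∀ᵐ a ∂(p.kernel t s), 0 < p.dens t s a := by
  rw [p.kernel_apply, ae_withDensity_iff (p.measurable_dens_left t s).ennreal_ofReal]
  refine ae_of_all _ fun a ha => ?_
  simpa using ha

lemma ae_dens_eq_zero_of_absolutelyContinuous {p p₀ : Policy T X A lam acts} {t : Fin T}
    {s : Hist X A t} (h : p.kernel t s ≪ p₀.kernel t s) :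
    ∀ᵐ a ∂(lam.restrict (acts t)), p₀.dens t s a = 0 → p.dens t s a = 0 := by
  have h1 : ∀ᵐ a ∂(p.kernel t s), 0 < p₀.dens t s a := h.ae_le (p₀.ae_dens_pos t s)
  rw [p.kernel_apply, ae_withDensity_iff (p.measurable_dens_left t s).ennreal_ofReal] at h1
  filter_upwards [h1] with a ha h0
  by_contra hne
  have hpos : 0 < p.dens t s a := lt_of_le_of_ne (p.dens_nonneg t s a) (Ne.symm hne)
  exact (ha (by simpa using hpos)).ne' h0

/-- Change of measure between policies. Where the baseline density vanishes the ratio is `0` by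
convention, which is harmless because absolute continuity makes the other density vanish there too.
-/
lemma lintegral_kernel_eq_ratio {p p₀ : Policy T X A lam acts} {t : Fin T}
    {s : Hist X A t} (h : p.kernel t s ≪ p₀.kernel t s) (F : A → ℝ≥0∞) :
    ∫⁻ b, F b ∂(p.kernel t s) =
      ∫⁻ b, ENNReal.ofReal (ratio p p₀ t s b) * F b ∂(p₀.kernel t s) := by
  rw [p.lintegral_kernel, p₀.lintegral_kernel]
  refine lintegral_congr_ae ?_
  filter_upwards [ae_dens_eq_zero_of_absolutelyContinuous h] with a ha
  rw [← mul_assoc, ← ENNReal.ofReal_mul (p₀.dens_nonneg t s a), ratio]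
  rcases eq_or_ne (p₀.dens t s a) 0 with h0 | h0
  · simp [h0, ha h0]
  · rw [mul_div_cancel₀ _ h0]

end Density

/-! ### The g-formula -/

namespace Model

variable {T : ℕ} {X : ℕ → Type*} {A : Type*} {Ω : Type*} [∀ j, MeasurableSpace (X j)]
  [MeasurableSpace A] [mΩ : MeasurableSpace Ω] {M : Model T X A Ω}
  {lam : Measure A} [SigmaFinite lam] {acts : Fin T → Set A} {P : Measure Ω}
  {p₀ : Policy T X A lam acts}

lemma measurable_state (M : Model T X A Ω) (t : Fin T) : Measurable (M.state t) :=
  (measurable_stateAt t).comp M.measurable_traj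

lemma measurable_state_act (M : Model T X A Ω) (t : Fin T) :
    Measurable fun ω => (M.state t ω, M.act t ω) :=
  (M.measurable_state t).prodMk (M.measurable_act t)

lemma FollowsPolicy.lintegral_act [IsProbabilityMeasure P] (hp : M.FollowsPolicy P p₀) (t : Fin T)
    {F : Hist X A t → A → ℝ≥0∞} (hF : Measurable (Function.uncurry F)) :
    ∫⁻ ω, F (M.state t ω) (M.act t ω) ∂P =
      ∫⁻ ω, ∫⁻ b, F (M.state t ω) b ∂(p₀.kernel t (M.state t ω)) ∂P := by
  have : IsProbabilityMeasure (P.map (M.state t)) :=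
    Measure.isProbabilityMeasure_map (M.measurable_state t).aemeasurable
  have h := lintegral_map (μ := P) hF (M.measurable_state_act t)
  rw [hp t, Measure.lintegral_compProd hF] at h
  refine h.symm.trans (lintegral_map ?_ (M.measurable_state t))
  exact p₀.measurable_lintegral_kernel t measurable_id hF

/-- The trajectory under the actions `c` from stage `t` on, for a given history up to stage `t` and
the potential outcomes of a unit. -/
def continuation (M : Model T X A Ω) (t : Fin T) {E : Type*} (e : E → Ω)
    (x : Hist X A t × E) (c : Fin T → A) : Hist X A T :=
  (fun j => if h : (t : ℕ) < j then (M.poTraj (e x.2) (splice (M.actions (e x.2)) t c)).1 j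
      else x.1.1 ⟨j, by omega⟩,
    fun i => if h : t ≤ i then c i else x.1.2.1 ⟨i, by rw [not_le] at h; exact h⟩,
    fun k => if h : t ≤ k then (M.poTraj (e x.2) (splice (M.actions (e x.2)) t c)).2.2 k
      else x.1.2.2 ⟨k, by rw [not_le] at h; exact h⟩)

/-- The past coordinates are read off the history and the future ones off the potential outcomes, so
nothing else about the unit has to be measurable for the sigma-algebra on `E`; the observed actions
inside `splice`, in particular, need not be. -/
lemma measurable_continuation {t : Fin T} {E : Type*} [MeasurableSpace E] {e : E → Ω}
    (hcov : ∀ j : Fin (T + 1), (t : ℕ) < j → Measurable fun x : E × (Fin T → A) =>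
      (M.poTraj (e x.1) (splice (M.actions (e x.1)) t x.2)).1 j)
    (hrew : ∀ k : Fin T, t ≤ k → Measurable fun x : E × (Fin T → A) =>
      (M.poTraj (e x.1) (splice (M.actions (e x.1)) t x.2)).2.2 k) :
    Measurable (Function.uncurry (M.continuation t e)) := by
  have hproj : Measurable fun y : (Hist X A t × E) × (Fin T → A) =>
      ((y.1.2, y.2) : E × (Fin T → A)) :=
    (measurable_snd.comp measurable_fst).prodMk measurable_snd
  have hhist : Measurable fun y : (Hist X A t × E) × (Fin T → A) => y.1.1 :=
    measurable_fst.comp measurable_fst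
  refine Measurable.prodMk (measurable_pi_lambda _ fun j => ?_) (Measurable.prodMk
    (measurable_pi_lambda _ fun i => ?_) (measurable_pi_lambda _ fun k => ?_))
  · by_cases hj : (t : ℕ) < j
    · simp only [hj, dif_pos]
      exact (hcov j hj).comp hproj
    · simp only [hj, dif_neg, not_false_eq_true]
      exact (measurable_pi_apply _).comp (measurable_fst.comp hhist)
  · by_cases hi : t ≤ i
    · simp only [hi, dif_pos]
      exact (measurable_pi_apply i).comp measurable_snd
    · simp only [hi, dif_neg, not_false_eq_true]
      exact (measurable_pi_apply _).comp (measurable_fst.comp (measurable_snd.comp hhist))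
  · by_cases hk : t ≤ k
    · simp only [hk, dif_pos]
      exact (hrew k hk).comp hproj
    · simp only [hk, dif_neg, not_false_eq_true]
      exact (measurable_pi_apply _).comp (measurable_snd.comp (measurable_snd.comp hhist))

/-- By consistency the observed past consists of the potential outcomes at the realized actions.
These see only actions before stage `t`, which splicing leaves unchanged. -/
lemma continuation_state {t : Fin T} {E : Type*} {e : E → Ω} {G : Ω → E}
    (he : ∀ ω, e (G ω) = ω) {ω : Ω}
    (hω : M.traj ω = M.poTraj ω (M.actions ω)) (c : Fin T → A) :
    M.continuation t e (M.state t ω, G ω) c = M.poTraj ω (splice (M.actions ω) t c) := by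
  have key : ∀ (m : ℕ) (hm : m ≤ T), m ≤ t →
      firstActions m hm (M.actions ω) = firstActions m hm (splice (M.actions ω) t c) := by
    intro m hm hmt
    funext i
    have : Fin.castLE hm i < t := Fin.lt_def.2 (by simp; omega)
    simp [firstActions, splice, this]
  refine Prod.ext (funext fun j => ?_) (Prod.ext (funext fun i => ?_) (funext fun k => ?_))
  · by_cases hj : (t : ℕ) < j
    · simp [continuation, hj, he]
    · simp only [continuation, hj, dif_neg, not_false_eq_true]
      have h1 := congrFun (congrArg Prod.fst hω) j
      exact h1.trans (congrArg _ (key _ _ (by omega)))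
  · by_cases hi : t ≤ i
    · simp [continuation, hi, poTraj, splice, not_lt.2 hi]
    · simp only [continuation, hi, dif_neg, not_false_eq_true, poTraj, splice, not_le.1 hi, if_true]
      rfl
  · by_cases hk : t ≤ k
    · simp [continuation, hk, he]
    · simp only [continuation, hk, dif_neg, not_false_eq_true]
      have h1 := congrFun (congrArg (fun z => z.2.2) hω) k
      exact h1.trans (congrArg _ (key _ _ (by rw [not_le] at hk; exact hk)))

/-- Conditionally on the history, the action of stage `t` is a draw from the policy that is
independent of the mean value of any way to continue. -/
lemma lintegral_iterVal_act_of_condIndepGiven [IsProbabilityMeasure P] (hcons : M.Consistency P)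
    (hp : M.FollowsPolicy P p₀) (p : Policy T X A lam acts) (t : Fin T)
    {E : Type*} [MeasurableSpace E] {e : E → Ω} {G : Ω → E} (hG : Measurable G)
    (he : ∀ ω, e (G ω) = ω)
    (hcov : ∀ j : Fin (T + 1), (t : ℕ) < j → Measurable fun x : E × (Fin T → A) =>
      (M.poTraj (e x.1) (splice (M.actions (e x.1)) t x.2)).1 j)
    (hrew : ∀ k : Fin T, t ≤ k → Measurable fun x : E × (Fin T → A) =>
      (M.poTraj (e x.1) (splice (M.actions (e x.1)) t x.2)).2.2 k)
    (hci : CondIndepGiven (MeasurableSpace.comap (M.state t) inferInstance)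
      (MeasurableSpace.comap (M.act t) inferInstance) (MeasurableSpace.comap G inferInstance) P)
    {f : Hist X A T → ℝ≥0∞} (hf : Measurable f)
    {g : Hist X A t → A → ℝ≥0∞} (hg : Measurable (Function.uncurry g)) :
    ∫⁻ ω, g (M.state t ω) (M.act t ω) * iterVal p f (t + 1) (M.poTraj ω) (M.actions ω) ∂P =
      ∫⁻ ω, ∫⁻ b, g (M.state t ω) b *
        iterVal p f (t + 1) (M.poTraj ω) (Function.update (M.actions ω) t b)
          ∂(p₀.kernel t (M.state t ω)) ∂P := by
  have hS := M.measurable_state t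
  have hlaw : P.map (fun ω => ((M.state t ω, G ω), M.act t ω)) =
      (P.map fun ω => (M.state t ω, G ω)) ⊗ₘ ((p₀.kernel t).comap Prod.fst measurable_fst) :=
    map_prodMk_of_condIndepGiven hG hS (M.measurable_act t) _ (hp t) hci
  -- An action vector computed from `(S_t, b)` alone. Its entries after stage `t` are placeholders,
  -- since the rollout from stage `t + 1` overwrites them.
  let start : Hist X A t → A → Fin T → A := fun s b i =>
    if h : t ≤ i then b else s.2.1 ⟨i, by rw [not_le] at h; exact h⟩
  have hstart : Measurable (Function.uncurry start) := by
    refine measurable_pi_lambda _ fun i => ?_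
    by_cases hi : t ≤ i
    · simp only [Function.uncurry, start, hi, dif_pos]
      exact measurable_snd
    · simp only [Function.uncurry, start, hi, dif_neg, not_false_eq_true]
      exact (measurable_pi_apply _).comp
        (measurable_fst.comp (measurable_snd.comp measurable_fst))
  -- The integrand as a function of `((S_t, G), A_t)`, the triple whose law `hlaw` disintegrates.
  let Φ : (Hist X A t × E) → A → ℝ≥0∞ := fun x b =>
    g x.1 b * iterVal p f (t + 1) (M.continuation t e x) (start x.1 b)
  have hΦ : Measurable (Function.uncurry Φ) := by
    have h1 : Measurable fun y : (Hist X A t × E) × A => (y.1.1, y.2) :=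
      (measurable_fst.comp measurable_fst).prodMk measurable_snd
    exact (hg.comp h1).mul ((measurable_iterVal p hf (measurable_continuation hcov hrew) (t + 1)).comp
      (measurable_fst.prodMk (hstart.comp h1)))
  have hΦeq : ∀ᵐ ω ∂P, ∀ b, g (M.state t ω) b *
      iterVal p f (t + 1) (M.poTraj ω) (Function.update (M.actions ω) t b) =
        Φ (M.state t ω, G ω) b := by
    filter_upwards [hcons] with ω hω b
    refine congrArg (g (M.state t ω) b * ·) ?_
    refine iterVal_congr p f (M.nonAnticipative_poTraj ω) _ (fun i hi => ?_) fun c hc => ?_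
    · by_cases hit : i = t
      · subst hit; simp [start]
      · have : ¬ t ≤ i := fun h => hit (le_antisymm (Fin.le_def.2 (by omega)) h)
        simp only [start, this, dif_neg, not_false_eq_true, Function.update_of_ne hit]
        rfl
    · refine (continuation_state he hω c).trans (congrArg _ (funext fun i => ?_))
      by_cases hi : i < t
      · have := hc i (by have := Fin.lt_def.1 hi; omega)
        simp [splice, hi, this, Function.update_of_ne hi.ne]
      · simp [splice, hi]
  have : IsProbabilityMeasure (P.map fun ω => (M.state t ω, G ω)) :=
    Measure.isProbabilityMeasure_map (hS.prodMk hG).aemeasurable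
  have h1 := lintegral_map (μ := P) hΦ ((hS.prodMk hG).prodMk (M.measurable_act t))
  rw [hlaw, Measure.lintegral_compProd hΦ] at h1
  have h2 : Measurable fun x : Hist X A t × E =>
      ∫⁻ b, Φ x b ∂(p₀.kernel t x.1) :=
    p₀.measurable_lintegral_kernel t measurable_fst hΦ
  calc _ = ∫⁻ ω, Φ (M.state t ω, G ω) (M.act t ω) ∂P := by
        refine lintegral_congr_ae ?_
        filter_upwards [hΦeq] with ω hω
        rw [← hω, show M.act t ω = M.actions ω t from rfl, Function.update_eq_self]
    _ = ∫⁻ ω, ∫⁻ b, Φ (M.state t ω, G ω) b ∂(p₀.kernel t (M.state t ω)) ∂P :=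
        h1.symm.trans (lintegral_map h2 (hS.prodMk hG))
    _ = _ := by
        refine lintegral_congr_ae ?_
        filter_upwards [hΦeq] with ω hω
        exact lintegral_congr fun b => (hω b).symm

/-- The space `E` is `Ω` with the sigma-algebra `𝒢` of unconfoundedness, and both maps are the
identity. Two sigma-algebras on `Ω` are then in play, hence the explicit arguments. -/
lemma lintegral_iterVal_act [IsProbabilityMeasure P] (hcons : M.Consistency P)
    (hSU : M.SequentialUnconfoundedness P) (hp : M.FollowsPolicy P p₀)
    (p : Policy T X A lam acts) (t : Fin T) {f : Hist X A T → ℝ≥0∞} (hf : Measurable f)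
    {g : Hist X A t → A → ℝ≥0∞} (hg : Measurable (Function.uncurry g)) :
    ∫⁻ ω, g (M.state t ω) (M.act t ω) * iterVal p f (t + 1) (M.poTraj ω) (M.actions ω) ∂P =
      ∫⁻ ω, ∫⁻ b, g (M.state t ω) b *
        iterVal p f (t + 1) (M.poTraj ω) (Function.update (M.actions ω) t b)
          ∂(p₀.kernel t (M.state t ω)) ∂P := by
  obtain ⟨𝒢, h⟩ := hSU t
  refine @lintegral_iterVal_act_of_condIndepGiven T X A Ω _ _ mΩ M lam _ acts P p₀ _ hcons hp p t
    Ω 𝒢 id id h.le (fun _ => rfl) h.measurable_cov h.measurable_rew ?_ f hf g hg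
  rw [MeasurableSpace.comap_id]
  exact h.condIndep

/-- The g-formula: if the actions from stage `s` on are drawn from the policy `p`, then the law of
the trajectory has the product of the density ratios as its density. -/
lemma lintegral_iterVal_eq_weight [IsProbabilityMeasure P] (hcons : M.Consistency P)
    (hSU : M.SequentialUnconfoundedness P) (hp : M.FollowsPolicy P p₀)
    {p : Policy T X A lam acts}
    (hac : ∀ t, ∀ᵐ ω ∂P, p.kernel t (M.state t ω) ≪ p₀.kernel t (M.state t ω)) (s : ℕ) :
    ∀ {f : Hist X A T → ℝ≥0∞}, Measurable f →
      ∫⁻ ω, iterVal p f s (M.poTraj ω) (M.actions ω) ∂P =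
        ∫⁻ ω, ENNReal.ofReal (weight p p₀ s (M.traj ω)) * f (M.traj ω) ∂P := by
  induction s using stage_induction (T := T) with
  | h0 s h =>
    intro f hf
    refine lintegral_congr_ae ?_
    filter_upwards [hcons] with ω hω
    rw [iterVal_of_le p f h, weight_of_le p p₀ h, hω]
    simp
  | h1 s h ih =>
    intro f hf
    set t : Fin T := ⟨s, h⟩ with ht
    have hρ : Measurable (Function.uncurry fun (x : Hist X A t) (a : A) =>
        ENNReal.ofReal (ratio p p₀ t x a)) := (measurable_ratio p p₀ t).ennreal_ofReal
    have hρz := measurable_stage (T := T) hρ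
    calc ∫⁻ ω, iterVal p f s (M.poTraj ω) (M.actions ω) ∂P
        = ∫⁻ ω, ∫⁻ b, ENNReal.ofReal (ratio p p₀ t (M.state t ω) b) *
            iterVal p f (t + 1) (M.poTraj ω) (Function.update (M.actions ω) t b)
              ∂(p₀.kernel t (M.state t ω)) ∂P := by
          refine lintegral_congr_ae ?_
          filter_upwards [hcons, hac t] with ω hω hacω
          rw [iterVal_of_lt p f h, ← hω]
          exact lintegral_kernel_eq_ratio hacω _
      -- Unconfoundedness: the baseline draw `b` may be replaced by the observed action.
      _ = ∫⁻ ω, ENNReal.ofReal (ratio p p₀ t (M.state t ω) (M.act t ω)) *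
            iterVal p f (s + 1) (M.poTraj ω) (M.actions ω) ∂P :=
          (lintegral_iterVal_act hcons hSU hp p t hf hρ).symm
      -- The ratio of stage `s` is fixed by the history and action up to that stage. It is absorbed
      -- into the integrand, which is why the induction runs over all `f`.
      _ = ∫⁻ ω, iterVal p (fun z => ENNReal.ofReal (ratio p p₀ t (stateAt t z) (actionAt t z)) * f z)
            (s + 1) (M.poTraj ω) (M.actions ω) ∂P := by
          refine lintegral_congr_ae ?_
          filter_upwards [hcons] with ω hω
          refine (iterVal_mul p f _ _ ENNReal.ofReal_ne_top (s + 1) fun c hc => ?_).symm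
          have h1 : stateAt t (M.poTraj ω c) = M.state t ω := by
            refine (M.nonAnticipative_poTraj ω t c (M.actions ω) fun i hi => hc i ?_).trans ?_
            · have := Fin.lt_def.1 hi
              simp only [ht] at this
              omega
            · rw [← hω]; rfl
          have h2 : actionAt t (M.poTraj ω c) = M.act t ω := hc t (by simp [ht])
          rw [h1, h2]
      _ = _ := by
          refine (ih (hρz.mul hf)).trans ?_
          refine lintegral_congr fun ω => ?_
          rw [Pi.mul_apply, weight_of_lt p p₀ h, ENNReal.ofReal_mul (ratio_nonneg _ _ _ _ _)]
          ring

/-- Redrawing actions from the policy that generated them changes nothing: the baseline density is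
almost surely positive at the observed action, so every ratio is exactly 1. -/
lemma lintegral_iterVal_self [IsProbabilityMeasure P] (hcons : M.Consistency P)
    (hSU : M.SequentialUnconfoundedness P) (hp : M.FollowsPolicy P p₀) (s : ℕ)
    {f : Hist X A T → ℝ≥0∞} (hf : Measurable f) :
    ∫⁻ ω, iterVal p₀ f s (M.poTraj ω) (M.actions ω) ∂P = ∫⁻ ω, f (M.traj ω) ∂P := by
  rw [lintegral_iterVal_eq_weight hcons hSU hp (fun _ => ae_of_all _ fun _ =>
    Measure.AbsolutelyContinuous.rfl) s hf]
  have h1 : ∀ t : Fin T, ∀ᵐ ω ∂P, 0 < p₀.dens t (M.state t ω) (M.act t ω) := by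
    intro t
    have hm : MeasurableSet {x : Hist X A t × A | 0 < p₀.dens t x.1 x.2} :=
      measurableSet_lt measurable_const (p₀.measurable_dens t)
    have := Measure.isProbabilityMeasure_map (μ := P) (M.measurable_state t).aemeasurable
    have h2 : ∀ᵐ x ∂(P.map fun ω => (M.state t ω, M.act t ω)), 0 < p₀.dens t x.1 x.2 := by
      rw [hp t]
      exact Measure.ae_compProd_of_ae_ae hm (ae_of_all _ fun s => p₀.ae_dens_pos t s)
    exact ae_of_ae_map (M.measurable_state_act t).aemeasurable h2
  refine lintegral_congr_ae ?_
  filter_upwards [ae_all_iff.2 h1] with ω hω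
  have : weight p₀ p₀ s (M.traj ω) = 1 :=
    Finset.prod_eq_one fun k _ => div_self (hω k).ne'
  rw [this]
  simp

lemma lintegral_policyLaw (M : Model T X A Ω) (P : Measure Ω) (p : Policy T X A lam acts)
    {f : Hist X A T → ℝ≥0∞} (hf : Measurable f) :
    ∫⁻ z, f z ∂(M.policyLaw P p) = ∫⁻ ω, iterVal p f 0 (M.poTraj ω) (M.actions ω) ∂P := by
  have hA : Measurable fun ω => (ω, M.actions ω) :=
    measurable_id.prodMk (measurable_pi_lambda _ M.measurable_act)
  have hfm : Measurable fun x : Ω × (Fin T → A) => f (M.poTraj x.1 x.2) :=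
    hf.comp M.measurable_poTraj
  rw [policyLaw, lintegral_map hf M.measurable_poTraj,
    Measure.lintegral_bind (Kernel.aemeasurable _) hfm.aemeasurable,
    lintegral_map (hfm.lintegral_kernel) hA]
  exact lintegral_congr fun ω => M.lintegral_rollout p hf 0 ω _

lemma policyLaw_eq_map_withDensity [IsProbabilityMeasure P] (hcons : M.Consistency P)
    (hSU : M.SequentialUnconfoundedness P) (hp : M.FollowsPolicy P p₀)
    {p : Policy T X A lam acts}
    (hac : ∀ t, ∀ᵐ ω ∂P, p.kernel t (M.state t ω) ≪ p₀.kernel t (M.state t ω)) :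
    M.policyLaw P p =
      (P.withDensity fun ω => ENNReal.ofReal (weight p p₀ 0 (M.traj ω))).map M.traj := by
  refine Measure.ext_of_lintegral _ fun f hf => ?_
  rw [lintegral_policyLaw M P p hf, lintegral_iterVal_eq_weight hcons hSU hp hac 0 hf,
    lintegral_map hf M.measurable_traj]
  exact (lintegral_withDensity_eq_lintegral_mul _
    ((measurable_weight p p₀ 0).comp M.measurable_traj).ennreal_ofReal
    (hf.comp M.measurable_traj)).symm

end Model

/-! ### The action-value function as a regression -/

lemma ae_mem_iff_lintegral_indicator_compl {α β : Type*} [MeasurableSpace α] [MeasurableSpace β]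
    {μ : Measure α} {D : Set β} (hD : MeasurableSet D) {h : α → β} (hh : Measurable h) :
    (∀ᵐ x ∂μ, h x ∈ D) ↔ ∫⁻ x, Dᶜ.indicator (fun _ => (1 : ℝ≥0∞)) (h x) ∂μ = 0 := by
  have hm : Measurable fun x => Dᶜ.indicator (fun _ => (1 : ℝ≥0∞)) (h x) :=
    (measurable_const.indicator hD.compl).comp hh
  rw [lintegral_eq_zero_iff hm]
  refine eventually_congr (ae_of_all _ fun x => ?_)
  simp [Set.indicator_apply_eq_zero]

/-- This is the pull-out property of conditional expectation. The shift by `B` makes the integrands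
nonnegative, so that it takes the form of an identity of Lebesgue integrals, which is what the
g-formula can be combined with. -/
lemma lintegral_ofReal_mul_condExp {Ω : Type*} {m mΩ : MeasurableSpace Ω} (hm : m ≤ mΩ)
    {P : Measure Ω} [IsProbabilityMeasure P] {w Y q : Ω → ℝ} {B : ℝ} 
    (hw : StronglyMeasurable[m] w) (hw0 : ∀ ω, 0 ≤ w ω) (hwi : Integrable w P)
    (hY : AEStronglyMeasurable Y P) (hYB : ∀ᵐ ω ∂P, |Y ω| ≤ B) (hq : q =ᵐ[P] P[Y | m]) :
    (∀ᵐ ω ∂P, |q ω| ≤ B) ∧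
      ∫⁻ ω, ENNReal.ofReal (w ω * (Y ω + B)) ∂P = ∫⁻ ω, ENNReal.ofReal (w ω * (q ω + B)) ∂P := by
  have hYi : Integrable Y P := Integrable.of_bound hY B hYB
  have hqB : ∀ᵐ ω ∂P, |q ω| ≤ B := by
    have h := ae_bdd_abs_condExp_of_ae_bdd_abs (m := m) (μ := P) (f := Y) hYB
    filter_upwards [h, hq] with ω h1 h2
    rwa [h2]
  refine ⟨hqB, ?_⟩
  have hqm : AEStronglyMeasurable q P :=
    (stronglyMeasurable_condExp.mono hm).aestronglyMeasurable.congr hq.symm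
  have hwY : Integrable (w * Y) P := hwi.mul_bdd hY hYB
  have hwq : Integrable (w * q) P := hwi.mul_bdd hqm hqB
  have hwB : Integrable (fun ω => w ω * B) P := hwi.mul_const B
  have hint : ∫ ω, w ω * Y ω ∂P = ∫ ω, w ω * q ω ∂P := by
    have h1 := integral_condExp hm (μ := P) (f := w * Y)
    have h2 := condExp_mul_of_stronglyMeasurable_left hw hwY hYi
    rw [integral_congr_ae h2] at h1
    refine h1.symm.trans (integral_congr_ae ?_)
    filter_upwards [hq] with ω h
    rw [Pi.mul_apply, ← h]
  rw [← ofReal_integral_eq_lintegral_ofReal, ← ofReal_integral_eq_lintegral_ofReal]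
  · simp only [mul_add]
    exact congrArg _ ((integral_add hwY hwB).trans ((congrArg (· + _) hint).trans
      (integral_add hwq hwB).symm))
  · simp only [mul_add]
    exact hwq.add hwB
  · filter_upwards [hqB] with ω h
    exact mul_nonneg (hw0 ω) (by linarith [(abs_le.1 h).1])
  · simp only [mul_add]
    exact hwY.add hwB
  · filter_upwards [hYB] with ω h
    exact mul_nonneg (hw0 ω) (by linarith [(abs_le.1 h).1])

section CumReward

variable {T : ℕ} {X : ℕ → Type*} {A : Type*}

/-- The bound `R ∑_{j < T} γ ^ j` for the discounted cumulative rewards. -/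
def rewardBound (T : ℕ) (γ R : ℝ) : ℝ := R * ∑ k ∈ Finset.range T, γ ^ k

lemma abs_cumReward_le {γ R : ℝ} (hγ : 0 ≤ γ) (t : Fin T) {z : Hist X A T}
    (hz : ∀ k, |z.2.2 k| ≤ R) : |cumReward γ t z| ≤ rewardBound T γ R := by
  have hR : 0 ≤ R := (abs_nonneg _).trans (hz t)
  calc |cumReward γ t z| ≤ ∑ k ∈ Finset.Ici t, |γ ^ ((k : ℕ) - (t : ℕ)) * z.2.2 k| :=
        Finset.abs_sum_le_sum_abs _ _
    _ ≤ ∑ k ∈ Finset.Ici t, R * γ ^ ((k : ℕ) - (t : ℕ)) := by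
        refine Finset.sum_le_sum fun k _ => ?_
        rw [abs_mul, abs_of_nonneg (pow_nonneg hγ _), mul_comm]
        exact mul_le_mul_of_nonneg_right (hz k) (pow_nonneg hγ _)
    -- The exponents `k - t` are distinct for `k ≥ t`, so the sum runs over a set of powers
    -- contained in the range of `T`.
    _ = R * ∑ j ∈ (Finset.Ici t).image (fun k : Fin T => (k : ℕ) - (t : ℕ)), γ ^ j := by
        rw [← Finset.mul_sum, Finset.sum_image]
        intro a ha b hb hab
        have h1 := Fin.le_def.1 (Finset.mem_Ici.1 ha)
        have h2 := Fin.le_def.1 (Finset.mem_Ici.1 hb)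
        exact Fin.ext (by simp only at hab; omega)
    _ ≤ rewardBound T γ R := by
        refine mul_le_mul_of_nonneg_left (Finset.sum_le_sum_of_subset_of_nonneg ?_ fun _ _ _ =>
          pow_nonneg hγ _) hR
        intro j hj
        obtain ⟨k, -, rfl⟩ := Finset.mem_image.1 hj
        exact Finset.mem_range.2 (by have := k.2; omega)

variable [∀ j, MeasurableSpace (X j)] [MeasurableSpace A]

lemma measurable_cumReward (γ : ℝ) (t : Fin T) :
    Measurable (cumReward (X := X) (A := A) γ t) :=
  Finset.measurable_fun_sum _ fun k _ =>
    ((measurable_pi_apply k).comp (measurable_snd.comp measurable_snd)).const_mul _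

end CumReward

namespace Model

variable {T : ℕ} {X : ℕ → Type*} {A : Type*} {Ω : Type*} [∀ j, MeasurableSpace (X j)]
  [MeasurableSpace A] [mΩ : MeasurableSpace Ω] {M : Model T X A Ω}
  {lam : Measure A} [SigmaFinite lam] {acts : Fin T → Set A} {P : Measure Ω}
  {p₀ : Policy T X A lam acts}

instance (M : Model T X A Ω) (p : Policy T X A lam acts) (t : Fin T) :
    IsMarkovKernel (M.drawStep p t) := by
  have h2 : Measurable fun y : (Ω × (Fin T → A)) × A =>
      (y.1.1, Function.update y.1.2 t y.2) := by
    refine (measurable_fst.comp measurable_fst).prodMk ?_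
    exact measurable_update'.comp ((measurable_snd.comp measurable_fst).prodMk measurable_snd)
  exact Kernel.IsMarkovKernel.map _ h2

instance (M : Model T X A Ω) (p : Policy T X A lam acts) (s : ℕ) :
    IsMarkovKernel (M.rollout p s) := by
  induction s using stage_induction (T := T) with
  | h0 s h => rw [rollout, dif_neg (by omega)]; infer_instance
  | h1 s h ih => rw [rollout, dif_pos h]; infer_instance

/-- Tonelli's theorem with the action outermost: the defining property of the action-value function
is given for almost every fixed action, and only then for almost every unit. -/
lemma lintegral_lintegral_kernel [IsProbabilityMeasure P] (t : Fin T) {F : Ω → A → ℝ≥0∞}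
    (hF : Measurable (Function.uncurry F)) :
    ∫⁻ ω, ∫⁻ b, F ω b ∂(p₀.kernel t (M.state t ω)) ∂P =
      ∫⁻ b in acts t, ∫⁻ ω, ENNReal.ofReal (p₀.dens t (M.state t ω) b) * F ω b ∂P ∂lam := by
  simp_rw [p₀.lintegral_kernel]
  refine lintegral_lintegral_swap (Measurable.aemeasurable ?_)
  exact (((p₀.measurable_dens t).comp (((M.measurable_state t).comp measurable_fst).prodMk
    measurable_snd)).ennreal_ofReal).mul hF

lemma FollowsPolicy.ae_act_iff [IsProbabilityMeasure P] (hp : M.FollowsPolicy P p₀) (t : Fin T)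
    {D : Set (Hist X A t × A)} (hD : MeasurableSet D) :
    (∀ᵐ ω ∂P, (M.state t ω, M.act t ω) ∈ D) ↔
      ∀ᵐ ω ∂P, ∀ᵐ b ∂(p₀.kernel t (M.state t ω)), (M.state t ω, b) ∈ D := by
  have hF : Measurable (Function.uncurry fun s b => Dᶜ.indicator (fun _ => (1 : ℝ≥0∞)) (s, b)) :=
    measurable_const.indicator hD.compl
  have h := hp.lintegral_act t hF
  have h2 : (∀ᵐ ω ∂P, ∀ᵐ b ∂(p₀.kernel t (M.state t ω)), (M.state t ω, b) ∈ D) ↔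
      ∫⁻ ω, ∫⁻ b, Dᶜ.indicator (fun _ => (1 : ℝ≥0∞)) (M.state t ω, b)
        ∂(p₀.kernel t (M.state t ω)) ∂P = 0 := by
    have hm : Measurable fun ω => ∫⁻ b, Dᶜ.indicator (fun _ => (1 : ℝ≥0∞)) (M.state t ω, b)
        ∂(p₀.kernel t (M.state t ω)) :=
      (p₀.measurable_lintegral_kernel t measurable_id hF).comp (M.measurable_state t)
    rw [lintegral_eq_zero_iff hm]
    exact eventually_congr (ae_of_all _ fun ω =>
      ae_mem_iff_lintegral_indicator_compl hD measurable_prodMk_left)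
  rw [ae_mem_iff_lintegral_indicator_compl hD (M.measurable_state_act t), h2, h]

/-- The later actions are redrawn first, which costs nothing under the baseline policy and leaves
the factor `g` outside; then unconfoundedness replaces `A_t` by an independent draw. -/
lemma lintegral_stage_mul [IsProbabilityMeasure P] (hcons : M.Consistency P)
    (hSU : M.SequentialUnconfoundedness P) (hp : M.FollowsPolicy P p₀) (t : Fin T)
    {f : Hist X A T → ℝ≥0∞} (hf : Measurable f) {g : Hist X A t → A → ℝ≥0∞}
    (hg : Measurable (Function.uncurry g)) (hgt : ∀ s a, g s a ≠ ∞) :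
    ∫⁻ ω, g (M.state t ω) (M.act t ω) * f (M.traj ω) ∂P =
      ∫⁻ ω, ∫⁻ b, g (M.state t ω) b *
        iterVal p₀ f (t + 1) (M.poTraj ω) (Function.update (M.actions ω) t b)
          ∂(p₀.kernel t (M.state t ω)) ∂P := by
  rw [← lintegral_iterVal_act hcons hSU hp p₀ t hf hg]
  refine (lintegral_iterVal_self hcons hSU hp ((t : ℕ) + 1)
    (f := fun z => g (stateAt t z) (actionAt t z) * f z)
    ((measurable_stage hg).mul hf)).symm.trans (lintegral_congr_ae ?_)
  filter_upwards [hcons] with ω hω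
  refine iterVal_mul p₀ f (fun z => g (stateAt t z) (actionAt t z)) _ (hgt _ _) _ fun c hc => ?_
  have h1 : stateAt t (M.poTraj ω c) = M.state t ω := by
    refine (M.nonAnticipative_poTraj ω t c (M.actions ω) fun i hi => hc i ?_).trans ?_
    · have := Fin.lt_def.1 hi
      omega
    · rw [← hω]; rfl
  have h2 : actionAt t (M.poTraj ω c) = M.act t ω := hc t (by omega)
  rw [h1, h2]

lemma ae_abs_cumReward_le {γ R : ℝ} (hγ : 0 ≤ γ) (hR : ∀ t, ∀ᵐ ω ∂P, |M.rew t ω| ≤ R) (t : Fin T) :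
    ∀ᵐ ω ∂P, |cumReward γ t (M.traj ω)| ≤ rewardBound T γ R := by
  filter_upwards [ae_all_iff.2 hR] with ω hω
  exact abs_cumReward_le hγ t hω

lemma rewardBound_nonneg [IsProbabilityMeasure P] {γ R : ℝ} (hγ : 0 ≤ γ)
    (hR : ∀ t, ∀ᵐ ω ∂P, |M.rew t ω| ≤ R) (t : Fin T) : 0 ≤ rewardBound T γ R := by
  obtain ⟨ω, hω⟩ := (ae_abs_cumReward_le hγ hR t).exists
  exact (abs_nonneg _).trans hω

/-- If the rewards are bounded, then so are the values of `Γ_t` on the support of the policy. -/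
lemma ae_doMean_eq [IsProbabilityMeasure P] (hcons : M.Consistency P)
    (hSU : M.SequentialUnconfoundedness P) (hp : M.FollowsPolicy P p₀) {γ R : ℝ} (hγ : 0 ≤ γ)
    (hR : ∀ t, ∀ᵐ ω ∂P, |M.rew t ω| ≤ R) (t : Fin T) :
    ∀ᵐ b ∂(lam.restrict (acts t)), ∀ᵐ ω ∂P, 0 < p₀.dens t (M.state t ω) b →
      |M.doMean γ p₀ t b ω| ≤ rewardBound T γ R ∧
      iterVal p₀ (fun z => ENNReal.ofReal (cumReward γ t z + rewardBound T γ R)) (t + 1)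
        (M.poTraj ω) (Function.update (M.actions ω) t b) =
          ENNReal.ofReal (M.doMean γ p₀ t b ω + rewardBound T γ R) := by
  set B := rewardBound T γ R
  set D : Set (Hist X A T) := {z | |cumReward γ t z| ≤ B}
  have hD : MeasurableSet D :=
    measurableSet_le (measurable_cumReward γ t).abs measurable_const
  have hf : Measurable (Dᶜ.indicator fun _ => (1 : ℝ≥0∞)) := measurable_const.indicator hD.compl
  have hupd : Measurable fun x : Ω × A => (x.1, Function.update (M.actions x.1) t x.2) :=
    measurable_fst.prodMk (measurable_update'.comp
      (((measurable_pi_lambda _ M.measurable_act).comp measurable_fst).prodMk measurable_snd))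
  have hF : Measurable (Function.uncurry fun ω b =>
      iterVal p₀ (Dᶜ.indicator fun _ => (1 : ℝ≥0∞)) (t + 1) (M.poTraj ω)
        (Function.update (M.actions ω) t b)) :=
    (measurable_iterVal p₀ hf M.measurable_poTraj (t + 1)).comp hupd
  have h0 : ∫⁻ ω, Dᶜ.indicator (fun _ => (1 : ℝ≥0∞)) (M.traj ω) ∂P = 0 :=
    (ae_mem_iff_lintegral_indicator_compl hD M.measurable_traj).1 (ae_abs_cumReward_le hγ hR t)
  -- The event `|Γ_t| > B` is null for the observed data. Writing its probability through a redraw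
  -- of `A_t` shows that, at almost every action, it is null for the rollout wherever the density is
  -- positive. There `doMean` is the integral of a bounded function and agrees with `iterVal` after
  -- the shift by `B`.
  have h1 := lintegral_stage_mul hcons hSU hp t hf (g := fun _ _ => 1) measurable_const (by simp)
  simp only [one_mul] at h1
  rw [h0, lintegral_lintegral_kernel t hF] at h1
  have hdF : Measurable (Function.uncurry fun b ω =>
      ENNReal.ofReal (p₀.dens t (M.state t ω) b) *
        iterVal p₀ (Dᶜ.indicator fun _ => (1 : ℝ≥0∞)) (t + 1) (M.poTraj ω)
        (Function.update (M.actions ω) t b)) :=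
    (((p₀.measurable_dens t).comp (((M.measurable_state t).comp measurable_snd).prodMk
      measurable_fst)).ennreal_ofReal).mul (hF.comp measurable_swap)
  have h2 := (lintegral_eq_zero_iff hdF.lintegral_prod_right).1 h1.symm
  filter_upwards [h2] with b hb
  have h3 := (lintegral_eq_zero_iff (hdF.comp measurable_prodMk_left)).1 hb
  filter_upwards [h3] with ω hω hpos
  have h4 : iterVal p₀ (Dᶜ.indicator fun _ => (1 : ℝ≥0∞)) (t + 1) (M.poTraj ω)
      (Function.update (M.actions ω) t b) = 0 := by
    rcases mul_eq_zero.1 hω with h | h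
    · exact absurd h (by simpa using hpos)
    · exact h
  set μ := M.rollout p₀ ((t : ℕ) + 1) (ω, Function.update (M.actions ω) t b) with hμ
  have h5 : ∀ᵐ x ∂μ, |cumReward γ t (M.poTraj x.1 x.2)| ≤ B := by
    rw [← M.lintegral_rollout p₀ hf] at h4
    exact (ae_mem_iff_lintegral_indicator_compl hD M.measurable_poTraj).2 h4
  have hint : Integrable (fun x => cumReward γ t (M.poTraj x.1 x.2)) μ :=
    Integrable.of_bound ((measurable_cumReward γ t).comp
      M.measurable_poTraj).aestronglyMeasurable B h5
  constructor
  · have := norm_integral_le_of_norm_le_const (μ := μ)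
      (f := fun x => cumReward γ t (M.poTraj x.1 x.2)) h5
    change |∫ x, cumReward γ t (M.poTraj x.1 x.2) ∂μ| ≤ B
    simpa using this
  · rw [← M.lintegral_rollout p₀ ((measurable_cumReward γ t).add_const B).ennreal_ofReal, ← hμ]
    refine (ofReal_integral_eq_lintegral_ofReal (hint.add (integrable_const B)) ?_).symm.trans ?_
    swap
    · refine congrArg _ ((integral_add hint (integrable_const B)).trans ?_)
      simp [doMean, hμ]
    · filter_upwards [h5] with x hx
      have := (abs_le.1 hx).1
      simp only [Pi.zero_apply, Pi.add_apply]
      linarith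

lemma ae_integrable_dens [IsProbabilityMeasure P] (M : Model T X A Ω)
    (p₀ : Policy T X A lam acts) (t : Fin T) :
    ∀ᵐ b ∂(lam.restrict (acts t)), Integrable (fun ω => p₀.dens t (M.state t ω) b) P := by
  have h := lintegral_lintegral_kernel (M := M) (P := P) (p₀ := p₀) t (F := fun _ _ => 1)
    measurable_const
  simp only [lintegral_one, measure_univ, mul_one] at h
  have hm : Measurable (Function.uncurry fun b ω => ENNReal.ofReal (p₀.dens t (M.state t ω) b)) :=
    ((p₀.measurable_dens t).comp (((M.measurable_state t).comp measurable_snd).prodMk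
      measurable_fst)).ennreal_ofReal
  filter_upwards [ae_lt_top hm.lintegral_prod_right (h.symm.trans_ne ENNReal.one_ne_top)] with b hb
  refine ⟨((p₀.measurable_dens t).comp
    ((M.measurable_state t).prodMk measurable_const)).aestronglyMeasurable, ?_⟩
  rw [hasFiniteIntegral_iff_ofReal (ae_of_all _ fun _ => p₀.dens_nonneg _ _ _)]
  exact hb

variable {γ : ℝ} {q : (t : Fin T) → Hist X A t → A → ℝ}

/-- The law of `(S_t, A_t, Γ_t)` is expanded with `A_t` redrawn and held at a fixed action `b`.
There `q` is a conditional expectation of `doMean` given `S_t`, and the indicator of `D` times the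
density is a function of `S_t`, so `doMean` may be replaced by `q`. Integrating over `b` returns to
the observed law. -/
lemma IsActionValue.ae_bound_and_lintegral [IsProbabilityMeasure P] (hq : M.IsActionValue P γ p₀ q)
    (hcons : M.Consistency P) (hSU : M.SequentialUnconfoundedness P) (hp : M.FollowsPolicy P p₀)
    {R : ℝ} (hγ : 0 ≤ γ) (hR : ∀ t, ∀ᵐ ω ∂P, |M.rew t ω| ≤ R) (t : Fin T) :
    (∀ᵐ ω ∂P, |q t (M.state t ω) (M.act t ω)| ≤ rewardBound T γ R) ∧
    ∀ D : Set (Hist X A t × A), MeasurableSet D →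
      ∫⁻ ω, D.indicator (fun _ => 1) (M.state t ω, M.act t ω) *
          ENNReal.ofReal (cumReward γ t (M.traj ω) + rewardBound T γ R) ∂P =
        ∫⁻ ω, D.indicator (fun _ => 1) (M.state t ω, M.act t ω) *
          ENNReal.ofReal (q t (M.state t ω) (M.act t ω) + rewardBound T γ R) ∂P := by
  set B := rewardBound T γ R
  have hB : 0 ≤ B := rewardBound_nonneg (M := M) (P := P) hγ hR t
  have hqm := (hq t).1
  have hf : Measurable fun z : Hist X A T => ENNReal.ofReal (cumReward γ t z + B) :=
    ((measurable_cumReward γ t).add_const B).ennreal_ofReal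
  have hupd : Measurable fun x : Ω × A => (x.1, Function.update (M.actions x.1) t x.2) :=
    measurable_fst.prodMk (measurable_update'.comp
      (((measurable_pi_lambda _ M.measurable_act).comp measurable_fst).prodMk measurable_snd))
  have hF : Measurable (Function.uncurry fun ω b =>
      iterVal p₀ (fun z => ENNReal.ofReal (cumReward γ t z + B)) (t + 1) (M.poTraj ω)
        (Function.update (M.actions ω) t b)) :=
    (measurable_iterVal p₀ hf M.measurable_poTraj (t + 1)).comp hupd
  have hdens : ∀ b, Measurable fun s => p₀.dens t s b := fun b =>
    (p₀.measurable_dens t).comp measurable_prodMk_right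
  have hkey : ∀ D : Set (Hist X A t × A), MeasurableSet D →
      ∀ᵐ b ∂(lam.restrict (acts t)),
        (∀ᵐ ω ∂P, 0 < p₀.dens t (M.state t ω) b → |q t (M.state t ω) b| ≤ B) ∧
        ∫⁻ ω, ENNReal.ofReal (p₀.dens t (M.state t ω) b) *
          (D.indicator (fun _ => 1) (M.state t ω, b) *
            iterVal p₀ (fun z => ENNReal.ofReal (cumReward γ t z + B)) (t + 1) (M.poTraj ω)
              (Function.update (M.actions ω) t b)) ∂P =
        ∫⁻ ω, ENNReal.ofReal (p₀.dens t (M.state t ω) b) *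
          (D.indicator (fun _ => 1) (M.state t ω, b) *
            ENNReal.ofReal (q t (M.state t ω) b + B)) ∂P := by
    intro D hD
    filter_upwards [ae_doMean_eq hcons hSU hp hγ hR t, ae_integrable_dens (P := P) M p₀ t, (hq t).2]
      with b hdo hdi hqb
    set I : Set Ω := {ω | 0 < p₀.dens t (M.state t ω) b} with hI
    have hIm : MeasurableSet I :=
      measurableSet_lt measurable_const ((hdens b).comp (M.measurable_state t))
    set w : Ω → ℝ := fun ω =>
      D.indicator (fun _ => (1 : ℝ)) (M.state t ω, b) * p₀.dens t (M.state t ω) b with hw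
    have hwS : Measurable fun s => D.indicator (fun _ => (1 : ℝ)) (s, b) * p₀.dens t s b :=
      ((measurable_const.indicator hD).comp measurable_prodMk_right).mul (hdens b)
    have hind : ∀ x, 0 ≤ D.indicator (fun _ => (1 : ℝ)) x := fun x =>
      Set.indicator_nonneg (fun _ _ => zero_le_one) x
    -- Almost everywhere on `I` the mean `doMean` is a shifted `iterVal`, whose measurability is
    -- known.
    have hYm : AEStronglyMeasurable (I.indicator (M.doMean γ p₀ t b)) P := by
      have h1 : Measurable (I.indicator fun ω => (iterVal p₀ (fun z =>
          ENNReal.ofReal (cumReward γ t z + B)) (t + 1) (M.poTraj ω)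
            (Function.update (M.actions ω) t b)).toReal - B) :=
        ((hF.comp (measurable_prodMk_right (y := b))).ennreal_toReal.sub_const B).indicator hIm
      refine h1.aestronglyMeasurable.congr ?_
      filter_upwards [hdo] with ω hω
      by_cases hωI : ω ∈ I
      · obtain ⟨h2, h3⟩ := hω hωI
        rw [Set.indicator_of_mem hωI, Set.indicator_of_mem hωI, h3, ENNReal.toReal_ofReal]
        · ring
        · linarith [(abs_le.1 h2).1]
      · rw [Set.indicator_of_notMem hωI, Set.indicator_of_notMem hωI]
    have hYB : ∀ᵐ ω ∂P, |I.indicator (M.doMean γ p₀ t b) ω| ≤ B := by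
      filter_upwards [hdo] with ω hω
      by_cases hωI : ω ∈ I
      · rw [Set.indicator_of_mem hωI]
        exact (hω hωI).1
      · rw [Set.indicator_of_notMem hωI, abs_zero]
        exact hB
    have hwi : Integrable w P := by
      refine hdi.mono (hwS.comp (M.measurable_state t)).aestronglyMeasurable
        (ae_of_all _ fun ω => ?_)
      simp only [hw, norm_mul]
      refine mul_le_of_le_one_left (norm_nonneg _) ?_
      by_cases h : (M.state t ω, b) ∈ D <;> simp [h]
    obtain ⟨h1, h2⟩ := lintegral_ofReal_mul_condExp (P := P) (M.measurable_state t).comap_le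
      (hwS.stronglyMeasurable.comp_measurable (comap_measurable (M.state t)))
      (fun ω => mul_nonneg (hind _) (p₀.dens_nonneg t _ _)) hwi hYm hYB hqb
    refine ⟨?_, ?_⟩
    · filter_upwards [h1] with ω hω hpos
      rwa [Set.indicator_of_mem (show ω ∈ I from hpos)] at hω
    -- Off `I` the density is zero, so cutting `x` off there does not change the product.
    · have hcalc : ∀ (ω : Ω) (x : ℝ), ENNReal.ofReal (p₀.dens t (M.state t ω) b) *
          (D.indicator (fun _ => 1) (M.state t ω, b) * ENNReal.ofReal (x + B)) =
            ENNReal.ofReal (w ω * (I.indicator (fun _ => x) ω + B)) := by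
        intro ω x
        by_cases hωI : ω ∈ I
        · by_cases hωD : (M.state t ω, b) ∈ D
          · simp [hw, hωI, hωD, ENNReal.ofReal_mul (p₀.dens_nonneg t _ _)]
          · simp [hw, hωD]
        · have h0 : p₀.dens t (M.state t ω) b = 0 :=
            le_antisymm (not_lt.1 hωI) (p₀.dens_nonneg t _ _)
          simp [hw, h0]
      refine Eq.trans (lintegral_congr_ae ?_) (h2.trans (lintegral_congr fun ω => ?_))
      · filter_upwards [hdo] with ω hω
        by_cases hωI : ω ∈ I
        · rw [(hω hωI).2, hcalc]
          simp only [Set.indicator_of_mem hωI]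
          rfl
        · have h0 : p₀.dens t (M.state t ω) b = 0 :=
            le_antisymm (not_lt.1 hωI) (p₀.dens_nonneg t _ _)
          simp [h0]
      · rw [hcalc]
        by_cases hωI : ω ∈ I
        · simp only [Set.indicator_of_mem hωI]
          rfl
        · simp only [Set.indicator_of_notMem hωI]
          rfl
  have hbd : ∀ᵐ ω ∂P, |q t (M.state t ω) (M.act t ω)| ≤ B := by
    have hE : MeasurableSet {x : Hist X A t × A | |q t x.1 x.2| ≤ B} :=
      measurableSet_le hqm.abs measurable_const
    set E := {x : Hist X A t × A | |q t x.1 x.2| ≤ B}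
    have hEm : Measurable (Function.uncurry fun s b =>
        Eᶜ.indicator (fun _ => (1 : ℝ≥0∞)) (s, b)) := measurable_const.indicator hE.compl
    have h0 : ∫⁻ ω, Eᶜ.indicator (fun _ => (1 : ℝ≥0∞)) (M.state t ω, M.act t ω) ∂P = 0 := by
      rw [hp.lintegral_act t hEm, lintegral_lintegral_kernel (p₀ := p₀) (M := M) (P := P) t
        (F := fun ω b => Eᶜ.indicator (fun _ => (1 : ℝ≥0∞)) (M.state t ω, b))
        (hEm.comp (((M.measurable_state t).comp measurable_fst).prodMk measurable_snd))]
      rw [lintegral_congr_ae (g := fun _ => 0), lintegral_zero]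
      filter_upwards [hkey Set.univ MeasurableSet.univ] with b hb
      rw [lintegral_congr_ae (g := fun _ => 0), lintegral_zero]
      filter_upwards [hb.1] with ω hω
      rcases (p₀.dens_nonneg t (M.state t ω) b).eq_or_lt with h | h
      · simp [← h]
      · have : (M.state t ω, b) ∈ E := hω h
        simp [this]
    exact (ae_mem_iff_lintegral_indicator_compl hE (M.measurable_state_act t)).2 h0
  refine ⟨hbd, fun D hD => ?_⟩
  have hDm : Measurable (Function.uncurry fun s b =>
      D.indicator (fun _ => (1 : ℝ≥0∞)) (s, b)) := measurable_const.indicator hD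
  have hst : Measurable fun x : Ω × A => (M.state t x.1, x.2) :=
    ((M.measurable_state t).comp measurable_fst).prodMk measurable_snd
  have hDq : Measurable (Function.uncurry fun s b =>
      D.indicator (fun _ => (1 : ℝ≥0∞)) (s, b) * ENNReal.ofReal (q t s b + B)) :=
    hDm.mul (hqm.add_const B).ennreal_ofReal
  rw [lintegral_stage_mul hcons hSU hp t hf (g := fun s b => D.indicator (fun _ => 1) (s, b)) hDm
    (fun s a => by by_cases h : (s, a) ∈ D <;> simp [h]), hp.lintegral_act t hDq,
    lintegral_lintegral_kernel (p₀ := p₀) t ((hDm.comp hst).mul hF),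
    lintegral_lintegral_kernel (p₀ := p₀) t (F := fun ω b =>
      D.indicator (fun _ => (1 : ℝ≥0∞)) (M.state t ω, b) * ENNReal.ofReal (q t (M.state t ω) b + B))
      (hDq.comp hst)]
  refine lintegral_congr_ae ?_
  filter_upwards [hkey D hD] with b hb
  exact hb.2

/-- The action-value function is the regression of the cumulative reward on the history and the
action. -/
lemma IsActionValue.condExp_cumReward [IsProbabilityMeasure P] (hq : M.IsActionValue P γ p₀ q)
    (hcons : M.Consistency P) (hSU : M.SequentialUnconfoundedness P) (hp : M.FollowsPolicy P p₀)
    {R : ℝ} (hγ : 0 ≤ γ) (hR : ∀ t, ∀ᵐ ω ∂P, |M.rew t ω| ≤ R) (t : Fin T) :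
    (fun ω => q t (M.state t ω) (M.act t ω)) =ᵐ[P]
      P[fun ω => cumReward γ t (M.traj ω) |
        MeasurableSpace.comap (fun ω => (M.state t ω, M.act t ω)) inferInstance] := by
  obtain ⟨hbd, hset⟩ := hq.ae_bound_and_lintegral hcons hSU hp hγ hR t
  set B := rewardBound T γ R
  have hΓ := ae_abs_cumReward_le hγ hR t
  have hqm : Measurable fun ω => q t (M.state t ω) (M.act t ω) :=
    (hq t).1.comp (M.measurable_state_act t)
  have hΓm : Measurable fun ω => cumReward γ t (M.traj ω) :=
    (measurable_cumReward γ t).comp M.measurable_traj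
  have hqi := Integrable.of_bound hqm.aestronglyMeasurable B hbd
  have hΓi := Integrable.of_bound hΓm.aestronglyMeasurable B hΓ
  refine ae_eq_condExp_of_forall_setIntegral_eq (M.measurable_state_act t).comap_le hΓi
    (fun _ _ _ => hqi.integrableOn) ?_ ?_
  · rintro _ ⟨D, hD, rfl⟩ -
    have hDm := (M.measurable_state_act t) hD
    have hconv : ∀ f : Ω → ℝ, Integrable f P → (∀ᵐ ω ∂P, |f ω| ≤ B) →
        ENNReal.ofReal (∫ ω in (fun ω => (M.state t ω, M.act t ω)) ⁻¹' D, (f ω + B) ∂P) =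
          ∫⁻ ω, D.indicator (fun _ => 1) (M.state t ω, M.act t ω) * ENNReal.ofReal (f ω + B) ∂P := by
      intro f hf hfB
      refine (ofReal_integral_eq_lintegral_ofReal
        (hf.add (integrable_const B)).integrableOn ?_).trans ?_
      swap
      · rw [← lintegral_indicator hDm]
        refine lintegral_congr fun ω => ?_
        by_cases h : (M.state t ω, M.act t ω) ∈ D <;> simp [Set.indicator, h]
      · refine ae_restrict_of_ae ?_
        filter_upwards [hfB] with ω h
        have := (abs_le.1 h).1
        simp only [Pi.zero_apply, Pi.add_apply]
        linarith
    have h1 := (hconv _ hΓi hΓ).trans ((hset D hD).trans (hconv _ hqi hbd).symm)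
    have hnn : ∀ f : Ω → ℝ, (∀ᵐ ω ∂P, |f ω| ≤ B) →
        0 ≤ ∫ ω in (fun ω => (M.state t ω, M.act t ω)) ⁻¹' D, (f ω + B) ∂P := by
      intro f hfB
      refine integral_nonneg_of_ae (ae_restrict_of_ae ?_)
      filter_upwards [hfB] with ω h
      have := (abs_le.1 h).1
      simp only [Pi.zero_apply]
      linarith
    have h2 := (ENNReal.ofReal_eq_ofReal_iff (hnn _ hΓ) (hnn _ hbd)).1 h1
    rw [integral_add hΓi.integrableOn (integrable_const B).integrableOn,
      integral_add hqi.integrableOn (integrable_const B).integrableOn] at h2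
    linarith
  · exact ((hq t).1.comp (comap_measurable _)).stronglyMeasurable.aestronglyMeasurable

/-- Orthogonality of the regression residual. It centres the augmentation term of the oracle score
and the error term in `Ĥ - H`, and it exchanges `Γ_t` for `q_t` in the policy gradient. -/
lemma IsActionValue.integral_mul_sub [IsProbabilityMeasure P] (hq : M.IsActionValue P γ p₀ q)
    (hcons : M.Consistency P) (hSU : M.SequentialUnconfoundedness P) (hp : M.FollowsPolicy P p₀)
    {R : ℝ} (hγ : 0 ≤ γ) (hR : ∀ t, ∀ᵐ ω ∂P, |M.rew t ω| ≤ R) (t : Fin T)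
    {φ : Hist X A t → A → ℝ} (hφ : Measurable (Function.uncurry φ))
    (hφi : Integrable (fun ω => φ (M.state t ω) (M.act t ω)) P) :
    ∫ ω, φ (M.state t ω) (M.act t ω) *
      (cumReward γ t (M.traj ω) - q t (M.state t ω) (M.act t ω)) ∂P = 0 := by
  have hbd := (hq.ae_bound_and_lintegral hcons hSU hp hγ hR t).1
  set B := rewardBound T γ R
  have hΓ := ae_abs_cumReward_le hγ hR t
  have hqm : Measurable fun ω => q t (M.state t ω) (M.act t ω) :=
    (hq t).1.comp (M.measurable_state_act t)
  have hΓm : Measurable fun ω => cumReward γ t (M.traj ω) :=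
    (measurable_cumReward γ t).comp M.measurable_traj
  have hΓi := Integrable.of_bound hΓm.aestronglyMeasurable B hΓ
  have hm := (M.measurable_state_act t).comap_le
  have hφΓ : Integrable ((fun ω => φ (M.state t ω) (M.act t ω)) *
      fun ω => cumReward γ t (M.traj ω)) P := hφi.mul_bdd hΓm.aestronglyMeasurable hΓ
  have hφq : Integrable ((fun ω => φ (M.state t ω) (M.act t ω)) *
      fun ω => q t (M.state t ω) (M.act t ω)) P := hφi.mul_bdd hqm.aestronglyMeasurable hbd
  have h1 := condExp_mul_of_stronglyMeasurable_left
    (m := MeasurableSpace.comap (fun ω => (M.state t ω, M.act t ω)) inferInstance)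
    ((hφ.comp (comap_measurable _)).stronglyMeasurable) hφΓ hΓi
  have h2 := integral_condExp hm (μ := P) (f := (fun ω => φ (M.state t ω) (M.act t ω)) *
      fun ω => cumReward γ t (M.traj ω))
  simp only [mul_sub]
  have h3 : ∫ ω, φ (M.state t ω) (M.act t ω) * cumReward γ t (M.traj ω) ∂P =
      ∫ ω, φ (M.state t ω) (M.act t ω) * q t (M.state t ω) (M.act t ω) ∂P := by
    refine h2.symm.trans (integral_congr_ae ?_)
    filter_upwards [h1, hq.condExp_cumReward hcons hSU hp hγ hR t] with ω e1 e2
    refine e1.trans ?_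
    rw [Pi.mul_apply, ← e2]
    rfl
  exact (integral_sub hφΓ hφq).trans (sub_eq_zero.2 h3)

end Model

/-- The tails of an integrable function are small. -/
lemma exists_lintegral_tail_le {α : Type*} [MeasurableSpace α] {μ : Measure α} {f : α → ℝ≥0∞}
    (hf : Measurable f) (hfi : ∫⁻ x, f x ∂μ ≠ ∞) {e : ℝ≥0∞} (he : 0 < e) :
    ∃ N : ℕ, ∫⁻ x, {x | (N : ℝ≥0∞) < f x}.indicator f x ∂μ ≤ e := by
  have hlim : Tendsto (fun N : ℕ => ∫⁻ x, {x | (N : ℝ≥0∞) < f x}.indicator f x ∂μ) atTop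
      (𝓝 (∫⁻ _, 0 ∂μ)) := by
    refine tendsto_lintegral_of_dominated_convergence f
      (fun N => hf.indicator (measurableSet_lt measurable_const hf))
      (fun N => ae_of_all _ fun x => Set.indicator_le_self _ _ x) hfi ?_
    filter_upwards [ae_lt_top hf hfi] with x hx
    obtain ⟨N, hN⟩ := ENNReal.exists_nat_gt hx.ne
    refine tendsto_const_nhds.congr' ?_
    filter_upwards [eventually_ge_atTop N] with n hn
    refine (Set.indicator_of_notMem (s := {x | (n : ℝ≥0∞) < f x}) ?_ f).symm
    exact not_lt.2 (hN.le.trans (by exact_mod_cast hn))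
  rw [lintegral_zero] at hlim
  exact ((hlim.eventually (gt_mem_nhds he)).exists).imp fun N hN => hN.le

/-! ### Integrals against the action kernels -/

section Kernel

variable {T : ℕ} {X : ℕ → Type*} {A : Type*} [∀ j, MeasurableSpace (X j)]
  [MeasurableSpace A] {lam : Measure A} [SigmaFinite lam] {acts : Fin T → Set A}

lemma Policy.integral_kernel (p : Policy T X A lam acts) (t : Fin T) (s : Hist X A t)
    (f : A → ℝ) : ∫ b, f b ∂(p.kernel t s) = ∫ b in acts t, p.dens t s b * f b ∂lam := by
  rw [p.kernel_apply, integral_withDensity_eq_integral_toReal_smul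
    (p.measurable_dens_left t s).ennreal_ofReal (ae_of_all _ fun _ => ENNReal.ofReal_lt_top)]
  refine integral_congr_ae (ae_of_all _ fun b => ?_)
  simp only [ENNReal.toReal_ofReal (p.dens_nonneg t s b), smul_eq_mul]

lemma Policy.ae_kernel_iff (p : Policy T X A lam acts) (t : Fin T) (s : Hist X A t)
    {r : A → Prop} :
    (∀ᵐ b ∂(p.kernel t s), r b) ↔
      ∀ᵐ b ∂(lam.restrict (acts t)), 0 < p.dens t s b → r b := by
  rw [p.kernel_apply, ae_withDensity_iff (p.measurable_dens_left t s).ennreal_ofReal]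
  simp

/-- Multiplying by the density undoes the division; on the zero set of the density both sides vanish
because `u` does. With `u` the direction, this turns integrals against `π'` into kernel integrals of
the score. -/
lemma Policy.lintegral_enorm_div_mul (p : Policy T X A lam acts) (t : Fin T) (s : Hist X A t)
    {u : A → ℝ} (hu : ∀ᵐ a ∂(lam.restrict (acts t)), p.dens t s a = 0 → u a = 0)
    (g : A → ℝ≥0∞) :
    ∫⁻ b, ‖u b / p.dens t s b‖ₑ * g b ∂(p.kernel t s) = ∫⁻ b in acts t, ‖u b‖ₑ * g b ∂lam := by
  rw [p.lintegral_kernel]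
  refine lintegral_congr_ae ?_
  filter_upwards [hu] with b hb
  rcases eq_or_ne (p.dens t s b) 0 with h | h
  · simp [h, hb h]
  · rw [← mul_assoc, ← Real.enorm_of_nonneg (p.dens_nonneg t s b), ← enorm_mul, mul_div_cancel₀ _ h]

lemma Policy.integral_mul_div (p : Policy T X A lam acts) (t : Fin T) (s : Hist X A t)
    {u : A → ℝ} (hu : ∀ᵐ a ∂(lam.restrict (acts t)), p.dens t s a = 0 → u a = 0)
    (g : A → ℝ) :
    ∫ b, g b * (u b / p.dens t s b) ∂(p.kernel t s) = ∫ b in acts t, g b * u b ∂lam := by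
  rw [p.integral_kernel]
  refine integral_congr_ae ?_
  filter_upwards [hu] with b hb
  rcases eq_or_ne (p.dens t s b) 0 with h | h
  · simp [h, hb h]
  · rw [mul_left_comm, mul_div_cancel₀ _ h]

lemma Policy.kernel_univ (p : Policy T X A lam acts) (t : Fin T) (s : Hist X A t) :
    p.kernel t s Set.univ = 1 := measure_univ

lemma iterVal_one (p : Policy T X A lam acts) (s : ℕ) (τ : (Fin T → A) → Hist X A T) :
    ∀ a, iterVal p (fun _ => 1) s τ a = 1 := by
  induction s using stage_induction (T := T) with
  | h0 s h => exact fun a => iterVal_of_le p _ h τ a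
  | h1 s h ih =>
    intro a
    rw [iterVal_of_lt p _ h]
    simp only [ih]
    exact (lintegral_one.trans (p.kernel_univ ⟨s, h⟩ _))

end Kernel

/-! ### Laws of histories under the weights of later stages -/

namespace Model

variable {T : ℕ} {X : ℕ → Type*} {A : Type*} {Ω : Type*} [∀ j, MeasurableSpace (X j)]
  [MeasurableSpace A] [mΩ : MeasurableSpace Ω] {M : Model T X A Ω}
  {lam : Measure A} [SigmaFinite lam] {acts : Fin T → Set A} {P : Measure Ω}
  {p p₀ : Policy T X A lam acts}

/-- Absolute continuity of the action distributions of `p` with respect to those of `p₀`, at almost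
every observed history. -/
def Supported (M : Model T X A Ω) (P : Measure Ω) (p p₀ : Policy T X A lam acts) : Prop :=
  ∀ t, ∀ᵐ ω ∂P, p.kernel t (M.state t ω) ≪ p₀.kernel t (M.state t ω)

lemma FollowsPolicy.integral_act [IsProbabilityMeasure P] (hp : M.FollowsPolicy P p₀) (t : Fin T)
    {φ : Hist X A t → A → ℝ} (hφ : Measurable (Function.uncurry φ))
    (hφi : Integrable (fun ω => φ (M.state t ω) (M.act t ω)) P) :
    ∫ ω, φ (M.state t ω) (M.act t ω) ∂P =
      ∫ ω, ∫ b, φ (M.state t ω) b ∂(p₀.kernel t (M.state t ω)) ∂P := by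
  have : IsProbabilityMeasure (P.map (M.state t)) :=
    Measure.isProbabilityMeasure_map (M.measurable_state t).aemeasurable
  have hm := M.measurable_state_act t
  have h1 := integral_map (μ := P) hm.aemeasurable hφ.aestronglyMeasurable
  have h2 : Integrable (Function.uncurry φ) (P.map fun ω => (M.state t ω, M.act t ω)) :=
    (integrable_map_measure hφ.aestronglyMeasurable hm.aemeasurable).2 hφi
  rw [hp t] at h1 h2
  rw [Measure.integral_compProd h2] at h1
  refine h1.symm.trans (integral_map (M.measurable_state t).aemeasurable ?_)
  exact (hφ.stronglyMeasurable.integral_kernel_prod_right (κ := p₀.kernel t)).aestronglyMeasurable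

lemma FollowsPolicy.ae_dens_pos [IsProbabilityMeasure P] (hp : M.FollowsPolicy P p₀) (t : Fin T) :
    ∀ᵐ ω ∂P, 0 < p₀.dens t (M.state t ω) (M.act t ω) :=
  (hp.ae_act_iff t (measurableSet_lt measurable_const (p₀.measurable_dens t))).2
    (ae_of_all _ fun _ => p₀.ae_dens_pos t _)

/-- By the g-formula the weight from stage `t + 1` on only redraws actions after stage `t`, so
`(S_t, A_t)` keeps its law. This property removes the weights in all the limit arguments below. -/
lemma lintegral_weight_mul_act [IsProbabilityMeasure P] (hcons : M.Consistency P)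
    (hSU : M.SequentialUnconfoundedness P) (hp : M.FollowsPolicy P p₀) (hac : M.Supported P p p₀)
    (t : Fin T) {g : Hist X A t → A → ℝ≥0∞}
    (hg : Measurable (Function.uncurry g)) (hgt : ∀ s a, g s a ≠ ∞) :
    ∫⁻ ω, ENNReal.ofReal (weight p p₀ (t + 1) (M.traj ω)) * g (M.state t ω) (M.act t ω) ∂P =
      ∫⁻ ω, g (M.state t ω) (M.act t ω) ∂P := by
  refine (lintegral_iterVal_eq_weight hcons hSU hp hac ((t : ℕ) + 1)
    (measurable_stage hg)).symm.trans (lintegral_congr_ae ?_)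
  filter_upwards [hcons] with ω hω
  have h := iterVal_mul p (fun _ => 1) (fun z => g (stateAt t z) (actionAt t z)) (M.poTraj ω)
    (hgt (M.state t ω) (M.act t ω)) ((t : ℕ) + 1) (a := M.actions ω) fun c hc => by
      have h1 : stateAt t (M.poTraj ω c) = M.state t ω := by
        refine (M.nonAnticipative_poTraj ω t c (M.actions ω) fun i hi => hc i ?_).trans ?_
        · have := Fin.lt_def.1 hi
          omega
        · rw [← hω]; rfl
      have h2 : actionAt t (M.poTraj ω c) = M.act t ω := hc t (by omega)
      rw [h1, h2]
  simpa only [mul_one, iterVal_one] using h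

lemma lintegral_weight_mul_state [IsProbabilityMeasure P] (hcons : M.Consistency P)
    (hSU : M.SequentialUnconfoundedness P) (hp : M.FollowsPolicy P p₀) (hac : M.Supported P p p₀)
    (t : Fin T) {g : Hist X A t → ℝ≥0∞} (hg : Measurable g) (hgt : ∀ s, g s ≠ ∞) :
    ∫⁻ ω, ENNReal.ofReal (weight p p₀ t (M.traj ω)) * g (M.state t ω) ∂P =
      ∫⁻ ω, g (M.state t ω) ∂P := by
  refine (lintegral_iterVal_eq_weight hcons hSU hp hac (t : ℕ)
    (hg.comp (measurable_stateAt t))).symm.trans (lintegral_congr_ae ?_)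
  filter_upwards [hcons] with ω hω
  have h := iterVal_mul p (fun _ => 1) (fun z => g (stateAt t z)) (M.poTraj ω)
    (hgt (M.state t ω)) t (a := M.actions ω) fun c hc => by
      have h1 : stateAt t (M.poTraj ω c) = M.state t ω := by
        refine (M.nonAnticipative_poTraj ω t c (M.actions ω) fun i hi =>
          hc i (Fin.lt_def.1 hi)).trans ?_
        rw [← hω]; rfl
      rw [h1]
  simp only [mul_one, iterVal_one] at h
  exact h

lemma lintegral_weight [IsProbabilityMeasure P] (hcons : M.Consistency P)
    (hSU : M.SequentialUnconfoundedness P) (hp : M.FollowsPolicy P p₀) (hac : M.Supported P p p₀)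
    (s : ℕ) : ∫⁻ ω, ENNReal.ofReal (weight p p₀ s (M.traj ω)) ∂P = 1 := by
  have h := lintegral_iterVal_eq_weight hcons hSU hp hac s (f := fun _ => 1) measurable_const
  simp only [iterVal_one, mul_one, lintegral_one, measure_univ] at h
  exact h.symm

lemma integrable_weight [IsProbabilityMeasure P] (hcons : M.Consistency P)
    (hSU : M.SequentialUnconfoundedness P) (hp : M.FollowsPolicy P p₀) (hac : M.Supported P p p₀)
    (s : ℕ) : Integrable (fun ω => weight p p₀ s (M.traj ω)) P := by
  refine ⟨((measurable_weight p p₀ s).comp M.measurable_traj).aestronglyMeasurable, ?_⟩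
  rw [hasFiniteIntegral_iff_ofReal (ae_of_all _ fun _ => weight_nonneg _ _ _ _),
    lintegral_weight hcons hSU hp hac s]
  exact ENNReal.one_lt_top

/-- Stated as an equality of laws so that signed functions of `(S_t, A_t)` can be integrated with no
integrability condition. -/
lemma withDensity_weight_map_act [IsProbabilityMeasure P] (hcons : M.Consistency P)
    (hSU : M.SequentialUnconfoundedness P) (hp : M.FollowsPolicy P p₀) (hac : M.Supported P p p₀)
    (t : Fin T) :
    (P.withDensity fun ω => ENNReal.ofReal (weight p p₀ (t + 1) (M.traj ω))).map
      (fun ω => (M.state t ω, M.act t ω)) = P.map fun ω => (M.state t ω, M.act t ω) := by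
  have hm := M.measurable_state_act t
  have hw : Measurable fun ω => ENNReal.ofReal (weight p p₀ (t + 1) (M.traj ω)) :=
    ((measurable_weight p p₀ _).comp M.measurable_traj).ennreal_ofReal
  ext D hD
  rw [Measure.map_apply hm hD, Measure.map_apply hm hD, withDensity_apply _ (hm hD),
    ← lintegral_indicator (hm hD), ← lintegral_indicator_one (hm hD)]
  have h := lintegral_weight_mul_act hcons hSU hp hac t
    (g := fun s a => D.indicator (fun _ => 1) (s, a)) (measurable_const.indicator hD)
    (fun s a => by by_cases h : (s, a) ∈ D <;> simp [h])
  refine Eq.trans (lintegral_congr fun ω => ?_) (h.trans (lintegral_congr fun ω => ?_))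
  · by_cases h : (M.state t ω, M.act t ω) ∈ D <;> simp [Set.indicator, h]
  · by_cases h : (M.state t ω, M.act t ω) ∈ D <;> simp [Set.indicator, h]

lemma withDensity_weight_map_state [IsProbabilityMeasure P] (hcons : M.Consistency P)
    (hSU : M.SequentialUnconfoundedness P) (hp : M.FollowsPolicy P p₀) (hac : M.Supported P p p₀)
    (t : Fin T) :
    (P.withDensity fun ω => ENNReal.ofReal (weight p p₀ t (M.traj ω))).map (M.state t) =
      P.map (M.state t) := by
  have hm := M.measurable_state t
  ext D hD
  rw [Measure.map_apply hm hD, Measure.map_apply hm hD, withDensity_apply _ (hm hD),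
    ← lintegral_indicator (hm hD), ← lintegral_indicator_one (hm hD)]
  have h := lintegral_weight_mul_state hcons hSU hp hac t
    (g := fun s => D.indicator (fun _ => 1) s) (measurable_const.indicator hD)
    (fun s => by by_cases h : s ∈ D <;> simp [h])
  refine Eq.trans (lintegral_congr fun ω => ?_) (h.trans (lintegral_congr fun ω => ?_))
  · by_cases h : M.state t ω ∈ D <;> simp [Set.indicator, h]
  · by_cases h : M.state t ω ∈ D <;> simp [Set.indicator, h]

lemma integral_withDensity_weight (M : Model T X A Ω) (P : Measure Ω)
    (p p₀ : Policy T X A lam acts) (s : ℕ) (f : Ω → ℝ) :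
    ∫ ω, f ω ∂(P.withDensity fun ω => ENNReal.ofReal (weight p p₀ s (M.traj ω))) =
      ∫ ω, weight p p₀ s (M.traj ω) * f ω ∂P := by
  refine (integral_withDensity_eq_integral_toReal_smul
    (f := fun ω => ENNReal.ofReal (weight p p₀ s (M.traj ω)))
    ((measurable_weight p p₀ s).comp M.measurable_traj).ennreal_ofReal
    (ae_of_all _ fun _ => ENNReal.ofReal_lt_top) f).trans ?_
  refine integral_congr_ae (ae_of_all _ fun ω => ?_)
  simp only [ENNReal.toReal_ofReal (weight_nonneg _ _ _ _), smul_eq_mul]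

lemma integral_weight_mul_act [IsProbabilityMeasure P] (hcons : M.Consistency P)
    (hSU : M.SequentialUnconfoundedness P) (hp : M.FollowsPolicy P p₀) (hac : M.Supported P p p₀)
    (t : Fin T) {φ : Hist X A t → A → ℝ} (hφ : Measurable (Function.uncurry φ)) :
    ∫ ω, weight p p₀ (t + 1) (M.traj ω) * φ (M.state t ω) (M.act t ω) ∂P =
      ∫ ω, φ (M.state t ω) (M.act t ω) ∂P := by
  rw [← integral_withDensity_weight]
  have hm := M.measurable_state_act t
  refine (integral_map (f := Function.uncurry φ) hm.aemeasurable
    hφ.aestronglyMeasurable).symm.trans ?_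
  rw [withDensity_weight_map_act hcons hSU hp hac t]
  exact integral_map (f := Function.uncurry φ) hm.aemeasurable hφ.aestronglyMeasurable

lemma integral_weight_mul_state [IsProbabilityMeasure P] (hcons : M.Consistency P)
    (hSU : M.SequentialUnconfoundedness P) (hp : M.FollowsPolicy P p₀) (hac : M.Supported P p p₀)
    (t : Fin T) {φ : Hist X A t → ℝ} (hφ : Measurable φ) :
    ∫ ω, weight p p₀ t (M.traj ω) * φ (M.state t ω) ∂P = ∫ ω, φ (M.state t ω) ∂P := by
  rw [← integral_withDensity_weight]
  have hm := M.measurable_state t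
  refine (integral_map (f := φ) hm.aemeasurable hφ.aestronglyMeasurable).symm.trans ?_
  rw [withDensity_weight_map_state hcons hSU hp hac t]
  exact integral_map (f := φ) hm.aemeasurable hφ.aestronglyMeasurable

end Model

/-! ### Welfare before and after a stage -/

section Welfare

variable {T : ℕ} {X : ℕ → Type*} {A : Type*}

/-- The discounted rewards before stage `t`, as a function of the history of stage `t`. -/
def pastWelfare (γ : ℝ) (t : Fin T) (s : Hist X A t) : ℝ := ∑ k : Fin t, γ ^ (k : ℕ) * s.2.2 k

lemma welfare_eq_pastWelfare_add (γ : ℝ) (t : Fin T) (z : Hist X A T) :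
    welfare γ z = pastWelfare γ t (stateAt t z) + γ ^ (t : ℕ) * cumReward γ t z := by
  have h1 : γ ^ (t : ℕ) * cumReward γ t z = ∑ k ∈ Finset.Ici t, γ ^ (k : ℕ) * z.2.2 k := by
    rw [cumReward, Finset.mul_sum]
    refine Finset.sum_congr rfl fun k hk => ?_
    have := Fin.le_def.1 (Finset.mem_Ici.1 hk)
    rw [← mul_assoc, ← pow_add]
    congr 3
    omega
  have h2 : pastWelfare γ t (stateAt t z) = ∑ k ∈ Finset.Iio t, γ ^ (k : ℕ) * z.2.2 k := by
    refine Finset.sum_bij (fun (k : Fin t) _ => Fin.castLE (by omega) k) (fun k _ => ?_)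
      (fun a _ b _ h => ?_) (fun k hk => ?_) fun k _ => rfl
    · exact Finset.mem_Iio.2 (Fin.lt_def.2 k.2)
    · exact Fin.castLE_injective _ h
    · exact ⟨⟨k, Fin.lt_def.1 (Finset.mem_Iio.1 hk)⟩, Finset.mem_univ _, rfl⟩
  rw [h1, h2, welfare, ← Finset.sum_union]
  · refine Finset.sum_congr (Finset.ext fun k => ?_) fun _ _ => rfl
    simp [lt_or_ge]
  · rw [Finset.disjoint_left]
    intro k hk hk'
    exact absurd (Finset.mem_Ici.1 hk') (not_le.2 (Finset.mem_Iio.1 hk))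

variable [∀ j, MeasurableSpace (X j)] [MeasurableSpace A]

lemma measurable_pastWelfare (γ : ℝ) (t : Fin T) :
    Measurable (pastWelfare (X := X) (A := A) γ t) :=
  Finset.measurable_fun_sum _ fun k _ =>
    ((measurable_pi_apply k).comp (measurable_snd.comp measurable_snd)).const_mul _

lemma measurable_welfare (γ : ℝ) :
    Measurable (welfare (X := X) (A := A) (T := T) γ) :=
  Finset.measurable_fun_sum _ fun k _ =>
    ((measurable_pi_apply k).comp (measurable_snd.comp measurable_snd)).const_mul _

end Welfare

/-! ### Difference quotients of action kernels -/

section Kernel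

variable {T : ℕ} {X : ℕ → Type*} {A : Type*} [∀ j, MeasurableSpace (X j)]
  [MeasurableSpace A] {lam : Measure A} [SigmaFinite lam] {acts : Fin T → Set A}

lemma measurable_dirScore (p : Policy T X A lam acts) {dir : (t : Fin T) → Hist X A t → A → ℝ}
    {t : Fin T} (hdir : Measurable (Function.uncurry (dir t))) :
    Measurable (Function.uncurry (dirScore p dir t)) :=
  hdir.div (p.measurable_dens t)

/-- Only an inequality, because the kernel ignores the zero set of the baseline density, where the
right-hand side may still contribute. -/
lemma lintegral_kernel_score_sub_le (p p₀ : Policy T X A lam acts)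
    (dir : (t : Fin T) → Hist X A t → A → ℝ) (t : Fin T) (s : Hist X A t) (ε : ℝ)
    (g : A → ℝ≥0∞) :
    ∫⁻ b, ‖(ratio p p₀ t s b - 1) / ε - dirScore p₀ dir t s b‖ₑ * g b ∂(p₀.kernel t s) ≤
      ∫⁻ b in acts t, ‖(p.dens t s b - p₀.dens t s b) / ε - dir t s b‖ₑ * g b ∂lam := by
  rw [p₀.lintegral_kernel]
  refine lintegral_mono fun b => ?_
  rcases eq_or_ne (p₀.dens t s b) 0 with h | h
  · simp [h]
  · rw [← mul_assoc, ← Real.enorm_of_nonneg (p₀.dens_nonneg t s b), ← enorm_mul]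
    refine le_of_eq ?_
    congr 2
    rw [ratio, dirScore]
    rcases eq_or_ne ε 0 with hε | hε
    · rw [hε]; field_simp
    · field_simp

lemma lintegral_kernel_dirScore_le (p₀ : Policy T X A lam acts)
    (dir : (t : Fin T) → Hist X A t → A → ℝ) (t : Fin T) (s : Hist X A t) (g : A → ℝ≥0∞) :
    ∫⁻ b, ‖dirScore p₀ dir t s b‖ₑ * g b ∂(p₀.kernel t s) ≤
      ∫⁻ b in acts t, ‖dir t s b‖ₑ * g b ∂lam := by
  rw [p₀.lintegral_kernel]
  refine lintegral_mono fun b => ?_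
  rcases eq_or_ne (p₀.dens t s b) 0 with h | h
  · simp [h]
  · rw [← mul_assoc, ← Real.enorm_of_nonneg (p₀.dens_nonneg t s b), ← enorm_mul, dirScore,
      mul_div_cancel₀ _ h]

lemma lintegral_kernel_ratio_le_one (p p₀ : Policy T X A lam acts) (t : Fin T) (s : Hist X A t) :
    ∫⁻ b, ENNReal.ofReal (ratio p p₀ t s b) ∂(p₀.kernel t s) ≤ 1 := by
  rw [p₀.lintegral_kernel, ← p.lintegral_dens t s]
  refine lintegral_mono fun b => ?_
  rcases eq_or_ne (p₀.dens t s b) 0 with h | h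
  · simp [h]
  · rw [← ENNReal.ofReal_mul (p₀.dens_nonneg t s b), ratio, mul_div_cancel₀ _ h]

/-- The ratio and the constant 1 each have mass at most 1. No support condition enters, so 2 is a
uniform dominating constant along any path. -/
lemma lintegral_kernel_ratio_sub_one_le (p p₀ : Policy T X A lam acts) (t : Fin T)
    (s : Hist X A t) : ∫⁻ b, ‖ratio p p₀ t s b - 1‖ₑ ∂(p₀.kernel t s) ≤ 2 := by
  calc ∫⁻ b, ‖ratio p p₀ t s b - 1‖ₑ ∂(p₀.kernel t s)
      ≤ ∫⁻ b, (ENNReal.ofReal (ratio p p₀ t s b) + 1) ∂(p₀.kernel t s) := by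
        refine lintegral_mono fun b => (enorm_sub_le).trans ?_
        rw [Real.enorm_of_nonneg (ratio_nonneg _ _ _ _ _), enorm_one]
    _ ≤ 1 + 1 := by
        rw [lintegral_add_right _ measurable_const, lintegral_one, p₀.kernel_univ]
        gcongr
        exact lintegral_kernel_ratio_le_one p p₀ t s
    _ = 2 := one_add_one_eq_two

end Kernel

/-! ### Performance difference and limits along the path -/

namespace Model

variable {T : ℕ} {X : ℕ → Type*} {A : Type*} {Ω : Type*} [∀ j, MeasurableSpace (X j)]
  [MeasurableSpace A] [mΩ : MeasurableSpace Ω] {M : Model T X A Ω}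
  {lam : Measure A} [SigmaFinite lam] {acts : Fin T → Set A} {P : Measure Ω}

section PerformanceDifference

variable {p p₀ : Policy T X A lam acts} {γ R : ℝ}

lemma expectedWelfare_eq_integral_weight [IsProbabilityMeasure P] (hcons : M.Consistency P)
    (hSU : M.SequentialUnconfoundedness P) (hp : M.FollowsPolicy P p₀) (hac : M.Supported P p p₀)
    (γ : ℝ) : M.expectedWelfare P γ p =
      ∫ ω, weight p p₀ 0 (M.traj ω) * welfare γ (M.traj ω) ∂P := by
  rw [expectedWelfare, policyLaw_eq_map_withDensity hcons hSU hp hac,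
    integral_map M.measurable_traj.aemeasurable (measurable_welfare γ).aestronglyMeasurable,
    integral_withDensity_weight]

lemma expectedWelfare_self [IsProbabilityMeasure P] (hcons : M.Consistency P)
    (hSU : M.SequentialUnconfoundedness P) (hp : M.FollowsPolicy P p₀) (γ : ℝ) :
    M.expectedWelfare P γ p₀ = ∫ ω, welfare γ (M.traj ω) ∂P := by
  rw [expectedWelfare_eq_integral_weight hcons hSU hp (fun _ => ae_of_all _ fun _ =>
    Measure.AbsolutelyContinuous.rfl) γ]
  refine integral_congr_ae ?_
  filter_upwards [ae_all_iff.2 hp.ae_dens_pos] with ω hω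
  have : weight p₀ p₀ 0 (M.traj ω) = 1 :=
    Finset.prod_eq_one fun k _ => div_self (hω k).ne'
  rw [this, one_mul]

/-- One step of the telescoping. Rewards before stage `t` are a function of `S_t`, whose law both
weights preserve, so they cancel. What remains is `Γ_t` against the difference of the weights, which
is the ratio minus 1 times the later weight. -/
lemma integral_weight_mul_welfare_sub [IsProbabilityMeasure P] (hcons : M.Consistency P)
    (hSU : M.SequentialUnconfoundedness P) (hp : M.FollowsPolicy P p₀) (hac : M.Supported P p p₀)
    (hγ : 0 ≤ γ) (hR : ∀ t, ∀ᵐ ω ∂P, |M.rew t ω| ≤ R) (t : Fin T) :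
    ∫ ω, weight p p₀ t (M.traj ω) * welfare γ (M.traj ω) ∂P -
      ∫ ω, weight p p₀ (t + 1) (M.traj ω) * welfare γ (M.traj ω) ∂P =
    γ ^ (t : ℕ) * ∫ ω, (ratio p p₀ t (M.state t ω) (M.act t ω) - 1) *
      weight p p₀ (t + 1) (M.traj ω) * cumReward γ t (M.traj ω) ∂P := by
  have hpast : ∀ᵐ ω ∂P, ‖pastWelfare γ t (M.state t ω)‖ ≤ ∑ k : Fin t, γ ^ (k : ℕ) * R := by
    filter_upwards [ae_all_iff.2 hR] with ω hω
    refine (norm_sum_le _ _).trans (Finset.sum_le_sum fun k _ => ?_)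
    rw [norm_mul, Real.norm_of_nonneg (pow_nonneg hγ _)]
    exact mul_le_mul_of_nonneg_left (hω (Fin.castLE (by omega) k)) (pow_nonneg hγ _)
  have hpm : AEStronglyMeasurable (fun ω => pastWelfare γ t (M.state t ω)) P :=
    ((measurable_pastWelfare γ t).comp (M.measurable_state t)).aestronglyMeasurable
  have hΓ := ae_abs_cumReward_le hγ hR t
  have hΓm : AEStronglyMeasurable (fun ω => cumReward γ t (M.traj ω)) P :=
    ((measurable_cumReward γ t).comp M.measurable_traj).aestronglyMeasurable
  have hsplit : ∀ s : ℕ, ∫ ω, weight p p₀ s (M.traj ω) * welfare γ (M.traj ω) ∂P =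
      ∫ ω, weight p p₀ s (M.traj ω) * pastWelfare γ t (M.state t ω) ∂P +
        γ ^ (t : ℕ) * ∫ ω, weight p p₀ s (M.traj ω) * cumReward γ t (M.traj ω) ∂P := by
    intro s
    have hw := integrable_weight hcons hSU hp hac s
    rw [← integral_const_mul, ← integral_add (hw.mul_bdd hpm hpast)
      ((hw.mul_bdd hΓm hΓ).const_mul _)]
    refine integral_congr_ae (ae_of_all _ fun ω => ?_)
    simp only [welfare_eq_pastWelfare_add γ t (M.traj ω)]
    rw [state]
    ring
  have h1 := integral_weight_mul_state hcons hSU hp hac t (measurable_pastWelfare γ t)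
  have h2 := integral_weight_mul_act hcons hSU hp hac t (φ := fun s _ => pastWelfare γ t s)
    ((measurable_pastWelfare γ t).comp measurable_fst)
  rw [hsplit, hsplit, h1, h2, add_sub_add_left_eq_sub, ← mul_sub, ← integral_sub
    ((integrable_weight hcons hSU hp hac t).mul_bdd hΓm hΓ)
    ((integrable_weight hcons hSU hp hac (t + 1)).mul_bdd hΓm hΓ)]
  congr 1
  refine integral_congr_ae (ae_of_all _ fun ω => ?_)
  simp only [weight_of_lt p p₀ t.2 (M.traj ω)]
  change ratio p p₀ t (M.state t ω) (M.act t ω) * _ * _ - _ = _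
  ring

/-- The performance-difference identity. -/
lemma expectedWelfare_sub [IsProbabilityMeasure P] (hcons : M.Consistency P)
    (hSU : M.SequentialUnconfoundedness P) (hp : M.FollowsPolicy P p₀) (hac : M.Supported P p p₀)
    (hγ : 0 ≤ γ) (hR : ∀ t, ∀ᵐ ω ∂P, |M.rew t ω| ≤ R) :
    M.expectedWelfare P γ p - M.expectedWelfare P γ p₀ =
      ∑ t : Fin T, γ ^ (t : ℕ) * ∫ ω, (ratio p p₀ t (M.state t ω) (M.act t ω) - 1) *
        weight p p₀ (t + 1) (M.traj ω) * cumReward γ t (M.traj ω) ∂P := by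
  rw [expectedWelfare_eq_integral_weight hcons hSU hp hac, expectedWelfare_self hcons hSU hp]
  simp_rw [← integral_weight_mul_welfare_sub hcons hSU hp hac hγ hR]
  -- The sum telescopes from the full weight at `s = 0` to the empty product at `s = T`.
  rw [Fin.sum_univ_eq_sum_range (fun s => ∫ ω, weight p p₀ s (M.traj ω) * welfare γ (M.traj ω) ∂P -
      ∫ ω, weight p p₀ (s + 1) (M.traj ω) * welfare γ (M.traj ω) ∂P) T, Finset.sum_range_sub']
  simp only [weight_of_le p p₀ le_rfl, one_mul]

lemma integrable_ratio_sub_one [IsProbabilityMeasure P] (hp : M.FollowsPolicy P p₀) (t : Fin T) :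
    Integrable (fun ω => ratio p p₀ t (M.state t ω) (M.act t ω) - 1) P := by
  have hm : Measurable (Function.uncurry fun s a => ratio p p₀ t s a - 1) :=
    (measurable_ratio p p₀ t).sub_const 1
  refine ⟨(hm.comp (M.measurable_state_act t)).aestronglyMeasurable, ?_⟩
  rw [HasFiniteIntegral, hp.lintegral_act t (F := fun s a => ‖ratio p p₀ t s a - 1‖ₑ) hm.enorm]
  refine (lintegral_mono fun ω => lintegral_kernel_ratio_sub_one_le p p₀ t _).trans_lt ?_
  simp

end PerformanceDifference

section Path

variable {p : ℝ → Policy T X A lam acts} {dir : (t : Fin T) → Hist X A t → A → ℝ}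

lemma DifferentiablePath.eventually_supported (hpath : M.DifferentiablePath P p dir) :
    ∀ᶠ ε in 𝓝 (0 : ℝ), M.Supported P (p ε) (p 0) := by
  filter_upwards [hpath.supported] with ε hε t
  exact ae_of_ae_map (M.measurable_state t).aemeasurable (hε t)

lemma DifferentiablePath.ae_tendsto (hpath : M.DifferentiablePath P p dir) (t : Fin T) :
    ∀ᵐ ω ∂P, Tendsto (fun ε : ℝ => ∫⁻ a in acts t,
      ‖((p ε).dens t (M.state t ω) a - (p 0).dens t (M.state t ω) a) / ε
        - dir t (M.state t ω) a‖ₑ ∂lam) (𝓝[≠] 0) (𝓝 0) :=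
  ae_of_ae_map (M.measurable_state t).aemeasurable (hpath.tendsto_dir t)

/-- The direction vanishes where the baseline density does. -/
lemma DifferentiablePath.ae_dir_eq_zero (hpath : M.DifferentiablePath P p dir) (t : Fin T) :
    ∀ᵐ ω ∂P, ∀ᵐ a ∂(lam.restrict (acts t)),
      (p 0).dens t (M.state t ω) a = 0 → dir t (M.state t ω) a = 0 := by
  -- The null set of exceptional histories depends on `ε`, so absolute continuity is used only along
  -- a sequence tending to zero.
  have hseq : Tendsto (fun n : ℕ => 1 / ((n : ℝ) + 1)) atTop (𝓝[≠] 0) :=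
    tendsto_nhdsWithin_iff.2 ⟨tendsto_one_div_add_atTop_nhds_zero_nat,
      Eventually.of_forall fun n => by simp only [Set.mem_compl_iff, Set.mem_singleton_iff]; positivity⟩
  obtain ⟨N, hN⟩ := eventually_atTop.1
    ((hseq.mono_right nhdsWithin_le_nhds).eventually hpath.eventually_supported)
  have hac : ∀ᵐ ω ∂P, ∀ n, (p (1 / (((n + N : ℕ) : ℝ) + 1))).kernel t (M.state t ω) ≪
      (p 0).kernel t (M.state t ω) := ae_all_iff.2 fun n => hN (n + N) (by omega) t
  filter_upwards [hac, hpath.ae_tendsto t] with ω hω hlim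
  set s := M.state t ω
  have hdm : Measurable (dir t s) := (hpath.measurable_dir t).comp measurable_prodMk_left
  have hE : MeasurableSet {a | (p 0).dens t s a = 0} :=
    (p 0).measurable_dens_left t s (measurableSet_singleton 0)
  set E := {a | (p 0).dens t s a = 0}
  -- On the zero set of the baseline density both densities vanish, and the `L¹` error of the
  -- difference quotient is at least the mass of the direction there.
  have hle : ∀ n : ℕ, ∫⁻ a in acts t, E.indicator (fun a => ‖dir t s a‖ₑ) a ∂lam ≤
      ∫⁻ a in acts t, ‖((p (1 / (((n + N : ℕ) : ℝ) + 1))).dens t s a - (p 0).dens t s a) /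
        (1 / (((n + N : ℕ) : ℝ) + 1)) - dir t s a‖ₑ ∂lam := by
    intro n
    refine lintegral_mono_ae ?_
    filter_upwards [ae_dens_eq_zero_of_absolutelyContinuous (hω n)] with a ha
    by_cases haE : a ∈ E
    · rw [Set.indicator_of_mem haE, ha haE, show (p 0).dens t s a = 0 from haE]
      simp
    · rw [Set.indicator_of_notMem haE]
      exact zero_le
  have h0 : ∫⁻ a in acts t, E.indicator (fun a => ‖dir t s a‖ₑ) a ∂lam = 0 :=
    le_antisymm (ge_of_tendsto' ((hlim.comp hseq).comp (tendsto_add_atTop_nat N)) hle) (zero_le)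
  rw [lintegral_eq_zero_iff (hdm.enorm.indicator hE)] at h0
  filter_upwards [h0] with a ha haE
  rw [Set.indicator_of_mem (show a ∈ E from haE)] at ha
  simpa using ha

/-- Dominated convergence over histories: for a fixed history the kernel integral is at most `C`
times the `L¹` error of the difference quotient, and `D` plus the mass of the direction dominates.
It is applied with `g = 1` before the last stage and with `g = |q_t|` at the last one. -/
lemma DifferentiablePath.tendsto_lintegral_score_sub [IsProbabilityMeasure P]
    (hpath : M.DifferentiablePath P p dir) (hp : M.FollowsPolicy P (p 0)) (t : Fin T)
    {g : Hist X A t → A → ℝ≥0∞} (hg : Measurable (Function.uncurry g)) {C : ℝ≥0∞} (hC : C ≠ ∞)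
    (hgC : ∀ᵐ ω ∂P, g (M.state t ω) (M.act t ω) ≤ C)
    (hdir : ∫⁻ ω, ∫⁻ a in acts t, ‖dir t (M.state t ω) a‖ₑ * g (M.state t ω) a ∂lam ∂P ≠ ∞)
    (hD : ∃ D : Ω → ℝ, Integrable D P ∧ ∀ᶠ ε in 𝓝[≠] (0 : ℝ), ∀ᵐ ω ∂P,
      ∫⁻ a in acts t, ‖((p ε).dens t (M.state t ω) a - (p 0).dens t (M.state t ω) a) / ε‖ₑ *
        g (M.state t ω) a ∂lam ≤ ENNReal.ofReal (D ω)) :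
    Tendsto (fun ε => ∫⁻ ω, ‖(ratio (p ε) (p 0) t (M.state t ω) (M.act t ω) - 1) / ε -
      dirScore (p 0) dir t (M.state t ω) (M.act t ω)‖ₑ * g (M.state t ω) (M.act t ω) ∂P)
      (𝓝[≠] 0) (𝓝 0) := by
  obtain ⟨D, hDi, hDle⟩ := hD
  have hdirm := hpath.measurable_dir t
  have hm : ∀ ε, Measurable (Function.uncurry fun s a =>
      ‖(ratio (p ε) (p 0) t s a - 1) / ε - dirScore (p 0) dir t s a‖ₑ * g s a) := fun ε =>
    (((((measurable_ratio (p ε) (p 0) t).sub_const 1).div_const ε).sub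
      (measurable_dirScore (p 0) hdirm)).enorm).mul hg
  have hgm : ∀ s, Measurable (g s) := fun s => hg.comp measurable_prodMk_left
  have hdgm : Measurable (Function.uncurry fun s a => ‖dir t s a‖ₑ * g s a) := hdirm.enorm.mul hg
  have hrew : ∀ ε, ∫⁻ ω, ‖(ratio (p ε) (p 0) t (M.state t ω) (M.act t ω) - 1) / ε -
      dirScore (p 0) dir t (M.state t ω) (M.act t ω)‖ₑ * g (M.state t ω) (M.act t ω) ∂P =
      ∫⁻ ω, ∫⁻ b, ‖(ratio (p ε) (p 0) t (M.state t ω) b - 1) / ε -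
        dirScore (p 0) dir t (M.state t ω) b‖ₑ * g (M.state t ω) b
          ∂((p 0).kernel t (M.state t ω)) ∂P := fun ε => hp.lintegral_act t (hm ε)
  simp_rw [hrew]
  have hgC' : ∀ᵐ ω ∂P, ∀ᵐ b ∂((p 0).kernel t (M.state t ω)), g (M.state t ω) b ≤ C :=
    (hp.ae_act_iff t (D := {x | g x.1 x.2 ≤ C}) (measurableSet_le hg measurable_const)).1 hgC
  rw [← lintegral_zero (α := Ω) (μ := P)]
  refine tendsto_lintegral_filter_of_dominated_convergence
    (fun ω => ENNReal.ofReal (D ω) + ∫⁻ a in acts t, ‖dir t (M.state t ω) a‖ₑ *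
      g (M.state t ω) a ∂lam) (Eventually.of_forall fun ε => ?_) ?_ ?_ ?_
  · exact ((p 0).measurable_lintegral_kernel t measurable_id (hm ε)).comp (M.measurable_state t)
  · filter_upwards [hDle] with ε hε
    filter_upwards [hε] with ω hω
    refine (lintegral_kernel_score_sub_le (p ε) (p 0) dir t (M.state t ω) ε _).trans ?_
    refine le_trans ?_ (add_le_add_left hω _)
    have hdgω : Measurable fun a => ‖dir t (M.state t ω) a‖ₑ * g (M.state t ω) a :=
      hdgm.comp measurable_prodMk_left
    rw [← lintegral_add_right _ hdgω]
    refine lintegral_mono fun b => ?_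
    rw [← add_mul]
    gcongr
    exact enorm_sub_le
  · have hmeas : Measurable fun ω => ∫⁻ a in acts t, ‖dir t (M.state t ω) a‖ₑ *
        g (M.state t ω) a ∂lam := hdgm.lintegral_prod_right.comp (M.measurable_state t)
    rw [lintegral_add_right _ hmeas]
    exact ENNReal.add_ne_top.2 ⟨hDi.lintegral_lt_top.ne, hdir⟩
  · filter_upwards [hgC', hpath.ae_tendsto t] with ω hω hlim
    have h1 : Tendsto (fun ε : ℝ => (∫⁻ a in acts t,
      ‖((p ε).dens t (M.state t ω) a - (p 0).dens t (M.state t ω) a) / ε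
        - dir t (M.state t ω) a‖ₑ ∂lam) * C) (𝓝[≠] 0) (𝓝 0) := by
      simpa using ENNReal.Tendsto.mul_const hlim (Or.inr hC)
    refine tendsto_of_tendsto_of_tendsto_of_le_of_le tendsto_const_nhds h1 (fun ε => zero_le)
      fun ε => ?_
    have h2 := lintegral_kernel_score_sub_le (p ε) (p 0) dir t (M.state t ω) ε (fun _ => C)
    rw [lintegral_mul_const' _ _ hC, lintegral_mul_const' _ _ hC] at h2
    refine le_trans ?_ h2
    rw [← lintegral_mul_const' _ _ hC]
    refine lintegral_mono_ae ?_
    filter_upwards [hω] with b hb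
    gcongr

/-- For a fixed history, `ratio - 1` is `ε` times a quantity bounded in `L¹` near zero. The constant
2 dominates over histories, so differentiability of the path is enough. -/
lemma DifferentiablePath.tendsto_lintegral_ratio_sub_one [IsProbabilityMeasure P]
    (hpath : M.DifferentiablePath P p dir) (hp : M.FollowsPolicy P (p 0)) (t : Fin T) :
    Tendsto (fun ε => ∫⁻ ω, ‖ratio (p ε) (p 0) t (M.state t ω) (M.act t ω) - 1‖ₑ ∂P)
      (𝓝[≠] 0) (𝓝 0) := by
  have hdirm := hpath.measurable_dir t
  have hm : ∀ ε, Measurable (Function.uncurry fun s a => ‖ratio (p ε) (p 0) t s a - 1‖ₑ) :=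
    fun ε => ((measurable_ratio (p ε) (p 0) t).sub_const 1).enorm
  have hrew : ∀ ε, ∫⁻ ω, ‖ratio (p ε) (p 0) t (M.state t ω) (M.act t ω) - 1‖ₑ ∂P =
      ∫⁻ ω, ∫⁻ b, ‖ratio (p ε) (p 0) t (M.state t ω) b - 1‖ₑ
          ∂((p 0).kernel t (M.state t ω)) ∂P := fun ε => hp.lintegral_act t (hm ε)
  simp_rw [hrew]
  rw [← lintegral_zero (α := Ω) (μ := P)]
  refine tendsto_lintegral_filter_of_dominated_convergence (fun _ => 2)
    (Eventually.of_forall fun ε => ?_) (Eventually.of_forall fun ε => ae_of_all _ fun ω =>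
      lintegral_kernel_ratio_sub_one_le (p ε) (p 0) t _) (by simp) ?_
  · exact ((p 0).measurable_lintegral_kernel t measurable_id (hm ε)).comp (M.measurable_state t)
  · filter_upwards [hpath.ae_tendsto t,
      ae_of_ae_map (M.measurable_state t).aemeasurable (hpath.integrable_dir t)] with ω hlim hint
    set s := M.state t ω
    have hdir : ∫⁻ a in acts t, ‖dir t s a‖ₑ ∂lam ≠ ∞ := hint.2.ne
    have hε0 : Tendsto (fun ε : ℝ => ‖ε‖ₑ) (𝓝[≠] 0) (𝓝 0) := by
      have : Tendsto (fun ε : ℝ => ‖ε‖ₑ) (𝓝 0) (𝓝 ‖(0 : ℝ)‖ₑ) := continuous_enorm.tendsto 0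
      rw [enorm_zero] at this
      exact this.mono_left nhdsWithin_le_nhds
    have h1 : Tendsto (fun ε : ℝ => ‖ε‖ₑ * ((∫⁻ a in acts t,
        ‖((p ε).dens t s a - (p 0).dens t s a) / ε - dir t s a‖ₑ ∂lam) +
          ∫⁻ a in acts t, ‖dir t s a‖ₑ ∂lam)) (𝓝[≠] 0) (𝓝 0) := by
      have h2 := ENNReal.Tendsto.mul hε0 (Or.inr (by simpa using hdir)) (hlim.add_const
        (∫⁻ a in acts t, ‖dir t s a‖ₑ ∂lam)) (Or.inr ENNReal.zero_ne_top)
      simpa using h2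
    refine tendsto_of_tendsto_of_tendsto_of_le_of_le' tendsto_const_nhds h1
      (Eventually.of_forall fun ε => zero_le) ?_
    filter_upwards [self_mem_nhdsWithin] with ε hε
    have h2 := lintegral_kernel_score_sub_le (p ε) (p 0) dir t s ε (fun _ => 1)
    have h3 := lintegral_kernel_dirScore_le (p 0) dir t s (fun _ => 1)
    simp only [mul_one] at h2 h3
    have hHm : Measurable fun b => ‖dirScore (p 0) dir t s b‖ₑ :=
      ((measurable_dirScore (p 0) hdirm).comp measurable_prodMk_left).enorm
    calc ∫⁻ b, ‖ratio (p ε) (p 0) t s b - 1‖ₑ ∂((p 0).kernel t s)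
        ≤ ∫⁻ b, ‖ε‖ₑ * (‖(ratio (p ε) (p 0) t s b - 1) / ε - dirScore (p 0) dir t s b‖ₑ +
            ‖dirScore (p 0) dir t s b‖ₑ) ∂((p 0).kernel t s) := by
          refine lintegral_mono fun b => ?_
          have h4 : ratio (p ε) (p 0) t s b - 1 =
              ε * (((ratio (p ε) (p 0) t s b - 1) / ε - dirScore (p 0) dir t s b) +
                dirScore (p 0) dir t s b) := by
            rw [sub_add_cancel, mul_div_cancel₀ _ hε]
          calc ‖ratio (p ε) (p 0) t s b - 1‖ₑ = _ := congrArg _ h4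
            _ ≤ _ := by
              rw [enorm_mul]
              gcongr
              exact enorm_add_le _ _
      _ ≤ _ := by
          rw [lintegral_const_mul' _ _ enorm_ne_top, lintegral_add_right _ hHm]
          gcongr

variable [IsProbabilityMeasure P]

/-- Backward induction on `w_s - 1 = w_{s+1} (ratio_s - 1) + (w_{s+1} - 1)`, where `w_{s+1}` drops
out of the mean of the first term because `ratio_s` is a function of `(S_s, A_s)`. -/
lemma DifferentiablePath.tendsto_lintegral_weight_sub_one (hpath : M.DifferentiablePath P p dir)
    (hp : M.FollowsPolicy P (p 0)) (hcons : M.Consistency P)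
    (hSU : M.SequentialUnconfoundedness P) (s : ℕ) :
    Tendsto (fun ε => ∫⁻ ω, ‖weight (p ε) (p 0) s (M.traj ω) - 1‖ₑ ∂P) (𝓝[≠] 0) (𝓝 0) := by
  induction s using stage_induction (T := T) with
  | h0 s h => simp [weight_of_le _ _ h]
  | h1 s h ih =>
    set t : Fin T := ⟨s, h⟩
    have hsum := (hpath.tendsto_lintegral_ratio_sub_one hp t).add ih
    rw [add_zero] at hsum
    refine tendsto_of_tendsto_of_tendsto_of_le_of_le' tendsto_const_nhds hsum
      (Eventually.of_forall fun ε => zero_le) ?_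
    filter_upwards [nhdsWithin_le_nhds hpath.eventually_supported] with ε hε
    have hρm : Measurable (Function.uncurry fun s a => ‖ratio (p ε) (p 0) t s a - 1‖ₑ) :=
      ((measurable_ratio (p ε) (p 0) t).sub_const 1).enorm
    rw [← lintegral_weight_mul_act hcons hSU hp hε t hρm (fun _ _ => enorm_ne_top),
      ← lintegral_add_right]
    · refine lintegral_mono fun ω => ?_
      rw [weight_of_lt _ _ h]
      change ‖ratio (p ε) (p 0) t (M.state t ω) (M.act t ω) *
        weight (p ε) (p 0) (s + 1) (M.traj ω) - 1‖ₑ ≤ _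
      have h4 : ratio (p ε) (p 0) t (M.state t ω) (M.act t ω) *
          weight (p ε) (p 0) (s + 1) (M.traj ω) - 1 =
          weight (p ε) (p 0) (s + 1) (M.traj ω) *
            (ratio (p ε) (p 0) t (M.state t ω) (M.act t ω) - 1) +
          (weight (p ε) (p 0) (s + 1) (M.traj ω) - 1) := by ring
      rw [h4]
      refine (enorm_add_le _ _).trans ?_
      rw [enorm_mul, Real.enorm_of_nonneg (weight_nonneg _ _ _ _)]
    · exact (((measurable_weight _ _ _).comp M.measurable_traj).sub_const 1).enorm

/-- Truncation of `h` at a level `N`. Below `N` the weights converge in `L¹`. Above it `|w - 1| ≤ w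
+ 1`, and the weight leaves the mean of the tail of `h` unchanged, so no further integrability of
the weights is needed. -/
lemma DifferentiablePath.tendsto_lintegral_mul_weight_sub_one
    (hpath : M.DifferentiablePath P p dir)
    (hp : M.FollowsPolicy P (p 0)) (hcons : M.Consistency P)
    (hSU : M.SequentialUnconfoundedness P) (t : Fin T) {h : Hist X A t → A → ℝ≥0∞}
    (hh : Measurable (Function.uncurry h)) (hht : ∀ s a, h s a ≠ ∞)
    (hhi : ∫⁻ ω, h (M.state t ω) (M.act t ω) ∂P ≠ ∞) :
    Tendsto (fun ε => ∫⁻ ω, h (M.state t ω) (M.act t ω) *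
      ‖weight (p ε) (p 0) (t + 1) (M.traj ω) - 1‖ₑ ∂P) (𝓝[≠] 0) (𝓝 0) := by
  rw [ENNReal.tendsto_nhds_zero]
  intro e he
  have he4 : 0 < e / 4 := ENNReal.div_pos he.ne' (by simp)
  have hhm : Measurable fun ω => h (M.state t ω) (M.act t ω) := hh.comp (M.measurable_state_act t)
  obtain ⟨N, hN⟩ := exists_lintegral_tail_le hhm hhi he4
  have hlim := ENNReal.Tendsto.const_mul (a := (N : ℝ≥0∞))
    (hpath.tendsto_lintegral_weight_sub_one hp hcons hSU (t + 1)) (Or.inr (by simp))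
  rw [mul_zero] at hlim
  filter_upwards [ENNReal.tendsto_nhds_zero.1 hlim (e / 2) (ENNReal.div_pos he.ne' (by simp)),
    nhdsWithin_le_nhds hpath.eventually_supported] with ε hε hac
  set g : Hist X A t → A → ℝ≥0∞ := fun s a =>
    {x : Hist X A t × A | (N : ℝ≥0∞) < h x.1 x.2}.indicator (Function.uncurry h) (s, a) with hg
  have hgm : Measurable (Function.uncurry g) := hh.indicator (measurableSet_lt measurable_const hh)
  have hgt : ∀ s a, g s a ≠ ∞ := fun s a =>
    ((Set.indicator_le_self _ (Function.uncurry h) (s, a)).trans_lt (hht s a).lt_top).ne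
  have hgN : ∫⁻ ω, g (M.state t ω) (M.act t ω) ∂P ≤ e / 4 := hN
  have hwm : Measurable fun ω => weight (p ε) (p 0) (t + 1) (M.traj ω) :=
    (measurable_weight _ _ _).comp M.measurable_traj
  have hgm' : Measurable fun ω => g (M.state t ω) (M.act t ω) :=
    hgm.comp (M.measurable_state_act t)
  calc ∫⁻ ω, h (M.state t ω) (M.act t ω) * ‖weight (p ε) (p 0) (t + 1) (M.traj ω) - 1‖ₑ ∂P
      ≤ ∫⁻ ω, (N * ‖weight (p ε) (p 0) (t + 1) (M.traj ω) - 1‖ₑ +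
          (ENNReal.ofReal (weight (p ε) (p 0) (t + 1) (M.traj ω)) * g (M.state t ω) (M.act t ω) +
            g (M.state t ω) (M.act t ω))) ∂P := by
        refine lintegral_mono fun ω => ?_
        by_cases hlt : (N : ℝ≥0∞) < h (M.state t ω) (M.act t ω)
        · have : g (M.state t ω) (M.act t ω) = h (M.state t ω) (M.act t ω) :=
            Set.indicator_of_mem (s := {x : Hist X A t × A | (N : ℝ≥0∞) < h x.1 x.2}) hlt _
          rw [this, ← add_one_mul, mul_comm (h _ _)]
          refine le_add_left ?_
          gcongr
          refine enorm_sub_le.trans ?_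
          rw [Real.enorm_of_nonneg (weight_nonneg _ _ _ _), enorm_one]
        · refine le_add_right ?_
          gcongr
          exact not_lt.1 hlt
    _ = N * ∫⁻ ω, ‖weight (p ε) (p 0) (t + 1) (M.traj ω) - 1‖ₑ ∂P +
          (∫⁻ ω, g (M.state t ω) (M.act t ω) ∂P + ∫⁻ ω, g (M.state t ω) (M.act t ω) ∂P) := by
        have hNm : Measurable fun ω =>
            (N : ℝ≥0∞) * ‖weight (p ε) (p 0) (t + 1) (M.traj ω) - 1‖ₑ :=
          (hwm.sub_const 1).enorm.const_mul _
        rw [lintegral_add_left hNm,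
          lintegral_add_right _ hgm', lintegral_weight_mul_act hcons hSU hp hac t hgm hgt,
          lintegral_const_mul _ (hwm.sub_const 1).enorm]
    _ ≤ e / 2 + (e / 4 + e / 4) := by gcongr
    _ = e := by
        have h4 : e / 4 + e / 4 = e / 2 := by
          rw [← two_mul, ← mul_div_assoc, mul_comm, show (4 : ℝ≥0∞) = 2 * 2 by norm_num,
            ENNReal.mul_div_mul_right _ _ (by simp) (by simp)]
        rw [h4, ENNReal.add_halves]

end Path

end Model

/-! ### The policy-gradient theorem -/

namespace Model

variable {T : ℕ} {X : ℕ → Type*} {A : Type*} {Ω : Type*} [∀ j, MeasurableSpace (X j)]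
  [MeasurableSpace A] [mΩ : MeasurableSpace Ω] {M : Model T X A Ω}
  {lam : Measure A} [SigmaFinite lam] {acts : Fin T → Set A} {P : Measure Ω}
  [IsProbabilityMeasure P] {p : ℝ → Policy T X A lam acts}
  {dir q : (t : Fin T) → Hist X A t → A → ℝ} {γ R : ℝ}

lemma GradientConditions.memLp_score (hgrad : M.GradientConditions P p dir q) (t : Fin T) :
    MemLp (fun ω => dirScore (p 0) dir t (M.state t ω) (M.act t ω)) 2 P :=
  let ⟨_, h⟩ := hgrad.score_bound
  (h t).1

lemma GradientConditions.integrable_score (hgrad : M.GradientConditions P p dir q) (t : Fin T) :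
    Integrable (fun ω => dirScore (p 0) dir t (M.state t ω) (M.act t ω)) P :=
  (hgrad.memLp_score t).integrable one_le_two

lemma DifferentiablePath.lintegral_dir (hpath : M.DifferentiablePath P p dir)
    (hp : M.FollowsPolicy P (p 0)) (t : Fin T) {g : Hist X A t → A → ℝ≥0∞}
    (hg : Measurable (Function.uncurry g)) :
    ∫⁻ ω, ∫⁻ a in acts t, ‖dir t (M.state t ω) a‖ₑ * g (M.state t ω) a ∂lam ∂P =
      ∫⁻ ω, ‖dirScore (p 0) dir t (M.state t ω) (M.act t ω)‖ₑ *
        g (M.state t ω) (M.act t ω) ∂P := by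
  rw [hp.lintegral_act t (F := fun s a => ‖dirScore (p 0) dir t s a‖ₑ * g s a)
    ((measurable_dirScore (p 0) (hpath.measurable_dir t)).enorm.mul hg)]
  refine lintegral_congr_ae ?_
  filter_upwards [hpath.ae_dir_eq_zero t] with ω hω
  exact ((p 0).lintegral_enorm_div_mul t (M.state t ω) hω _).symm

lemma DifferentiablePath.integral_mul_dir (hpath : M.DifferentiablePath P p dir)
    (hp : M.FollowsPolicy P (p 0)) (t : Fin T) {g : Hist X A t → A → ℝ}
    (hg : Measurable (Function.uncurry g))
    (hgi : Integrable (fun ω => g (M.state t ω) (M.act t ω) *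
      dirScore (p 0) dir t (M.state t ω) (M.act t ω)) P) :
    ∫ ω, ∫ a in acts t, g (M.state t ω) a * dir t (M.state t ω) a ∂lam ∂P =
      ∫ ω, g (M.state t ω) (M.act t ω) *
        dirScore (p 0) dir t (M.state t ω) (M.act t ω) ∂P := by
  rw [hp.integral_act t (φ := fun s a => g s a * dirScore (p 0) dir t s a)
    (hg.mul (measurable_dirScore (p 0) (hpath.measurable_dir t))) hgi]
  refine integral_congr_ae ?_
  filter_upwards [hpath.ae_dir_eq_zero t] with ω hω
  exact ((p 0).integral_mul_div t (M.state t ω) hω _).symm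

/-- The derivative of a single term of the performance-difference identity. -/
lemma DifferentiablePath.tendsto_integral_ratio (hpath : M.DifferentiablePath P p dir)
    (hp : M.FollowsPolicy P (p 0)) (hcons : M.Consistency P)
    (hSU : M.SequentialUnconfoundedness P) (hq : M.IsActionValue P γ (p 0) q)
    (hgrad : M.GradientConditions P p dir q) (hγ : 0 ≤ γ)
    (hR : ∀ t, ∀ᵐ ω ∂P, |M.rew t ω| ≤ R) (hdom : M.DominatedPathBeforeLast P p) (t : Fin T) :
    Tendsto (fun ε => ∫ ω, (ratio (p ε) (p 0) t (M.state t ω) (M.act t ω) - 1) / ε *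
        weight (p ε) (p 0) (t + 1) (M.traj ω) * cumReward γ t (M.traj ω) ∂P) (𝓝[≠] 0)
      (𝓝 (∫ ω, ∫ a in acts t, q t (M.state t ω) a * dir t (M.state t ω) a ∂lam ∂P)) := by
  have hqm := (hq t).1
  have hqbd := (hq.ae_bound_and_lintegral hcons hSU hp hγ hR t).1
  have hΓ := ae_abs_cumReward_le hγ hR t
  have hB : 0 ≤ rewardBound T γ R := rewardBound_nonneg (M := M) (P := P) hγ hR t
  set B := rewardBound T γ R
  have hΓm : Measurable fun ω => cumReward γ t (M.traj ω) :=
    (measurable_cumReward γ t).comp M.measurable_traj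
  have hHi := hgrad.integrable_score t
  have hHm' := measurable_dirScore (p 0) (hpath.measurable_dir t)
  have hHm : Measurable fun ω => dirScore (p 0) dir t (M.state t ω) (M.act t ω) :=
    hHm'.comp (M.measurable_state_act t)
  have hqm' : Measurable fun ω => q t (M.state t ω) (M.act t ω) :=
    hqm.comp (M.measurable_state_act t)
  have hqHi : Integrable (fun ω => q t (M.state t ω) (M.act t ω) *
      dirScore (p 0) dir t (M.state t ω) (M.act t ω)) P :=
    hHi.bdd_mul hqm'.aestronglyMeasurable hqbd
  have hlim : ∫ ω, ∫ a in acts t, q t (M.state t ω) a * dir t (M.state t ω) a ∂lam ∂P =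
      ∫ ω, q t (M.state t ω) (M.act t ω) *
        dirScore (p 0) dir t (M.state t ω) (M.act t ω) ∂P :=
    hpath.integral_mul_dir hp t hqm hqHi
  rw [hlim]
  -- Before the last stage the later weight is present, so the limit is rewritten with `Γ_t` in
  -- place of `q_t`; `Γ_t` is bounded and the quotients converge in plain `L¹`. At the last stage
  -- the later weight is 1, so `Γ_t` is replaced by `q_t` before the limit is taken, and domination
  -- of the quotients against `q_t` suffices.
  by_cases htT : (t : ℕ) + 1 < T
  · have hlim2 : ∫ ω, q t (M.state t ω) (M.act t ω) *
        dirScore (p 0) dir t (M.state t ω) (M.act t ω) ∂P =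
        ∫ ω, dirScore (p 0) dir t (M.state t ω) (M.act t ω) * cumReward γ t (M.traj ω) ∂P := by
      have h1 := hq.integral_mul_sub hcons hSU hp hγ hR t hHm' hHi
      have h2 : Integrable (fun ω => dirScore (p 0) dir t (M.state t ω) (M.act t ω) *
          cumReward γ t (M.traj ω)) P := hHi.mul_bdd hΓm.aestronglyMeasurable hΓ
      have h3 : Integrable (fun ω => dirScore (p 0) dir t (M.state t ω) (M.act t ω) *
          q t (M.state t ω) (M.act t ω)) P := hHi.mul_bdd hqm'.aestronglyMeasurable hqbd
      simp only [mul_sub] at h1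
      rw [integral_sub h2 h3, sub_eq_zero] at h1
      rw [h1]
      simp only [mul_comm]
    rw [hlim2]
    have hdirfin : ∫⁻ ω, ∫⁻ a in acts t, ‖dir t (M.state t ω) a‖ₑ * 1 ∂lam ∂P ≠ ∞ := by
      rw [hpath.lintegral_dir hp t (g := fun _ _ => 1) measurable_const]
      simpa using hHi.2.ne
    have hl1 := hpath.tendsto_lintegral_score_sub hp t (g := fun _ _ => 1) measurable_const
      ENNReal.one_ne_top (ae_of_all _ fun _ => le_rfl) hdirfin (by simpa using hdom t htT)
    have hl2 := hpath.tendsto_lintegral_mul_weight_sub_one hp hcons hSU t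
      (h := fun s a => ‖dirScore (p 0) dir t s a‖ₑ) hHm'.enorm (fun _ _ => enorm_ne_top) hHi.2.ne
    simp only [mul_one] at hl1
    have hl3 := ENNReal.Tendsto.mul_const (b := ENNReal.ofReal B) (hl1.add hl2)
      (Or.inr ENNReal.ofReal_ne_top)
    rw [add_zero, zero_mul] at hl3
    refine tendsto_integral_of_L1 _ (hHi.mul_bdd hΓm.aestronglyMeasurable hΓ).1 ?_ ?_
    · filter_upwards [nhdsWithin_le_nhds hpath.eventually_supported] with ε hac
      -- The ratio minus 1 times the later weight is a difference of two integrable weights.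
      have h4 : Integrable (fun ω => weight (p ε) (p 0) t (M.traj ω) -
          weight (p ε) (p 0) (t + 1) (M.traj ω)) P :=
        (integrable_weight hcons hSU hp hac t).sub (integrable_weight hcons hSU hp hac (t + 1))
      refine ((h4.div_const ε).mul_bdd hΓm.aestronglyMeasurable hΓ).congr
        (ae_of_all _ fun ω => ?_)
      simp only [weight_of_lt _ _ t.2]
      change (ratio _ _ t (M.state t ω) (M.act t ω) * _ - _) / ε * _ = _
      ring
    · refine tendsto_of_tendsto_of_tendsto_of_le_of_le' tendsto_const_nhds hl3
        (Eventually.of_forall fun ε => zero_le) ?_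
      filter_upwards [nhdsWithin_le_nhds hpath.eventually_supported] with ε hac
      have hum : Measurable (Function.uncurry fun s a =>
          ‖(ratio (p ε) (p 0) t s a - 1) / ε - dirScore (p 0) dir t s a‖ₑ) :=
        ((((measurable_ratio (p ε) (p 0) t).sub_const 1).div_const ε).sub hHm').enorm
      have hwm : Measurable fun ω => weight (p ε) (p 0) (t + 1) (M.traj ω) :=
        (measurable_weight _ _ _).comp M.measurable_traj
      have hHwm : Measurable fun ω => ‖dirScore (p 0) dir t (M.state t ω) (M.act t ω)‖ₑ *
          ‖weight (p ε) (p 0) (t + 1) (M.traj ω) - 1‖ₑ := hHm.enorm.mul (hwm.sub_const 1).enorm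
      rw [← lintegral_weight_mul_act hcons hSU hp hac t hum (fun _ _ => enorm_ne_top),
        ← lintegral_add_right _ hHwm, ← lintegral_mul_const' _ _ ENNReal.ofReal_ne_top]
      refine lintegral_mono_ae ?_
      filter_upwards [hΓ] with ω hω
      -- Replace the quotient by the score first, then the weight by 1. In the first replacement the
      -- weight disappears from the mean.
      have h5 : (ratio (p ε) (p 0) t (M.state t ω) (M.act t ω) - 1) / ε *
          weight (p ε) (p 0) (t + 1) (M.traj ω) * cumReward γ t (M.traj ω) -
          dirScore (p 0) dir t (M.state t ω) (M.act t ω) * cumReward γ t (M.traj ω) =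
          (weight (p ε) (p 0) (t + 1) (M.traj ω) *
            ((ratio (p ε) (p 0) t (M.state t ω) (M.act t ω) - 1) / ε -
              dirScore (p 0) dir t (M.state t ω) (M.act t ω)) +
            dirScore (p 0) dir t (M.state t ω) (M.act t ω) *
              (weight (p ε) (p 0) (t + 1) (M.traj ω) - 1)) * cumReward γ t (M.traj ω) := by
        ring
      rw [h5, enorm_mul]
      refine mul_le_mul' ((enorm_add_le _ _).trans ?_) ?_
      · rw [enorm_mul, enorm_mul, Real.enorm_of_nonneg (weight_nonneg _ _ _ _)]
      · rw [← ofReal_norm]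
        exact ENNReal.ofReal_le_ofReal hω
  · have hw1 : ∀ (ε : ℝ) z, weight (p ε) (p 0) (t + 1) z = 1 := fun ε z =>
      weight_of_le _ _ (by omega) z
    simp only [hw1, mul_one]
    have hρi : ∀ ε, Integrable (fun ω =>
        (ratio (p ε) (p 0) t (M.state t ω) (M.act t ω) - 1) / ε) P := fun ε =>
      (integrable_ratio_sub_one hp t).div_const ε
    have hswap : ∀ ε, ∫ ω, (ratio (p ε) (p 0) t (M.state t ω) (M.act t ω) - 1) / ε *
        cumReward γ t (M.traj ω) ∂P =
        ∫ ω, q t (M.state t ω) (M.act t ω) *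
          ((ratio (p ε) (p 0) t (M.state t ω) (M.act t ω) - 1) / ε) ∂P := by
      intro ε
      have h1 := hq.integral_mul_sub hcons hSU hp hγ hR t
        (φ := fun s a => (ratio (p ε) (p 0) t s a - 1) / ε)
        (((measurable_ratio (p ε) (p 0) t).sub_const 1).div_const ε) (hρi ε)
      simp only [mul_sub] at h1
      rw [integral_sub ((hρi ε).mul_bdd hΓm.aestronglyMeasurable hΓ)
        ((hρi ε).mul_bdd hqm'.aestronglyMeasurable hqbd), sub_eq_zero] at h1
      rw [h1]
      simp only [mul_comm]
    simp_rw [hswap]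
    have hqe : ∀ᵐ ω ∂P, ‖q t (M.state t ω) (M.act t ω)‖ₑ ≤ ENNReal.ofReal B := by
      filter_upwards [hqbd] with ω hω
      rw [← ofReal_norm]
      exact ENNReal.ofReal_le_ofReal hω
    obtain ⟨D, hDi, hDle⟩ := hgrad.dominated t
    have hl := hpath.tendsto_lintegral_score_sub hp t (g := fun s a => ‖q t s a‖ₑ) hqm.enorm
      ENNReal.ofReal_ne_top hqe (by simpa [enorm_mul, mul_comm] using (hgrad.lintegral_q_dir t).ne)
      ⟨D, hDi, by simpa [enorm_mul, mul_comm] using hDle⟩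
    refine tendsto_integral_of_L1 _ hqHi.1 (Eventually.of_forall fun ε =>
      (hρi ε).bdd_mul hqm'.aestronglyMeasurable hqbd) (hl.congr fun ε => ?_)
    refine lintegral_congr fun ω => ?_
    rw [← mul_sub, enorm_mul, mul_comm]

/-- The policy-gradient theorem. -/
theorem DifferentiablePath.hasDerivAt_expectedWelfare (hpath : M.DifferentiablePath P p dir)
    (hp : M.FollowsPolicy P (p 0)) (hcons : M.Consistency P)
    (hSU : M.SequentialUnconfoundedness P) (hq : M.IsActionValue P γ (p 0) q)
    (hgrad : M.GradientConditions P p dir q) (hγ : 0 ≤ γ)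
    (hR : ∀ t, ∀ᵐ ω ∂P, |M.rew t ω| ≤ R) (hdom : M.DominatedPathBeforeLast P p) :
    HasDerivAt (fun ε => M.expectedWelfare P γ (p ε))
      (M.gradientFunctional P lam acts γ dir q) 0 := by
  rw [hasDerivAt_iff_tendsto_slope]
  have hlim := tendsto_finsetSum Finset.univ fun (t : Fin T) _ =>
    (hpath.tendsto_integral_ratio hp hcons hSU hq hgrad hγ hR hdom t).const_mul (γ ^ (t : ℕ))
  refine hlim.congr' ?_
  filter_upwards [nhdsWithin_le_nhds hpath.eventually_supported] with ε hac
  rw [slope_def_field, sub_zero, expectedWelfare_sub hcons hSU hp hac hγ hR, Finset.sum_div]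
  refine Finset.sum_congr rfl fun t _ => ?_
  rw [mul_div_assoc, ← integral_div]
  congr 1
  refine integral_congr_ae (ae_of_all _ fun ω => ?_)
  simp only
  ring

end Model

/-! ### Decomposition of the error of the score -/

lemma memLp_two_of_lintegral_sq {α : Type*} [MeasurableSpace α] {μ : Measure α} {f : α → ℝ}
    (hf : AEStronglyMeasurable f μ) (h : ∫⁻ x, ENNReal.ofReal (f x ^ 2) ∂μ ≠ ∞) : MemLp f 2 μ := by
  rw [memLp_two_iff_integrable_sq hf]
  refine ⟨hf.pow 2, ?_⟩
  rw [hasFiniteIntegral_iff_ofReal (ae_of_all _ fun _ => sq_nonneg _)]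
  exact h.lt_top

/-- Jensen's inequality for the square. -/
lemma ofReal_integral_sq_le {α : Type*} [MeasurableSpace α] {μ : Measure α}
    [IsProbabilityMeasure μ] {f : α → ℝ} (hf : AEStronglyMeasurable f μ) :
    ENNReal.ofReal ((∫ x, f x ∂μ) ^ 2) ≤ ∫⁻ x, ENNReal.ofReal (f x ^ 2) ∂μ := by
  by_cases h : ∫⁻ x, ENNReal.ofReal (f x ^ 2) ∂μ = ∞
  · rw [h]; exact le_top
  have hL := memLp_two_of_lintegral_sq hf h
  have hv := variance_eq_sub hL
  have hv0 := variance_nonneg f μ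
  rw [← ofReal_integral_eq_lintegral_ofReal hL.integrable_sq (ae_of_all _ fun _ => sq_nonneg _)]
  refine ENNReal.ofReal_le_ofReal ?_
  have h2 : ∫ x, (f ^ 2) x ∂μ = ∫ x, f x ^ 2 ∂μ := rfl
  linarith

section Decomposition

variable {T : ℕ} {X : ℕ → Type*} {A : Type*} [∀ j, MeasurableSpace (X j)]
  [MeasurableSpace A]

/-- The part of the error of the summand of stage `t` that is linear in the errors of the nuisance
functions. -/
def linError (lam : Measure A) (acts : Fin T → Set A) (γ : ℝ)
    (dir q H qh Hh : (t : Fin T) → Hist X A t → A → ℝ) (t : Fin T) (z : Hist X A T) : ℝ :=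
  ∫ a in acts t, (qh t (stateAt t z) a - q t (stateAt t z) a) * dir t (stateAt t z) a ∂lam
    - (qh t (stateAt t z) (actionAt t z) - q t (stateAt t z) (actionAt t z)) *
        H t (stateAt t z) (actionAt t z)
    + (Hh t (stateAt t z) (actionAt t z) - H t (stateAt t z) (actionAt t z)) *
        (cumReward γ t z - q t (stateAt t z) (actionAt t z))

/-- The product of the errors of the nuisance functions of stage `t`. -/
def prodError (q H qh Hh : (t : Fin T) → Hist X A t → A → ℝ) (t : Fin T) (z : Hist X A T) : ℝ :=
  (qh t (stateAt t z) (actionAt t z) - q t (stateAt t z) (actionAt t z)) *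
    (Hh t (stateAt t z) (actionAt t z) - H t (stateAt t z) (actionAt t z))

variable {lam : Measure A} [SigmaFinite lam] {acts : Fin T → Set A} {γ : ℝ}
  {dir q H qh Hh : (t : Fin T) → Hist X A t → A → ℝ}

lemma measurable_setIntegral_mul {t : Fin T} {f g : Hist X A t → A → ℝ}
    (hf : Measurable (Function.uncurry f)) (hg : Measurable (Function.uncurry g)) :
    Measurable fun s => ∫ a in acts t, f s a * g s a ∂lam :=
  (StronglyMeasurable.integral_prod_right (f := fun s a => f s a * g s a)
    (hf.mul hg).stronglyMeasurable).measurable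

lemma measurable_linError (hdir : ∀ t, Measurable (Function.uncurry (dir t)))
    (hq : ∀ t, Measurable (Function.uncurry (q t))) (hH : ∀ t, Measurable (Function.uncurry (H t)))
    (hqh : ∀ t, Measurable (Function.uncurry (qh t)))
    (hHh : ∀ t, Measurable (Function.uncurry (Hh t))) (t : Fin T) :
    Measurable (linError lam acts γ dir q H qh Hh t) := by
  have h1 := measurable_setIntegral_mul (lam := lam) (acts := acts)
    (f := fun s a => qh t s a - q t s a) ((hqh t).sub (hq t)) (hdir t)
  exact ((h1.comp (measurable_stateAt t)).sub (((measurable_stage (hqh t)).sub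
    (measurable_stage (hq t))).mul (measurable_stage (hH t)))).add
      (((measurable_stage (hHh t)).sub (measurable_stage (hH t))).mul
        ((measurable_cumReward γ t).sub (measurable_stage (hq t))))

lemma measurable_prodError
    (hq : ∀ t, Measurable (Function.uncurry (q t))) (hH : ∀ t, Measurable (Function.uncurry (H t)))
    (hqh : ∀ t, Measurable (Function.uncurry (qh t)))
    (hHh : ∀ t, Measurable (Function.uncurry (Hh t))) (t : Fin T) :
    Measurable (prodError q H qh Hh t) :=
  ((measurable_stage (hqh t)).sub (measurable_stage (hq t))).mul
    ((measurable_stage (hHh t)).sub (measurable_stage (hH t)))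

end Decomposition

namespace Model

variable {T : ℕ} {X : ℕ → Type*} {A : Type*} {Ω : Type*} [∀ j, MeasurableSpace (X j)]
  [MeasurableSpace A] [mΩ : MeasurableSpace Ω] {M : Model T X A Ω}
  {lam : Measure A} [SigmaFinite lam] {acts : Fin T → Set A} {P : Measure Ω}
  [IsProbabilityMeasure P] {p : ℝ → Policy T X A lam acts}
  {dir q qh Hh : (t : Fin T) → Hist X A t → A → ℝ} {γ R : ℝ}

/-- `f t` is bounded by `B` at almost every observed history. -/
def StateBound (M : Model T X A Ω) (P : Measure Ω) (lam : Measure A) (acts : Fin T → Set A)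
    (B : ℝ) (f : (t : Fin T) → Hist X A t → A → ℝ) : Prop :=
  ∀ t, ∀ᵐ ω ∂P, ∀ᵐ a ∂(lam.restrict (acts t)), |f t (M.state t ω) a| ≤ B

lemma StateBound.ae_act {B : ℝ} {p₀ : Policy T X A lam acts} (hbd : M.StateBound P lam acts B qh)
    (hp : M.FollowsPolicy P p₀) (hqh : ∀ t, Measurable (Function.uncurry (qh t))) (t : Fin T) :
    ∀ᵐ ω ∂P, |qh t (M.state t ω) (M.act t ω)| ≤ B := by
  refine (hp.ae_act_iff t (D := {x | |qh t x.1 x.2| ≤ B})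
    (measurableSet_le (hqh t).abs measurable_const)).2 ?_
  filter_upwards [hbd t] with ω hω
  rw [p₀.ae_kernel_iff]
  filter_upwards [hω] with a ha _ using ha

/-- The algebra is `Ĥ (Γ - q̂) - H (Γ - q) = (Ĥ - H)(Γ - q) - (q̂ - q) H - (q̂ - q)(Ĥ - H)`. It
holds only almost surely because merging the two integrals against the direction needs each of them
to converge. -/
lemma DifferentiablePath.ae_augScore_sub (hpath : M.DifferentiablePath P p dir)
    (hgrad : M.GradientConditions P p dir q) (hqm : ∀ t, Measurable (Function.uncurry (q t)))
    (hqh : ∀ t, Measurable (Function.uncurry (qh t))) {B : ℝ}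
    (hbd : M.StateBound P lam acts B qh) (γ : ℝ) (H Hh : (t : Fin T) → Hist X A t → A → ℝ) :
    ∀ᵐ ω ∂P, augScore lam acts γ dir qh Hh (M.traj ω) - augScore lam acts γ dir q H (M.traj ω) =
      ∑ t : Fin T, γ ^ (t : ℕ) * linError lam acts γ dir q H qh Hh t (M.traj ω) -
        ∑ t : Fin T, γ ^ (t : ℕ) * prodError q H qh Hh t (M.traj ω) := by
  have h1 : ∀ t, ∀ᵐ ω ∂P, IntegrableOn (dir t (M.state t ω)) (acts t) lam := fun t =>
    ae_of_ae_map (M.measurable_state t).aemeasurable (hpath.integrable_dir t)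
  have h2 : ∀ t, ∀ᵐ ω ∂P, ∫⁻ a in acts t, ‖q t (M.state t ω) a * dir t (M.state t ω) a‖ₑ ∂lam
      < ∞ := fun t => by
    have hm : Measurable fun s => ∫⁻ a in acts t, ‖q t s a * dir t s a‖ₑ ∂lam :=
      Measurable.lintegral_prod_right' (f := fun x : Hist X A t × A => ‖q t x.1 x.2 * dir t x.1 x.2‖ₑ)
        ((hqm t).mul (hpath.measurable_dir t)).enorm
    exact ae_lt_top (hm.comp (M.measurable_state t)) (hgrad.lintegral_q_dir t).ne
  filter_upwards [ae_all_iff.2 h1, ae_all_iff.2 h2, ae_all_iff.2 hbd] with ω h1 h2 h3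
  simp only [augScore, ← Finset.sum_sub_distrib]
  refine Finset.sum_congr rfl fun t _ => ?_
  have hdm : Measurable (dir t (M.state t ω)) := (hpath.measurable_dir t).of_uncurry_left
  have hqi : Integrable (fun a => q t (M.state t ω) a * dir t (M.state t ω) a)
      (lam.restrict (acts t)) :=
    ⟨((hqm t).of_uncurry_left.mul hdm).aestronglyMeasurable, h2 t⟩
  have hqhi : Integrable (fun a => qh t (M.state t ω) a * dir t (M.state t ω) a)
      (lam.restrict (acts t)) :=
    (h1 t).bdd_mul (hqh t).of_uncurry_left.aestronglyMeasurable (h3 t)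
  have h4 := integral_sub hqhi hqi
  simp only [← sub_mul] at h4
  simp only [linError, prodError]
  change _ = γ ^ (t : ℕ) * (∫ a in acts t,
    (qh t (M.state t ω) a - q t (M.state t ω) a) * dir t (M.state t ω) a ∂lam - _ + _) - _
  rw [h4]
  change γ ^ (t : ℕ) * ∫ a in acts t, qh t (M.state t ω) a * dir t (M.state t ω) a ∂lam + _ -
    (γ ^ (t : ℕ) * ∫ a in acts t, q t (M.state t ω) a * dir t (M.state t ω) a ∂lam + _) = _
  ring

/-- The inner integral against the direction is the conditional mean of `g H` given `S_t`, so
Jensen's inequality applies. -/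
lemma DifferentiablePath.lintegral_integral_mul_dir_sq_le (hpath : M.DifferentiablePath P p dir)
    (hp : M.FollowsPolicy P (p 0)) (t : Fin T) {g : Hist X A t → A → ℝ}
    (hg : Measurable (Function.uncurry g)) :
    ∫⁻ ω, ENNReal.ofReal ((∫ a in acts t, g (M.state t ω) a * dir t (M.state t ω) a ∂lam) ^ 2) ∂P ≤
      ∫⁻ ω, ENNReal.ofReal ((g (M.state t ω) (M.act t ω) *
        dirScore (p 0) dir t (M.state t ω) (M.act t ω)) ^ 2) ∂P := by
  have hm : Measurable (Function.uncurry fun s a => g s a * dirScore (p 0) dir t s a) :=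
    hg.mul (measurable_dirScore (p 0) (hpath.measurable_dir t))
  rw [hp.lintegral_act t (F := fun s a => ENNReal.ofReal ((g s a * dirScore (p 0) dir t s a) ^ 2))
    (hm.pow_const 2).ennreal_ofReal]
  refine lintegral_mono_ae ?_
  filter_upwards [hpath.ae_dir_eq_zero t] with ω hω
  rw [← (p 0).integral_mul_div t (M.state t ω) hω]
  exact ofReal_integral_sq_le hm.of_uncurry_left.aestronglyMeasurable

/-- The mean square of the product of a bounded error with a fixed square-integrable function is
small if the mean square of the error is. -/
lemma exists_lintegral_mul_sq_le {α : Type*} [MeasurableSpace α] {μ : Measure α} {h : α → ℝ}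
    (hm : Measurable h) (hh : MemLp h 2 μ) (B : ℝ) {e : ℝ≥0∞} (he : 0 < e) :
    ∃ η : ℝ≥0∞, 0 < η ∧ ∀ f : α → ℝ, Measurable f → (∀ᵐ x ∂μ, |f x| ≤ B) →
      ∫⁻ x, ENNReal.ofReal (f x ^ 2) ∂μ ≤ η →
        ∫⁻ x, ENNReal.ofReal ((f x * h x) ^ 2) ∂μ ≤ e := by
  have hfin : ∫⁻ x, ENNReal.ofReal (h x ^ 2) ∂μ ≠ ∞ := by
    rw [← ofReal_integral_eq_lintegral_ofReal hh.integrable_sq (ae_of_all _ fun _ => sq_nonneg _)]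
    exact ENNReal.ofReal_ne_top
  have hB : 0 < e / 2 / ENNReal.ofReal (B ^ 2 + 1) :=
    ENNReal.div_pos (ENNReal.half_pos he.ne').ne' ENNReal.ofReal_ne_top
  obtain ⟨N, hN⟩ := exists_lintegral_tail_le (μ := μ) (hm.pow_const 2).ennreal_ofReal hfin hB
  -- Where `h² ≤ N` the product is at most `(N + 1) f²`; on the tail of `h²` it is at most `(B² + 1)
  -- h²`. Each part is allotted `e / 2`, and the added ones keep the divisors nonzero.
  refine ⟨e / 2 / (N + 1), ENNReal.div_pos (ENNReal.half_pos he.ne').ne' (by finiteness),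
    fun f hf hfB hfe => ?_⟩
  have hle : ∀ᵐ x ∂μ, ENNReal.ofReal ((f x * h x) ^ 2) ≤
      ENNReal.ofReal (f x ^ 2) * (N + 1) + ENNReal.ofReal (B ^ 2 + 1) *
        {x | (N : ℝ≥0∞) < ENNReal.ofReal (h x ^ 2)}.indicator
          (fun x => ENNReal.ofReal (h x ^ 2)) x := by
    filter_upwards [hfB] with x hx
    rw [mul_pow, ENNReal.ofReal_mul (sq_nonneg _)]
    by_cases hxN : (N : ℝ≥0∞) < ENNReal.ofReal (h x ^ 2)
    · rw [Set.indicator_of_mem (by exact hxN)]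
      refine le_add_of_nonneg_of_le zero_le (mul_le_mul_left ?_ _)
      refine ENNReal.ofReal_le_ofReal ?_
      have := sq_le_sq' (by linarith [abs_le.1 hx]) (abs_le.1 hx).2
      linarith
    · refine le_add_of_le_of_nonneg (mul_le_mul_right ?_ _) zero_le
      exact (not_lt.1 hxN).trans le_self_add
  refine (lintegral_mono_ae hle).trans ?_
  rw [lintegral_add_left ((hf.pow_const 2).ennreal_ofReal.mul_const _),
    lintegral_mul_const' _ _ (by finiteness), lintegral_const_mul' _ _ ENNReal.ofReal_ne_top]
  calc _ ≤ e / 2 / (N + 1) * (N + 1) +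
      ENNReal.ofReal (B ^ 2 + 1) * (e / 2 / ENNReal.ofReal (B ^ 2 + 1)) :=
        add_le_add (mul_le_mul_left hfe _) (mul_le_mul_right hN _)
    _ ≤ e / 2 + e / 2 := add_le_add ((mul_comm _ _).trans_le ENNReal.mul_div_le) ENNReal.mul_div_le
    _ = e := ENNReal.add_halves e

end Model

/-! ### Moments of the linear and product errors -/

namespace Model

variable {T : ℕ} {X : ℕ → Type*} {A : Type*} {Ω : Type*} [∀ j, MeasurableSpace (X j)]
  [MeasurableSpace A] [mΩ : MeasurableSpace Ω] {M : Model T X A Ω}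
  {lam : Measure A} [SigmaFinite lam] {acts : Fin T → Set A} {P : Measure Ω}
  [IsProbabilityMeasure P] {p : ℝ → Policy T X A lam acts}
  {dir q qh Hh : (t : Fin T) → Hist X A t → A → ℝ} {γ R : ℝ}

lemma memLp_sub_of_mse {t : Fin T} {f g : Hist X A t → A → ℝ}
    (hf : Measurable (Function.uncurry f)) (hg : Measurable (Function.uncurry g))
    (h : M.mse P t f g ≠ ∞) :
    MemLp (fun ω => f (M.state t ω) (M.act t ω) - g (M.state t ω) (M.act t ω)) 2 P :=
  memLp_two_of_lintegral_sq ((hf.comp (M.measurable_state_act t)).sub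
    (hg.comp (M.measurable_state_act t))).aestronglyMeasurable h

/-- The linear part of the error of the summand of a single stage is square-integrable with mean
zero, and its mean square is controlled by the mean squared errors of the nuisance functions. -/
lemma linError_moments (hpath : M.DifferentiablePath P p dir)
    (hp : M.FollowsPolicy P (p 0)) (hcons : M.Consistency P)
    (hSU : M.SequentialUnconfoundedness P) (hq : M.IsActionValue P γ (p 0) q)
    (hgrad : M.GradientConditions P p dir q) (hγ : 0 ≤ γ)
    (hR : ∀ t, ∀ᵐ ω ∂P, |M.rew t ω| ≤ R)
    (hqh : ∀ t, Measurable (Function.uncurry (qh t)))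
    (hHh : ∀ t, Measurable (Function.uncurry (Hh t)))
    (hbd : M.StateBound P lam acts (rewardBound T γ R) qh) (t : Fin T)
    (hfin : M.mse P t (Hh t) (dirScore (p 0) dir t) ≠ ∞) :
    MemLp (fun ω => linError lam acts γ dir q (dirScore (p 0) dir) qh Hh t (M.traj ω)) 2 P ∧
    ∫ ω, linError lam acts γ dir q (dirScore (p 0) dir) qh Hh t (M.traj ω) ∂P = 0 ∧
    ∫⁻ ω, ENNReal.ofReal
      (linError lam acts γ dir q (dirScore (p 0) dir) qh Hh t (M.traj ω) ^ 2) ∂P ≤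
      3 * (∫⁻ ω, ENNReal.ofReal (((qh t (M.state t ω) (M.act t ω) -
        q t (M.state t ω) (M.act t ω)) * dirScore (p 0) dir t (M.state t ω) (M.act t ω)) ^ 2) ∂P +
      ∫⁻ ω, ENNReal.ofReal (((qh t (M.state t ω) (M.act t ω) -
        q t (M.state t ω) (M.act t ω)) * dirScore (p 0) dir t (M.state t ω) (M.act t ω)) ^ 2) ∂P +
      ENNReal.ofReal ((2 * rewardBound T γ R) ^ 2) *
        M.mse P t (Hh t) (dirScore (p 0) dir t)) := by
  have hqbd := (hq.ae_bound_and_lintegral hcons hSU hp hγ hR t).1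
  have hqhbd := hbd.ae_act hp hqh t
  have hΓ := ae_abs_cumReward_le hγ hR t
  set B := rewardBound T γ R
  have hHm' := measurable_dirScore (p 0) (hpath.measurable_dir t)
  set H := dirScore (p 0) dir
  have hsa := M.measurable_state_act t
  have hdm' : Measurable (Function.uncurry fun s a => qh t s a - q t s a) := (hqh t).sub (hq t).1
  have hdm : Measurable fun ω => qh t (M.state t ω) (M.act t ω) - q t (M.state t ω) (M.act t ω) :=
    hdm'.comp hsa
  have hHm : Measurable fun ω => H t (M.state t ω) (M.act t ω) := hHm'.comp hsa
  have hem' : Measurable (Function.uncurry fun s a => Hh t s a - H t s a) := (hHh t).sub hHm'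
  have hem : Measurable fun ω => Hh t (M.state t ω) (M.act t ω) - H t (M.state t ω) (M.act t ω) :=
    hem'.comp hsa
  have hrm : Measurable fun ω => cumReward γ t (M.traj ω) - q t (M.state t ω) (M.act t ω) :=
    ((measurable_cumReward γ t).comp M.measurable_traj).sub ((hq t).1.comp hsa)
  have hdbd : ∀ᵐ ω ∂P,
      ‖qh t (M.state t ω) (M.act t ω) - q t (M.state t ω) (M.act t ω)‖ ≤ 2 * B := by
    filter_upwards [hqbd, hqhbd] with ω h1 h2
    rw [Real.norm_eq_abs, abs_le]
    rw [abs_le] at h1 h2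
    constructor <;> linarith
  have hrbd : ∀ᵐ ω ∂P,
      ‖cumReward γ t (M.traj ω) - q t (M.state t ω) (M.act t ω)‖ ≤ 2 * B := by
    filter_upwards [hqbd, hΓ] with ω h1 h2
    rw [Real.norm_eq_abs, abs_le]
    rw [abs_le] at h1 h2
    constructor <;> linarith
  have heL : MemLp (fun ω => Hh t (M.state t ω) (M.act t ω) - H t (M.state t ω) (M.act t ω)) 2 P :=
    memLp_sub_of_mse (hHh t) hHm' hfin
  have h2L : MemLp (fun ω => (qh t (M.state t ω) (M.act t ω) - q t (M.state t ω) (M.act t ω)) *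
      H t (M.state t ω) (M.act t ω)) 2 P :=
    by
    refine (hgrad.memLp_score t).of_le_mul (c := 2 * B) (hdm.mul hHm).aestronglyMeasurable ?_
    filter_upwards [hdbd] with ω hω
    rw [norm_mul]
    exact mul_le_mul_of_nonneg_right hω (norm_nonneg _)
  have h3L : MemLp (fun ω => (Hh t (M.state t ω) (M.act t ω) - H t (M.state t ω) (M.act t ω)) *
      (cumReward γ t (M.traj ω) - q t (M.state t ω) (M.act t ω))) 2 P := by
    refine heL.of_le_mul (c := 2 * B) (hem.mul hrm).aestronglyMeasurable ?_
    filter_upwards [hrbd] with ω hω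
    rw [norm_mul, mul_comm]
    exact mul_le_mul_of_nonneg_right hω (norm_nonneg _)
  have hIm : Measurable fun ω => ∫ a in acts t, (qh t (M.state t ω) a - q t (M.state t ω) a) *
      dir t (M.state t ω) a ∂lam :=
    (measurable_setIntegral_mul hdm' (hpath.measurable_dir t)).comp (M.measurable_state t)
  have hIle := hpath.lintegral_integral_mul_dir_sq_le hp t hdm'
  have h2fin : ∫⁻ ω, ENNReal.ofReal (((qh t (M.state t ω) (M.act t ω) -
      q t (M.state t ω) (M.act t ω)) * H t (M.state t ω) (M.act t ω)) ^ 2) ∂P ≠ ∞ := by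
    rw [← ofReal_integral_eq_lintegral_ofReal h2L.integrable_sq (ae_of_all _ fun _ => sq_nonneg _)]
    exact ENNReal.ofReal_ne_top
  have hIL := memLp_two_of_lintegral_sq hIm.aestronglyMeasurable (hIle.trans_lt h2fin.lt_top).ne
  have hform : ∀ ω, linError lam acts γ dir q H qh Hh t (M.traj ω) =
      ∫ a in acts t, (qh t (M.state t ω) a - q t (M.state t ω) a) * dir t (M.state t ω) a ∂lam
      - (qh t (M.state t ω) (M.act t ω) - q t (M.state t ω) (M.act t ω)) *
        H t (M.state t ω) (M.act t ω)
      + (Hh t (M.state t ω) (M.act t ω) - H t (M.state t ω) (M.act t ω)) *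
        (cumReward γ t (M.traj ω) - q t (M.state t ω) (M.act t ω)) := fun ω => rfl
  simp_rw [hform]
  have hi := hIL.integrable one_le_two
  have h2i := h2L.integrable one_le_two
  have h3i := h3L.integrable one_le_two
  refine ⟨(hIL.sub h2L).add h3L, ?_, ?_⟩
  -- The integral against the direction and `(q̂ - q) H` have the same mean and cancel; the term in
  -- `Ĥ - H` is orthogonal to the residual.
  · have hz1 := hpath.integral_mul_dir hp t hdm' h2i
    have hz2 := hq.integral_mul_sub hcons hSU hp hγ hR t hem' (heL.integrable one_le_two)
    have hs1 := integral_add (hi.sub h2i) h3i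
    have hs2 := integral_sub hi h2i
    simp only [Pi.sub_apply] at hs1
    rw [hs1, hs2, hz1, hz2]
    simp only [H]
    ring
  · have hle3 : ∫⁻ ω, ENNReal.ofReal (((Hh t (M.state t ω) (M.act t ω) -
        H t (M.state t ω) (M.act t ω)) *
        (cumReward γ t (M.traj ω) - q t (M.state t ω) (M.act t ω))) ^ 2) ∂P ≤
        ENNReal.ofReal ((2 * B) ^ 2) * M.mse P t (Hh t) (H t) := by
      rw [mse, ← lintegral_const_mul' _ _ ENNReal.ofReal_ne_top]
      refine lintegral_mono_ae ?_
      filter_upwards [hrbd] with ω hω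
      rw [mul_pow, mul_comm, ENNReal.ofReal_mul (sq_nonneg _)]
      refine mul_le_mul_left (ENNReal.ofReal_le_ofReal ?_) _
      exact sq_le_sq' (by linarith [abs_le.1 hω]) (abs_le.1 hω).2
    -- The same mean square appears twice because Jensen bounds the integral term by the mean square
    -- of `(q̂ - q) H`.
    refine le_trans ?_ (mul_le_mul_right (add_le_add (add_le_add_left hIle _) hle3) 3)
    have hw : Measurable fun ω => ENNReal.ofReal (((Hh t (M.state t ω) (M.act t ω) -
        H t (M.state t ω) (M.act t ω)) *
        (cumReward γ t (M.traj ω) - q t (M.state t ω) (M.act t ω))) ^ 2) :=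
      ((hem.mul hrm).pow_const 2).ennreal_ofReal
    rw [← lintegral_add_left (hIm.pow_const 2).ennreal_ofReal,
      ← lintegral_add_right _ hw,
      ← lintegral_const_mul' _ _ (by finiteness)]
    refine lintegral_mono fun ω => ?_
    rw [← ENNReal.ofReal_add (sq_nonneg _) (sq_nonneg _),
      ← ENNReal.ofReal_add (by positivity) (sq_nonneg _),
      ← ENNReal.ofReal_ofNat, ← ENNReal.ofReal_mul (by norm_num)]
    refine ENNReal.ofReal_le_ofReal ?_
    generalize (∫ a in acts t, (qh t (M.state t ω) a - q t (M.state t ω) a) *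
      dir t (M.state t ω) a ∂lam) = x
    generalize (qh t (M.state t ω) (M.act t ω) - q t (M.state t ω) (M.act t ω)) *
        H t (M.state t ω) (M.act t ω) = y
    generalize (Hh t (M.state t ω) (M.act t ω) - H t (M.state t ω) (M.act t ω)) *
        (cumReward γ t (M.traj ω) - q t (M.state t ω) (M.act t ω)) = w
    -- `3 (x² + y² + w²) - (x - y + w)² = (x + y)² + (x - w)² + (y + w)²`.
    nlinarith [sq_nonneg (x + y), sq_nonneg (x - w), sq_nonneg (y + w)]

end Model

namespace Model

variable {T : ℕ} {X : ℕ → Type*} {A : Type*} {Ω : Type*} [∀ j, MeasurableSpace (X j)]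
  [MeasurableSpace A] [mΩ : MeasurableSpace Ω] {M : Model T X A Ω}
  {lam : Measure A} [SigmaFinite lam] {acts : Fin T → Set A} {P : Measure Ω}
  [IsProbabilityMeasure P] {p : ℝ → Policy T X A lam acts}
  {dir q qh Hh : (t : Fin T) → Hist X A t → A → ℝ} {γ R : ℝ}

lemma sq_sum_pow_mul_le (hγ : 0 ≤ γ) (hγ' : γ ≤ 1) (x : Fin T → ℝ) :
    (∑ t : Fin T, γ ^ (t : ℕ) * x t) ^ 2 ≤ T * ∑ t, x t ^ 2 := by
  have h := sq_sum_le_card_mul_sum_sq (s := Finset.univ) (f := fun t : Fin T => γ ^ (t : ℕ) * x t)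
  rw [Finset.card_univ, Fintype.card_fin] at h
  refine h.trans (mul_le_mul_of_nonneg_left (Finset.sum_le_sum fun t _ => ?_) (Nat.cast_nonneg T))
  rw [mul_pow]
  exact mul_le_of_le_one_left (sq_nonneg _) (pow_le_one₀ (by positivity) (pow_le_one₀ hγ hγ'))

/-- The linear part of the error is centred, with small mean square if the mean squared errors of
the nuisance functions are small. -/
lemma exists_linError_bound (hpath : M.DifferentiablePath P p dir)
    (hp : M.FollowsPolicy P (p 0)) (hcons : M.Consistency P)
    (hSU : M.SequentialUnconfoundedness P) (hq : M.IsActionValue P γ (p 0) q)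
    (hgrad : M.GradientConditions P p dir q) (hγ : 0 ≤ γ) (hγ' : γ ≤ 1)
    (hR : ∀ t, ∀ᵐ ω ∂P, |M.rew t ω| ≤ R) {e : ℝ≥0∞} (he : 0 < e) :
    ∃ η : ℝ≥0∞, 0 < η ∧ ∀ qh Hh : (t : Fin T) → Hist X A t → A → ℝ,
      (∀ t, Measurable (Function.uncurry (qh t))) → (∀ t, Measurable (Function.uncurry (Hh t))) →
      M.StateBound P lam acts (rewardBound T γ R) qh →
      (∀ t, M.mse P t (qh t) (q t) ≤ η) → (∀ t, M.mse P t (Hh t) (dirScore (p 0) dir t) ≤ η) →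
      MemLp (fun ω => ∑ t : Fin T, γ ^ (t : ℕ) *
        linError lam acts γ dir q (dirScore (p 0) dir) qh Hh t (M.traj ω)) 2 P ∧
      ∫ ω, ∑ t : Fin T, γ ^ (t : ℕ) *
        linError lam acts γ dir q (dirScore (p 0) dir) qh Hh t (M.traj ω) ∂P = 0 ∧
      ∫⁻ ω, ENNReal.ofReal ((∑ t : Fin T, γ ^ (t : ℕ) *
        linError lam acts γ dir q (dirScore (p 0) dir) qh Hh t (M.traj ω)) ^ 2) ∂P ≤ e := by
  have hHm := fun t => measurable_dirScore (p 0) (hpath.measurable_dir t)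
  set B := rewardBound T γ R
  -- Budget per stage: one factor `T` comes from Cauchy–Schwarz and one from the number of stages. A
  -- stage has three terms with a factor 3, hence `x / 9` for each.
  set x : ℝ≥0∞ := e / ((T : ℝ≥0∞) * T + 1) with hx
  have hx0 : 0 < x := ENNReal.div_pos he.ne' (by finiteness)
  have hx9 : 0 < x / 9 := ENNReal.div_pos hx0.ne' (by finiteness)
  set c : ℝ≥0∞ := ENNReal.ofReal ((2 * B) ^ 2) + 1 with hc
  have hctop : c ≠ ∞ := by finiteness
  choose η hη0 hη using fun t => exists_lintegral_mul_sq_le (μ := P)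
    ((hHm t).comp (M.measurable_state_act t)) (hgrad.memLp_score t) (2 * B) hx9
  -- The infimum controls `(q̂ - q) H` at every stage, `x / 9 / c` controls the residual term, whose
  -- factor `Γ - q` is at most `2 B` in absolute value, and 1 keeps the error of `Ĥ` finite.
  refine ⟨min (Finset.univ.inf η) (min (x / 9 / c) 1), ?_, fun qh Hh hqh hHh hbd hmq hmH => ?_⟩
  · refine lt_min ((Finset.lt_inf_iff ENNReal.zero_lt_top).2 fun t _ => hη0 t)
      (lt_min (ENNReal.div_pos hx9.ne' hctop) one_pos)
  have hmom := fun t => linError_moments hpath hp hcons hSU hq hgrad hγ hR hqh hHh hbd t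
    (ne_top_of_le_ne_top ENNReal.one_ne_top
      ((hmH t).trans ((min_le_right _ _).trans (min_le_right _ _))))
  have hWm : ∀ t, Measurable fun ω =>
      linError lam acts γ dir q (dirScore (p 0) dir) qh Hh t (M.traj ω) := fun t =>
    (measurable_linError hpath.measurable_dir (fun t => (hq t).1) hHm hqh hHh t).comp
      M.measurable_traj
  refine ⟨memLp_finsetSum _ fun t _ => (hmom t).1.const_mul _, ?_, ?_⟩
  · rw [integral_finsetSum _ fun t _ => ((hmom t).1.integrable one_le_two).const_mul _]
    refine Finset.sum_eq_zero fun t _ => ?_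
    rw [integral_const_mul, (hmom t).2.1, mul_zero]
  · have hstage : ∀ t, ∫⁻ ω, ENNReal.ofReal
        (linError lam acts γ dir q (dirScore (p 0) dir) qh Hh t (M.traj ω) ^ 2) ∂P ≤ x := by
      intro t
      have hdm : Measurable fun ω =>
          qh t (M.state t ω) (M.act t ω) - q t (M.state t ω) (M.act t ω) :=
        ((hqh t).sub (hq t).1).comp (M.measurable_state_act t)
      have hdbd : ∀ᵐ ω ∂P,
          |qh t (M.state t ω) (M.act t ω) - q t (M.state t ω) (M.act t ω)| ≤ 2 * B := by
        filter_upwards [(hq.ae_bound_and_lintegral hcons hSU hp hγ hR t).1, hbd.ae_act hp hqh t]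
          with ω h1 h2
        rw [abs_le] at h1 h2 ⊢
        constructor <;> linarith
      have h1 := hη t _ hdm hdbd ((hmq t).trans ((min_le_left _ _).trans
        (Finset.inf_le (Finset.mem_univ t))))
      have h2 : ENNReal.ofReal ((2 * B) ^ 2) * M.mse P t (Hh t) (dirScore (p 0) dir t) ≤ x / 9 := by
        refine (mul_le_mul' (b := c) le_self_add ((hmH t).trans ((min_le_right _ _).trans
          (min_le_left _ _)))).trans ENNReal.mul_div_le
      refine (hmom t).2.2.trans ((mul_le_mul_right (add_le_add (add_le_add h1 h1) h2) 3).trans ?_)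
      rw [← two_mul, ← add_one_mul, ← mul_assoc]
      norm_num
      exact ENNReal.mul_div_le
    calc _ ≤ ∫⁻ ω, T * ∑ t, ENNReal.ofReal
          (linError lam acts γ dir q (dirScore (p 0) dir) qh Hh t (M.traj ω) ^ 2) ∂P := by
          refine lintegral_mono fun ω => ?_
          rw [← ENNReal.ofReal_natCast, ← ENNReal.ofReal_sum_of_nonneg fun t _ => sq_nonneg _,
            ← ENNReal.ofReal_mul (Nat.cast_nonneg _)]
          exact ENNReal.ofReal_le_ofReal (sq_sum_pow_mul_le hγ hγ' _)
      _ = T * ∑ t, ∫⁻ ω, ENNReal.ofReal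
          (linError lam acts γ dir q (dirScore (p 0) dir) qh Hh t (M.traj ω) ^ 2) ∂P := by
          rw [lintegral_const_mul' _ _ (by finiteness),
            lintegral_finsetSum _ fun t _ => ((hWm t).pow_const 2).ennreal_ofReal]
      _ ≤ T * ∑ _t : Fin T, x := mul_le_mul_right (Finset.sum_le_sum fun t _ => hstage t) _
      _ = (T * T : ℝ≥0∞) * x := by
          rw [Finset.sum_const, Finset.card_univ, Fintype.card_fin, nsmul_eq_mul, mul_assoc]
      _ ≤ (T * T + 1 : ℝ≥0∞) * x := mul_le_mul_left le_self_add _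
      _ ≤ e := ENNReal.mul_div_le

/-- Weighted arithmetic–geometric mean inequality. The free weight `c` lets unequal rates be
balanced, so that only the sum of the two exponents matters. -/
lemma lintegral_prodError_le {H : (t : Fin T) → Hist X A t → A → ℝ}
    (hqm : ∀ t, Measurable (Function.uncurry (q t)))
    (hHm : ∀ t, Measurable (Function.uncurry (H t)))
    (hqh : ∀ t, Measurable (Function.uncurry (qh t)))
    (hHh : ∀ t, Measurable (Function.uncurry (Hh t)))
    (hγ : 0 ≤ γ) (hγ' : γ ≤ 1) {c : ℝ} (hc : 0 < c) :
    ∫⁻ ω, ENNReal.ofReal |∑ t : Fin T, γ ^ (t : ℕ) * prodError q H qh Hh t (M.traj ω)| ∂P ≤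
      ∑ t, (ENNReal.ofReal c * M.mse P t (qh t) (q t) +
        ENNReal.ofReal c⁻¹ * M.mse P t (Hh t) (H t)) := by
  have hsa := M.measurable_state_act
  have h1 : ∀ t, Measurable fun ω => ENNReal.ofReal ((qh t (M.state t ω) (M.act t ω) -
      q t (M.state t ω) (M.act t ω)) ^ 2) := fun t =>
    ((((hqh t).sub (hqm t)).comp (hsa t)).pow_const 2).ennreal_ofReal
  have h2 : ∀ t, Measurable fun ω => ENNReal.ofReal ((Hh t (M.state t ω) (M.act t ω) -
      H t (M.state t ω) (M.act t ω)) ^ 2) := fun t =>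
    ((((hHh t).sub (hHm t)).comp (hsa t)).pow_const 2).ennreal_ofReal
  simp only [mse]
  simp_rw [← fun t => lintegral_const_mul (μ := P) (ENNReal.ofReal c) (h1 t),
    ← fun t => lintegral_const_mul (μ := P) (ENNReal.ofReal c⁻¹) (h2 t),
    ← fun t => lintegral_add_left (μ := P) ((h1 t).const_mul (ENNReal.ofReal c))]
  have h3 : ∀ t, Measurable fun ω => ENNReal.ofReal c * ENNReal.ofReal ((qh t (M.state t ω)
      (M.act t ω) - q t (M.state t ω) (M.act t ω)) ^ 2) + ENNReal.ofReal c⁻¹ *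
      ENNReal.ofReal ((Hh t (M.state t ω) (M.act t ω) - H t (M.state t ω) (M.act t ω)) ^ 2) :=
    fun t => ((h1 t).const_mul _).add ((h2 t).const_mul _)
  rw [← lintegral_finsetSum _ fun t _ => h3 t]
  refine lintegral_mono fun ω => ?_
  have hci : 0 < c⁻¹ := inv_pos.2 hc
  simp_rw [← ENNReal.ofReal_mul hc.le, ← ENNReal.ofReal_mul hci.le]
  simp_rw [← fun t => ENNReal.ofReal_add (mul_nonneg hc.le (sq_nonneg
    (qh t (M.state t ω) (M.act t ω) - q t (M.state t ω) (M.act t ω))))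
    (mul_nonneg hci.le (sq_nonneg
      (Hh t (M.state t ω) (M.act t ω) - H t (M.state t ω) (M.act t ω))))]
  rw [← ENNReal.ofReal_sum_of_nonneg fun t _ => by positivity]
  refine ENNReal.ofReal_le_ofReal ((Finset.abs_sum_le_sum_abs _ _).trans
    (Finset.sum_le_sum fun t _ => ?_))
  rw [abs_mul, abs_of_nonneg (pow_nonneg hγ _)]
  refine (mul_le_of_le_one_left (abs_nonneg _) (pow_le_one₀ hγ hγ')).trans ?_
  change |(qh t (M.state t ω) (M.act t ω) - q t (M.state t ω) (M.act t ω)) *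
    (Hh t (M.state t ω) (M.act t ω) - H t (M.state t ω) (M.act t ω))| ≤ _
  generalize qh t (M.state t ω) (M.act t ω) - q t (M.state t ω) (M.act t ω) = x
  generalize Hh t (M.state t ω) (M.act t ω) - H t (M.state t ω) (M.act t ω) = y
  have hcc : c * c⁻¹ = 1 := mul_inv_cancel₀ hc.ne'
  have key : c * x ^ 2 + c⁻¹ * y ^ 2 - 2 * (x * y) = c * (x - c⁻¹ * y) ^ 2 := by
    linear_combination (2 * x * y - c⁻¹ * y ^ 2) * hcc
  have key' : c * x ^ 2 + c⁻¹ * y ^ 2 + 2 * (x * y) = c * (x + c⁻¹ * y) ^ 2 := by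
    linear_combination (-2 * x * y - c⁻¹ * y ^ 2) * hcc
  have k1 : 0 ≤ c * (x - c⁻¹ * y) ^ 2 := by positivity
  have k2 : 0 ≤ c * (x + c⁻¹ * y) ^ 2 := by positivity
  have k3 : 0 ≤ c * x ^ 2 + c⁻¹ * y ^ 2 := by positivity
  rw [abs_le]
  constructor <;> linarith

end Model

/-! ### Deviation bounds and sample splitting -/

section Concentration

variable {α β : Type*} [MeasurableSpace α] [MeasurableSpace β]

/-- A deviation inequality for a sum of independent copies of the difference of a centred
square-integrable variable and an integrable one. -/
lemma measure_pi_sum_ge_le {ν : Measure α} [IsProbabilityMeasure ν] {ι : Type*} [Fintype ι]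
    {L C D : α → ℝ} (hL : MemLp L 2 ν) (hL0 : ∫ x, L x ∂ν = 0) (hC : Measurable C)
    (hD : ∀ᵐ x ∂ν, D x = L x - C x) {n : ℕ} (hn : 0 < n) (hcard : Fintype.card ι ≤ n)
    {δ a b : ℝ} (hδ : 0 < δ) (ha : 0 ≤ a) (hb : 0 ≤ b)
    (hLa : ∫⁻ x, ENNReal.ofReal (L x ^ 2) ∂ν ≤ ENNReal.ofReal a)
    (hCb : ∫⁻ x, ENNReal.ofReal |C x| ∂ν ≤ ENNReal.ofReal (b / √n)) :
    Measure.pi (fun _ : ι => ν) {v | δ * √n ≤ |∑ i, D (v i)|} ≤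
      ENNReal.ofReal (4 * a / δ ^ 2) + ENNReal.ofReal (2 * b / δ) := by
  have hn' : (0 : ℝ) < n := Nat.cast_pos.2 hn
  have hs : 0 < √(n : ℝ) := Real.sqrt_pos.2 hn'
  have hcard' : (Fintype.card ι : ℝ) ≤ n := by exact_mod_cast hcard
  have hev : ∀ i : ι, MeasurePreserving (Function.eval i) (Measure.pi fun _ : ι => ν) ν := fun i =>
    measurePreserving_eval (fun _ : ι => ν) i
  have hDae : ∀ᵐ v ∂(Measure.pi fun _ : ι => ν), ∀ i, D (v i) = L (v i) - C (v i) :=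
    ae_all_iff.2 fun i => (hev i).quasiMeasurePreserving.ae hD
  have hLi : ∀ i : ι, MemLp (fun v : ι → α => L (v i)) 2 (Measure.pi fun _ : ι => ν) := fun i =>
    hL.comp_measurePreserving (hev i)
  have hsplit : Measure.pi (fun _ : ι => ν) {v | δ * √n ≤ |∑ i, D (v i)|} ≤
      Measure.pi (fun _ : ι => ν) ({v | δ / 2 * √n ≤ |∑ i, L (v i)|} ∪
        {v | δ / 2 * √n ≤ |∑ i, C (v i)|}) := by
    refine measure_mono_ae ?_
    filter_upwards [hDae] with v hv hv'
    change δ * √n ≤ |∑ i, D (v i)| at hv'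
    simp_rw [hv, Finset.sum_sub_distrib] at hv'
    by_contra hcon
    rcases not_or.1 hcon with ⟨h1, h2⟩
    have h1 : |∑ i, L (v i)| < δ / 2 * √n := not_le.1 h1
    have h2 : |∑ i, C (v i)| < δ / 2 * √n := not_le.1 h2
    have := abs_sub (∑ i, L (v i)) (∑ i, C (v i))
    linarith
  refine hsplit.trans ((measure_union_le _ _).trans (add_le_add ?_ ?_))
  -- Chebyshev for the centred part: the variance of the sum is at most `n a`, against the squared
  -- threshold `δ² n / 4`.
  · have hint : ∫ v, ∑ i, L (v i) ∂(Measure.pi fun _ : ι => ν) = 0 := by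
      rw [integral_finsetSum _ fun i _ => (hLi i).integrable one_le_two]
      refine Finset.sum_eq_zero fun i _ => ?_
      have h := integral_map (f := L) (hev i).measurable.aemeasurable
        (by rw [(hev i).map_eq]; exact hL.1)
      rw [(hev i).map_eq, hL0] at h
      exact h.symm
    have hch := meas_ge_le_variance_div_sq (μ := Measure.pi fun _ : ι => ν)
      (memLp_finsetSum Finset.univ fun i _ => hLi i) (c := δ / 2 * √n) (by positivity)
    rw [hint] at hch
    simp only [sub_zero] at hch
    refine hch.trans (ENNReal.ofReal_le_ofReal ?_)
    have hvar := variance_sum_pi (μ := fun _ : ι => ν) (X := fun _ => L) fun _ => hL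
    have hfun : (∑ i, fun v : ι → α => L (v i)) = fun v => ∑ i, L (v i) := by
      ext v
      simp
    rw [hfun, Finset.sum_const, Finset.card_univ, nsmul_eq_mul] at hvar
    rw [hvar]
    have hVar : Var[L; ν] ≤ a := by
      have h1 := variance_le_expectation_sq (X := L) hL.1
      refine h1.trans ((ENNReal.ofReal_le_ofReal_iff ha).1 ?_)
      exact (ofReal_integral_eq_lintegral_ofReal hL.integrable_sq
        (ae_of_all _ fun _ => sq_nonneg _)).trans_le hLa
    rw [div_le_div_iff₀ (by positivity) (by positivity), mul_pow, Real.sq_sqrt hn'.le]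
    have h1 : (Fintype.card ι : ℝ) * Var[L; ν] ≤ n * a :=
      mul_le_mul hcard' hVar (variance_nonneg _ _) hn'.le
    nlinarith [mul_le_mul_of_nonneg_right h1 (sq_nonneg δ)]
  -- Markov for the uncentred part: its mean absolute sum is at most `n b / √n = b √n`, against the
  -- threshold `δ √n / 2`.
  · have hCm : Measurable fun v : ι → α => ENNReal.ofReal |∑ i, C (v i)| :=
      (Finset.measurable_fun_sum _ fun i _ => hC.comp (measurable_pi_apply i)).abs.ennreal_ofReal
    have hpos : 0 < δ / 2 * √n := by positivity
    have hM := meas_ge_le_lintegral_div (μ := Measure.pi fun _ : ι => ν) hCm.aemeasurable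
      (ε := ENNReal.ofReal (δ / 2 * √n)) (by simpa using hpos) ENNReal.ofReal_ne_top
    have hset : {v : ι → α | δ / 2 * √n ≤ |∑ i, C (v i)|} =
        {v | ENNReal.ofReal (δ / 2 * √n) ≤ ENNReal.ofReal |∑ i, C (v i)|} := by
      ext v
      simp only [Set.mem_ofPred_eq, ENNReal.ofReal_le_ofReal_iff (abs_nonneg _)]
    rw [hset]
    refine hM.trans ?_
    have hle : ∫⁻ v, ENNReal.ofReal |∑ i, C (v i)| ∂(Measure.pi fun _ : ι => ν) ≤
        ENNReal.ofReal (b * √n) := by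
      calc _ ≤ ∫⁻ v, ∑ i, ENNReal.ofReal |C (v i)| ∂(Measure.pi fun _ : ι => ν) := by
            refine lintegral_mono fun v => ?_
            rw [← ENNReal.ofReal_sum_of_nonneg fun _ _ => abs_nonneg _]
            exact ENNReal.ofReal_le_ofReal (Finset.abs_sum_le_sum_abs _ _)
        _ = ∑ i : ι, ∫⁻ x, ENNReal.ofReal |C x| ∂ν := by
            have hCi : ∀ i : ι, Measurable fun v : ι → α => ENNReal.ofReal |C (v i)| := fun i =>
              (hC.comp (measurable_pi_apply i)).abs.ennreal_ofReal
            rw [lintegral_finsetSum _ fun i _ => hCi i]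
            exact Finset.sum_congr rfl fun i _ =>
              (hev i).lintegral_comp (f := fun x => ENNReal.ofReal |C x|) hC.abs.ennreal_ofReal
        _ ≤ ∑ _i : ι, ENNReal.ofReal (b / √n) := Finset.sum_le_sum fun _ _ => hCb
        _ = ENNReal.ofReal (Fintype.card ι * (b / √n)) := by
            rw [Finset.sum_const, Finset.card_univ, nsmul_eq_mul,
              ENNReal.ofReal_mul (Nat.cast_nonneg _), ENNReal.ofReal_natCast]
        _ ≤ ENNReal.ofReal (b * √n) := by
            refine ENNReal.ofReal_le_ofReal ?_
            rw [mul_div_assoc', div_le_iff₀ hs, mul_assoc, Real.mul_self_sqrt hn'.le, mul_comm b]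
            exact mul_le_mul_of_nonneg_right hcard' hb
    refine (ENNReal.div_le_div_right hle _).trans ?_
    rw [← ENNReal.ofReal_div_of_pos hpos]
    refine ENNReal.ofReal_le_ofReal (le_of_eq ?_)
    field_simp

/-- Conditioning on the first factor, here the training sample: a good one leaves probability at
most `e`, a bad one at most 1. The measurable hull of `bad` makes its measurability unnecessary. -/
lemma measure_prod_le_add {μ : Measure α} {ν : Measure β} [IsProbabilityMeasure ν]
    [IsProbabilityMeasure μ]
    {S : Set (α × β)} (hS : MeasurableSet S) {bad : Set α} {e : ℝ≥0∞}
    (h : ∀ᵐ x ∂μ, x ∉ bad → ν (Prod.mk x ⁻¹' S) ≤ e) : (μ.prod ν) S ≤ e + μ bad := by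
  rw [Measure.prod_apply hS]
  have hle : ∀ᵐ x ∂μ, ν (Prod.mk x ⁻¹' S) ≤ e + (toMeasurable μ bad).indicator 1 x := by
    filter_upwards [h] with x hx
    by_cases hb : x ∈ toMeasurable μ bad
    · rw [Set.indicator_of_mem hb]
      exact prob_le_one.trans le_add_self
    · exact (hx fun hxb => hb (subset_toMeasurable _ _ hxb)).trans le_self_add
  refine (lintegral_mono_ae hle).trans ?_
  rw [lintegral_add_left measurable_const, lintegral_indicator_one (measurableSet_toMeasurable _ _),
    measure_toMeasurable, lintegral_const, measure_univ, mul_one]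

/-- The law of an independent identically distributed sample, split into two parts. -/
lemma map_split_sample {Ω' : Type*} [MeasurableSpace Ω'] {Q : Measure Ω'} [IsProbabilityMeasure Q]
    {Z : ℕ → Ω' → α} (hZm : ∀ i, Measurable (Z i)) (hZi : iIndepFun Z Q) {ν : Measure α}
    [IsProbabilityMeasure ν] (hZl : ∀ i, Q.map (Z i) = ν) {n : ℕ} (r : Fin n → Prop)
    [DecidablePred r] :
    Q.map (fun w => ((fun i : {i // r i} => Z (i : Fin n) w),
      fun i : {i // ¬ r i} => Z (i : Fin n) w)) =
      (Measure.pi fun _ => ν).prod (Measure.pi fun _ => ν) := by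
  have h1 := iIndepFun.map_fun_eq_pi_map (f := fun i : Fin n => Z i)
    (fun i => (hZm i).aemeasurable) (hZi.precomp Fin.val_injective)
  simp only [hZl] at h1
  have h2 := measurePreserving_piEquivPiSubtypeProd (fun _ : Fin n => ν) r
  rw [← h1] at h2
  have h3 := h2.map_eq
  rw [Measure.map_map h2.measurable (measurable_pi_lambda _ fun i => hZm i)] at h3
  exact h3

end Concentration

/-! ### Joint measurability in training sample and trajectory -/

section Measurability

variable {T : ℕ} {X : ℕ → Type*} {A : Type*} [∀ j, MeasurableSpace (X j)]
  [MeasurableSpace A] {lam : Measure A} [SigmaFinite lam] {acts : Fin T → Set A}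
  {β : Type*} [MeasurableSpace β] {γ : ℝ}

/-- The parameter plays the role of the training sample; joint measurability is what makes the error
event measurable for the product law. -/
lemma measurable_augScore_param {F G : β → (t : Fin T) → Hist X A t → A → ℝ}
    {dir : (t : Fin T) → Hist X A t → A → ℝ}
    (hdir : ∀ t, Measurable (Function.uncurry (dir t)))
    (hF : ∀ t : Fin T, Measurable fun x : β × Hist X A t × A => F x.1 t x.2.1 x.2.2)
    (hG : ∀ t : Fin T, Measurable fun x : β × Hist X A t × A => G x.1 t x.2.1 x.2.2) :
    Measurable fun x : β × Hist X A T => augScore lam acts γ dir (F x.1) (G x.1) x.2 := by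
  refine Finset.measurable_fun_sum _ fun t _ => ?_
  have hst : Measurable fun x : β × Hist X A T => stateAt t x.2 :=
    (measurable_stateAt t).comp measurable_snd
  have hpt : Measurable fun x : β × Hist X A T => (x.1, stateAt t x.2, actionAt t x.2) :=
    measurable_fst.prodMk (hst.prodMk ((measurable_actionAt t).comp measurable_snd))
  have hI : Measurable fun x : β × Hist X A T =>
      ∫ a in acts t, F x.1 t (stateAt t x.2) a * dir t (stateAt t x.2) a ∂lam := by
    refine (StronglyMeasurable.integral_prod_right (ν := lam.restrict (acts t))
      (f := fun (x : β × Hist X A T) a => F x.1 t (stateAt t x.2) a * dir t (stateAt t x.2) a) ?_).measurable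
    refine Measurable.stronglyMeasurable (Measurable.mul ?_ ?_)
    · exact (hF t).comp ((measurable_fst.comp measurable_fst).prodMk
        ((hst.comp measurable_fst).prodMk measurable_snd))
    · exact (hdir t).comp ((hst.comp measurable_fst).prodMk measurable_snd)
  exact (hI.const_mul _).add ((((hG t).comp hpt).const_mul _).mul
    (((measurable_cumReward γ t).comp measurable_snd).sub ((hF t).comp hpt)))

lemma measurable_augScore {F G dir : (t : Fin T) → Hist X A t → A → ℝ}
    (hdir : ∀ t, Measurable (Function.uncurry (dir t)))
    (hF : ∀ t, Measurable (Function.uncurry (F t)))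
    (hG : ∀ t, Measurable (Function.uncurry (G t))) :
    Measurable (augScore lam acts γ dir F G) :=
  (measurable_augScore_param (β := Unit) (F := fun _ => F) (G := fun _ => G) hdir
    (fun t => (hF t).comp measurable_snd) fun t => (hG t).comp measurable_snd).comp
      ((measurable_const (a := ())).prodMk measurable_id)

lemma Model.measurable_mse {Ω : Type*} [MeasurableSpace Ω] (M : Model T X A Ω) (P : Measure Ω)
    [SFinite P] {t : Fin T} {f : β → Hist X A t → A → ℝ} {g : Hist X A t → A → ℝ}
    (hf : Measurable fun x : β × Hist X A t × A => f x.1 x.2.1 x.2.2)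
    (hg : Measurable (Function.uncurry g)) : Measurable fun x => M.mse P t (f x) g := by
  refine Measurable.lintegral_prod_right (f := fun x ω => ENNReal.ofReal
    ((f x (M.state t ω) (M.act t ω) - g (M.state t ω) (M.act t ω)) ^ 2)) ?_
  have hsa : Measurable fun y : β × Ω => (M.state t y.2, M.act t y.2) :=
    (M.measurable_state_act t).comp measurable_snd
  exact (((hf.comp (measurable_fst.prodMk hsa)).sub (hg.comp hsa)).pow_const 2).ennreal_ofReal

end Measurability

/-! ### Bounds for fitted functions at a generic history -/

section CrossFit

variable {T : ℕ} {X : ℕ → Type*} {A : Type*} {Ω Ω' : Type*} [∀ j, MeasurableSpace (X j)]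
  [MeasurableSpace A] [mΩ : MeasurableSpace Ω] [MeasurableSpace Ω'] {M : Model T X A Ω}
  {lam : Measure A} [SigmaFinite lam] {acts : Fin T → Set A} {P : Measure Ω}
  [IsProbabilityMeasure P] {p : ℝ → Policy T X A lam acts}
  {dir q : (t : Fin T) → Hist X A t → A → ℝ} {γ R : ℝ}
  {Q : Measure Ω'} [IsProbabilityMeasure Q] {Z : ℕ → Ω' → Hist X A T}
  {K : ℕ} {fold : (n : ℕ) → Fin n → Fin K} {LQ LH : Learner T X A fold}

lemma Learner.measurable_fit_left (L : Learner T X A fold) (n : ℕ) (k : Fin K)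
    (τ : Train T X A (fold n) k) (t : Fin T) : Measurable (Function.uncurry (L.fit n k τ t)) :=
  (L.measurable_fit n k t).comp (measurable_const.prodMk measurable_id)

/-- A bound at the histories of the units of a fold holds, for almost every training sample, at
almost every history of a generic unit. -/
lemma Learner.ae_stateBound (hacts : ∀ t, MeasurableSet (acts t)) (hZm : ∀ i, Measurable (Z i))
    (hZi : iIndepFun Z Q) (hZl : ∀ i, Q.map (Z i) = P.map M.traj) {B : ℝ} {n : ℕ}
    (hbdd : ∀ᵐ w ∂Q, ∀ i : Fin n, ∀ t : Fin T, ∀ a ∈ acts t,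
      |LQ.fitted Z n (fold n i) w t (stateAt t (Z i w)) a| ≤ B) (i₀ : Fin n) :
    ∀ᵐ τ ∂(Measure.pi fun _ : {i // fold n i ≠ fold n i₀} => P.map M.traj),
      M.StateBound P lam acts B (LQ.fit n (fold n i₀) τ) := by
  have : IsProbabilityMeasure (P.map M.traj) :=
    Measure.isProbabilityMeasure_map M.measurable_traj.aemeasurable
  set k := fold n i₀ with hk
  set ν := P.map M.traj
  -- The unit `i₀` lies in the fold, so its trajectory is independent of the training sample and
  -- acts as a generic one.
  have hlaw : Q.map (fun w => (trainSample fold Z n k w, Z i₀ w)) =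
      (Measure.pi fun _ : {i // fold n i ≠ k} => ν).prod ν := by
    have h1 := map_split_sample hZm hZi hZl (fun i : Fin n => fold n i ≠ k)
    have h2 := (MeasurePreserving.id (Measure.pi fun _ : {i // fold n i ≠ k} => ν)).prod
      (measurePreserving_eval (fun _ : {i // ¬ fold n i ≠ k} => ν) ⟨i₀, not_not.2 hk.symm⟩)
    rw [← h2.map_eq, ← h1, Measure.map_map h2.measurable]
    · rfl
    · exact (measurable_pi_lambda _ fun i => hZm _).prodMk (measurable_pi_lambda _ fun i => hZm _)
  have hpm : Measurable fun w => (trainSample fold Z n k w, Z i₀ w) :=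
    (measurable_pi_lambda _ fun i => hZm _).prodMk (hZm _)
  refine ae_all_iff.2 fun t => ?_
  have hmeas : MeasurableSet {y : A × (Train T X A (fold n) k × Hist X A T) |
      |LQ.fit n k y.2.1 t (stateAt t y.2.2) y.1| ≤ B} :=
    measurableSet_le ((LQ.measurable_fit n k t).comp
      ((measurable_fst.comp measurable_snd).prodMk
        (((measurable_stateAt t).comp (measurable_snd.comp measurable_snd)).prodMk
          measurable_fst))).abs measurable_const
  -- The action is fixed before passing to the product law, since the intersection of the bounds
  -- over all actions need not be measurable; Fubini's theorem then interchanges the quantifiers.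
  have h1 : ∀ᵐ a ∂(lam.restrict (acts t)),
      ∀ᵐ x ∂((Measure.pi fun _ : {i // fold n i ≠ k} => ν).prod ν),
        |LQ.fit n k x.1 t (stateAt t x.2) a| ≤ B := by
    filter_upwards [ae_restrict_mem (hacts t)] with a ha
    rw [← hlaw]
    refine (ae_map_iff hpm.aemeasurable (hmeas.preimage (measurable_const (a := a) |>.prodMk
      measurable_id))).2 ?_
    filter_upwards [hbdd] with w hw
    exact hw i₀ t a ha
  have h2 := (Measure.ae_ae_comm (p := fun (a : A) (x : Train T X A (fold n) k × Hist X A T) =>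
    |LQ.fit n k x.1 t (stateAt t x.2) a| ≤ B) hmeas).1 h1
  filter_upwards [Measure.ae_ae_of_ae_prod h2] with τ hτ
  exact ae_of_ae_map M.measurable_traj.aemeasurable hτ

end CrossFit

/-! ### Errors over a single fold -/

section

variable {T : ℕ} {X : ℕ → Type*} {A : Type*} {Ω Ω' : Type*} [∀ j, MeasurableSpace (X j)]
  [MeasurableSpace A] [mΩ : MeasurableSpace Ω] [MeasurableSpace Ω'] {M : Model T X A Ω}
  {lam : Measure A} [SigmaFinite lam] {acts : Fin T → Set A} {P : Measure Ω}
  [IsProbabilityMeasure P] {p : ℝ → Policy T X A lam acts}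
  {dir q : (t : Fin T) → Hist X A t → A → ℝ} {γ R : ℝ}
  {Q : Measure Ω'} [IsProbabilityMeasure Q] {Z : ℕ → Ω' → Hist X A T}
  {K : ℕ} {fold : (n : ℕ) → Fin n → Fin K} {LQ LH : Learner T X A fold}

/-- The deviation of the sum of the errors over a sample that is independent of the nuisance
functions, if the latter satisfy a product-rate condition. -/
lemma Model.exists_measure_pi_error_le (hpath : M.DifferentiablePath P p dir)
    (hp : M.FollowsPolicy P (p 0)) (hcons : M.Consistency P)
    (hSU : M.SequentialUnconfoundedness P) (hq : M.IsActionValue P γ (p 0) q)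
    (hgrad : M.GradientConditions P p dir q) (hγ : 0 ≤ γ) (hγ' : γ ≤ 1)
    (hR : ∀ t, ∀ᵐ ω ∂P, |M.rew t ω| ≤ R) {αq αH : ℝ} (hαq : 0 ≤ αq) (hαH : 0 ≤ αH)
    (hα : 1 / 2 ≤ αq + αH) {δ : ℝ} (hδ : 0 < δ) {e : ℝ} (he : 0 < e) :
    ∃ d : ℝ, 0 < d ∧ ∀ n : ℕ, 0 < n → ∀ qh Hh : (t : Fin T) → Hist X A t → A → ℝ,
      (∀ t, Measurable (Function.uncurry (qh t))) → (∀ t, Measurable (Function.uncurry (Hh t))) →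
      M.StateBound P lam acts (rewardBound T γ R) qh →
      (∀ t, M.mse P t (qh t) (q t) ≤ ENNReal.ofReal (d * (n : ℝ) ^ (-(2 * αq)))) →
      (∀ t, M.mse P t (Hh t) (dirScore (p 0) dir t) ≤
        ENNReal.ofReal (d * (n : ℝ) ^ (-(2 * αH)))) →
      ∀ {ι : Type} [Fintype ι], Fintype.card ι ≤ n →
      Measure.pi (fun _ : ι => P.map M.traj) {v | δ * √n ≤ |∑ i,
        (augScore lam acts γ dir qh Hh (v i) -
          augScore lam acts γ dir q (dirScore (p 0) dir) (v i))|} ≤ ENNReal.ofReal e := by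
  have : IsProbabilityMeasure (P.map M.traj) :=
    Measure.isProbabilityMeasure_map M.measurable_traj.aemeasurable
  have hHm := fun t => measurable_dirScore (p 0) (hpath.measurable_dir t)
  have hqm := fun t => (hq t).1
  -- Chosen so that `4 a / δ²` and `2 b / δ` both equal `e / 2`.
  set a : ℝ := e * δ ^ 2 / 8 with ha_def
  set b : ℝ := e * δ / 4 with hb_def
  have ha : 0 < a := by positivity
  have hb : 0 < b := by positivity
  obtain ⟨η, hη0, hη⟩ := exists_linError_bound hpath hp hcons hSU hq hgrad hγ hγ' hR
    (ENNReal.ofReal_pos.2 ha)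
  have hη1 : min η 1 ≠ ∞ := ne_top_of_le_ne_top ENNReal.one_ne_top (min_le_right _ _)
  have hη1' : 0 < (min η 1).toReal := ENNReal.toReal_pos (lt_min hη0 one_pos).ne' hη1
  -- The first bound serves the linear part, which needs no rate since `n^(-2α) ≤ 1`; the second
  -- gives `2 T d ≤ b` for the product part.
  set d : ℝ := min (min η 1).toReal (b / (2 * T + 1)) with hd_def
  have hd : 0 < d := lt_min hη1' (by positivity)
  refine ⟨d, hd, fun n hn qh Hh hqh hHh hbd hmq hmH ι _ hcard => ?_⟩
  have hn1 : (1 : ℝ) ≤ n := by exact_mod_cast hn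
  have hn0 : (0 : ℝ) < n := by linarith
  have hdη : ∀ α : ℝ, 0 ≤ α → ENNReal.ofReal (d * (n : ℝ) ^ (-(2 * α))) ≤ η := fun α hα => by
    refine (ENNReal.ofReal_le_ofReal ?_).trans ((ENNReal.ofReal_toReal hη1).trans_le
      (min_le_left _ _))
    refine (mul_le_of_le_one_right hd.le ?_).trans (min_le_left _ _)
    exact Real.rpow_le_one_of_one_le_of_nonpos hn1 (by linarith)
  obtain ⟨hL, hL0, hLa⟩ := hη qh Hh hqh hHh hbd (fun t => (hmq t).trans (hdη αq hαq))
    fun t => (hmH t).trans (hdη αH hαH)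
  set L : Hist X A T → ℝ := fun z => ∑ t : Fin T, γ ^ (t : ℕ) *
    linError lam acts γ dir q (dirScore (p 0) dir) qh Hh t z with hL_def
  set C : Hist X A T → ℝ := fun z => ∑ t : Fin T, γ ^ (t : ℕ) *
    prodError q (dirScore (p 0) dir) qh Hh t z with hC_def
  have hLm : Measurable L := Finset.measurable_fun_sum _ fun t _ =>
    (measurable_linError hpath.measurable_dir hqm hHm hqh hHh t).const_mul _
  have hCm : Measurable C := Finset.measurable_fun_sum _ fun t _ =>
    (measurable_prodError hqm hHm hqh hHh t).const_mul _
  have htr := M.measurable_traj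
  have hprod : ∫⁻ z, ENNReal.ofReal |C z| ∂(P.map M.traj) ≤ ENNReal.ofReal (b / √n) := by
    rw [lintegral_map hCm.abs.ennreal_ofReal htr]
    -- With this weight both mean squared errors contribute `d n^(-(αq + αH))`, which is at most `d
    -- / √n`.
    have hc : 0 < (n : ℝ) ^ (αq - αH) := Real.rpow_pos_of_pos hn0 _
    refine (lintegral_prodError_le hqm hHm hqh hHh hγ hγ' hc).trans ?_
    have hterm : ∀ t, ENNReal.ofReal ((n : ℝ) ^ (αq - αH)) * M.mse P t (qh t) (q t) +
        ENNReal.ofReal ((n : ℝ) ^ (αq - αH))⁻¹ * M.mse P t (Hh t) (dirScore (p 0) dir t) ≤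
        ENNReal.ofReal (2 * d * (n : ℝ) ^ (-(αq + αH))) := fun t => by
      refine (add_le_add (mul_le_mul_right (hmq t) _) (mul_le_mul_right (hmH t) _)).trans ?_
      rw [← ENNReal.ofReal_mul hc.le, ← ENNReal.ofReal_mul (inv_nonneg.2 hc.le),
        ← ENNReal.ofReal_add (by positivity) (by positivity)]
      refine ENNReal.ofReal_le_ofReal (le_of_eq ?_)
      rw [← Real.rpow_neg hn0.le, mul_left_comm, mul_left_comm _ d, ← Real.rpow_add hn0,
        ← Real.rpow_add hn0]
      ring_nf
    refine (Finset.sum_le_sum fun t _ => hterm t).trans ?_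
    rw [Finset.sum_const, Finset.card_univ, Fintype.card_fin, nsmul_eq_mul,
      ← ENNReal.ofReal_natCast, ← ENNReal.ofReal_mul (Nat.cast_nonneg _)]
    refine ENNReal.ofReal_le_ofReal ?_
    have h1 : (n : ℝ) ^ (-(αq + αH)) ≤ 1 / √n := by
      rw [one_div, Real.sqrt_eq_rpow, ← Real.rpow_neg hn0.le]
      exact Real.rpow_le_rpow_of_exponent_le hn1 (by linarith)
    have h2 : d * (2 * T + 1) ≤ b := (le_div_iff₀ (by positivity)).1 (min_le_right _ _)
    calc T * (2 * d * (n : ℝ) ^ (-(αq + αH))) ≤ T * (2 * d * (1 / √n)) := by gcongr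
      _ = (d * (2 * T)) / √n := by ring
      _ ≤ b / √n := by gcongr; linarith
  have hDae : ∀ᵐ z ∂(P.map M.traj), augScore lam acts γ dir qh Hh z -
      augScore lam acts γ dir q (dirScore (p 0) dir) z = L z - C z := by
    refine (ae_map_iff htr.aemeasurable (measurableSet_eq_fun
      ((measurable_augScore hpath.measurable_dir hqh hHh).sub
        (measurable_augScore hpath.measurable_dir hqm hHm)) (hLm.sub hCm))).2 ?_
    exact hpath.ae_augScore_sub hgrad hqm hqh hbd γ (dirScore (p 0) dir) Hh
  have hL' : MemLp L 2 (P.map M.traj) :=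
    (memLp_map_measure_iff hLm.aestronglyMeasurable htr.aemeasurable).2 hL
  have hL0' : ∫ z, L z ∂(P.map M.traj) = 0 := by
    rw [integral_map htr.aemeasurable hLm.aestronglyMeasurable]
    exact hL0
  have hLa' : ∫⁻ z, ENNReal.ofReal (L z ^ 2) ∂(P.map M.traj) ≤ ENNReal.ofReal a := by
    rw [lintegral_map (hLm.pow_const 2).ennreal_ofReal htr]
    exact hLa
  refine (measure_pi_sum_ge_le hL' hL0' hCm hDae hn hcard hδ ha.le hb.le hLa' hprod).trans ?_
  rw [← ENNReal.ofReal_add (by positivity) (by positivity)]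
  refine ENNReal.ofReal_le_ofReal (le_of_eq ?_)
  rw [ha_def, hb_def]
  field_simp
  ring

/-- The sum of the errors over a single fold is negligible. -/
lemma tendsto_fold_error (hacts : ∀ t, MeasurableSet (acts t)) (hγ : 0 ≤ γ) (hγ' : γ ≤ 1)
    (hcons : M.Consistency P) (hSU : M.SequentialUnconfoundedness P)
    (hp : M.FollowsPolicy P (p 0)) (hpath : M.DifferentiablePath P p dir)
    (hq : M.IsActionValue P γ (p 0) q) (hgrad : M.GradientConditions P p dir q)
    (hR : ∀ t, ∀ᵐ ω ∂P, |M.rew t ω| ≤ R)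
    (hZm : ∀ i, Measurable (Z i)) (hZi : iIndepFun Z Q) (hZl : ∀ i, Q.map (Z i) = P.map M.traj)
    (hbdd : ∀ n, ∀ᵐ w ∂Q, ∀ i : Fin n, ∀ t : Fin T, ∀ a ∈ acts t,
      |LQ.fitted Z n (fold n i) w t (stateAt t (Z i w)) a| ≤ rewardBound T γ R)
    {αq αH : ℝ} (hαq : 0 ≤ αq) (hαH : 0 ≤ αH) (hα : 1 / 2 ≤ αq + αH) (k : Fin K)
    (hrateq : ∀ t : Fin T, IsLittleOp Q (fun n w => M.mse P t (LQ.fitted Z n k w t) (q t))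
      (fun n => (n : ℝ) ^ (-(2 * αq))))
    (hrateH : ∀ t : Fin T, IsLittleOp Q
      (fun n w => M.mse P t (LH.fitted Z n k w t) (dirScore (p 0) dir t))
      (fun n => (n : ℝ) ^ (-(2 * αH)))) {δ : ℝ} (hδ : 0 < δ) :
    Tendsto (fun n : ℕ => Q {w | δ * √n ≤ |∑ i : Fin n with fold n i = k,
      (augScore lam acts γ dir (LQ.fitted Z n k w) (LH.fitted Z n k w) (Z i w) -
        augScore lam acts γ dir q (dirScore (p 0) dir) (Z i w))|}) atTop (𝓝 0) := by
  have : IsProbabilityMeasure (P.map M.traj) :=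
    Measure.isProbabilityMeasure_map M.measurable_traj.aemeasurable
  have hHm := fun t => measurable_dirScore (p 0) (hpath.measurable_dir t)
  have hqm := fun t => (hq t).1
  refine ENNReal.tendsto_nhds_zero.2 fun e he => ?_
  -- The tolerance `e` may be infinite; truncating it at 1 yields a real number.
  have he1 : min e 1 ≠ ∞ := ne_top_of_le_ne_top ENNReal.one_ne_top (min_le_right _ _)
  have he0 : 0 < min e 1 := lt_min he one_pos
  obtain ⟨d, hd, hdev⟩ := M.exists_measure_pi_error_le hpath hp hcons hSU hq hgrad hγ hγ' hR hαq hαH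
    hα hδ (half_pos (ENNReal.toReal_pos he0.ne' he1))
  have hlim := tendsto_finsetSum Finset.univ fun (t : Fin T) _ =>
    (hrateq t d hd).add (hrateH t d hd)
  simp only [add_zero, Finset.sum_const_zero] at hlim
  filter_upwards [eventually_gt_atTop 0, hlim.eventually
    (ge_mem_nhds (ENNReal.half_pos he0.ne'))] with n hn hbadn
  by_cases hk : ∃ i₀ : Fin n, fold n i₀ = k
  swap
  -- An empty fold has error zero, below the positive threshold.
  · have hset : {w | δ * √n ≤ |∑ i : Fin n with fold n i = k,
        (augScore lam acts γ dir (LQ.fitted Z n k w) (LH.fitted Z n k w) (Z i w) -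
          augScore lam acts γ dir q (dirScore (p 0) dir) (Z i w))|} = ∅ := by
      have hemp : (Finset.univ.filter fun i : Fin n => fold n i = k) = ∅ :=
        Finset.filter_eq_empty_iff.2 fun i _ hi => hk ⟨i, hi⟩
      have hpos : 0 < δ * √(n : ℝ) := mul_pos hδ (Real.sqrt_pos.2 (Nat.cast_pos.2 hn))
      simp only [hemp, Finset.sum_empty, abs_zero]
      exact Set.eq_empty_of_forall_notMem fun w hw => absurd hw (not_le.2 hpos)
    rw [hset, measure_empty]
    exact zero_le
  obtain ⟨i₀, rfl⟩ := hk
  set k := fold n i₀ with hk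
  set bad : Set (Train T X A (fold n) k) := ⋃ t : Fin T,
    ({τ | ENNReal.ofReal (d * (n : ℝ) ^ (-(2 * αq))) < M.mse P t (LQ.fit n k τ t) (q t)} ∪
      {τ | ENNReal.ofReal (d * (n : ℝ) ^ (-(2 * αH))) <
        M.mse P t (LH.fit n k τ t) (dirScore (p 0) dir t)}) with hbad_def
  have hbadm : MeasurableSet bad := MeasurableSet.iUnion fun t =>
    (measurableSet_lt measurable_const
      (M.measurable_mse P (f := fun τ => LQ.fit n k τ t) (LQ.measurable_fit n k t) (hqm t))).union
    (measurableSet_lt measurable_const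
      (M.measurable_mse P (f := fun τ => LH.fit n k τ t) (LH.measurable_fit n k t) (hHm t)))
  set S : Set (Train T X A (fold n) k × ({i // ¬ fold n i ≠ k} → Hist X A T)) :=
    {x | δ * √n ≤ |∑ i, (augScore lam acts γ dir (LQ.fit n k x.1) (LH.fit n k x.1) (x.2 i) -
      augScore lam acts γ dir q (dirScore (p 0) dir) (x.2 i))|} with hS_def
  have hSm : MeasurableSet S := by
    refine measurableSet_le measurable_const (Finset.measurable_fun_sum _ fun i _ => ?_).abs
    have hxi : Measurable fun x : Train T X A (fold n) k × ({i // ¬ fold n i ≠ k} → Hist X A T) =>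
        x.2 i := (measurable_pi_apply i).comp measurable_snd
    exact ((measurable_augScore_param (F := LQ.fit n k) (G := LH.fit n k) hpath.measurable_dir
      (LQ.measurable_fit n k) (LH.measurable_fit n k)).comp (measurable_fst.prodMk hxi)).sub
      ((measurable_augScore hpath.measurable_dir hqm hHm).comp hxi)
  have hlaw := map_split_sample hZm hZi hZl (fun i : Fin n => fold n i ≠ k)
  set μ₁ := Measure.pi fun _ : {i // fold n i ≠ k} => P.map M.traj
  set μ₂ := Measure.pi fun _ : {i // ¬ fold n i ≠ k} => P.map M.traj
  have hpm : Measurable fun w => ((fun i : {i // fold n i ≠ k} => Z (i : Fin n) w),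
      fun i : {i // ¬ fold n i ≠ k} => Z (i : Fin n) w) :=
    (measurable_pi_lambda _ fun i => hZm _).prodMk (measurable_pi_lambda _ fun i => hZm _)
  have hbadQ : μ₁ bad ≤ min e 1 / 2 := by
    have h1 : μ₁ bad = Q {w | trainSample fold Z n k w ∈ bad} := by
      have h2 : (μ₁.prod μ₂) (Prod.fst ⁻¹' bad) = μ₁ bad := by
        have h3 : MeasurePreserving Prod.fst (μ₁.prod μ₂) μ₁ := measurePreserving_fst
        exact h3.measure_preimage hbadm.nullMeasurableSet
      rw [← h2, ← hlaw, Measure.map_apply hpm (measurable_fst hbadm)]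
      rfl
    rw [h1]
    refine le_trans ?_ hbadn
    have h4 : {w | trainSample fold Z n k w ∈ bad} = ⋃ t : Fin T,
        ({w | ENNReal.ofReal (d * (n : ℝ) ^ (-(2 * αq))) <
          M.mse P t (LQ.fitted Z n k w t) (q t)} ∪
        {w | ENNReal.ofReal (d * (n : ℝ) ^ (-(2 * αH))) <
          M.mse P t (LH.fitted Z n k w t) (dirScore (p 0) dir t)}) := by
      ext w
      simp only [hbad_def, Set.mem_ofPred_eq, Set.mem_iUnion, Set.mem_union]
      rfl
    rw [h4]
    exact (measure_iUnion_fintype_le _ _).trans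
      (Finset.sum_le_sum fun t _ => measure_union_le _ _)
  have hevent : Q {w | δ * √n ≤ |∑ i : Fin n with fold n i = k,
      (augScore lam acts γ dir (LQ.fitted Z n k w) (LH.fitted Z n k w) (Z i w) -
        augScore lam acts γ dir q (dirScore (p 0) dir) (Z i w))|} = (μ₁.prod μ₂) S := by
    rw [← hlaw, Measure.map_apply hpm hSm]
    congr 1
    ext w
    simp only [hS_def, Set.mem_ofPred_eq, Set.mem_preimage]
    rw [Finset.sum_subtype (Finset.univ.filter fun i : Fin n => fold n i = k)
      (p := fun i => ¬ fold n i ≠ k) (fun i => by simp)]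
    rfl
  rw [hevent]
  -- For a training sample outside `bad` the fitted functions are fixed, the fold is an independent
  -- sample, and the deviation bound applies.
  have hbound : (μ₁.prod μ₂) S ≤ ENNReal.ofReal ((min e 1).toReal / 2) + μ₁ bad := by
    refine measure_prod_le_add hSm ?_
    filter_upwards [Learner.ae_stateBound (lam := lam) hacts hZm hZi hZl (hbdd n) i₀] with τ hτ hτbad
    have h1 : ∀ t, M.mse P t (LQ.fit n k τ t) (q t) ≤
        ENNReal.ofReal (d * (n : ℝ) ^ (-(2 * αq))) := fun t => not_lt.1 fun h =>
      hτbad (Set.mem_iUnion.2 ⟨t, Or.inl h⟩)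
    have h2 : ∀ t, M.mse P t (LH.fit n k τ t) (dirScore (p 0) dir t) ≤
        ENNReal.ofReal (d * (n : ℝ) ^ (-(2 * αH))) := fun t => not_lt.1 fun h =>
      hτbad (Set.mem_iUnion.2 ⟨t, Or.inr h⟩)
    exact hdev n hn (LQ.fit n k τ) (LH.fit n k τ) (LQ.measurable_fit_left n k τ)
      (LH.measurable_fit_left n k τ) hτ h1 h2
      ((Fintype.card_subtype_le _).trans_eq (Fintype.card_fin n))
  refine hbound.trans ((add_le_add_right hbadQ _).trans ?_)
  rw [ENNReal.ofReal_div_of_pos two_pos, ENNReal.ofReal_toReal he1, ENNReal.ofReal_ofNat,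
    ENNReal.add_halves]
  exact min_le_left _ _

end

/-! ### Asymptotic equivalence and normality -/

section

variable {T : ℕ} {X : ℕ → Type*} {A : Type*} {Ω Ω' : Type*} [∀ j, MeasurableSpace (X j)]
  [MeasurableSpace A] [mΩ : MeasurableSpace Ω] [MeasurableSpace Ω'] {M : Model T X A Ω}
  {lam : Measure A} [SigmaFinite lam] {acts : Fin T → Set A} {P : Measure Ω}
  [IsProbabilityMeasure P] {p : ℝ → Policy T X A lam acts}
  {dir q : (t : Fin T) → Hist X A t → A → ℝ} {γ R : ℝ}
  {Q : Measure Ω'} [IsProbabilityMeasure Q] {Z : ℕ → Ω' → Hist X A T}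
  {K : ℕ} {fold : (n : ℕ) → Fin n → Fin K} {LQ LH : Learner T X A fold}

lemma sqrt_mul_asrw_sub_oracleEst (H : (t : Fin T) → Hist X A t → A → ℝ) (n : ℕ) (w : Ω') :
    √(n : ℝ) * (asrw lam acts γ dir LQ LH Z n w - oracleEst lam acts γ dir q H Z n w) =
      (√(n : ℝ))⁻¹ * ∑ k : Fin K, ∑ i : Fin n with fold n i = k,
        (augScore lam acts γ dir (LQ.fitted Z n k w) (LH.fitted Z n k w) (Z i w) -
          augScore lam acts γ dir q H (Z i w)) := by
  have h1 : ∑ k : Fin K, ∑ i : Fin n with fold n i = k, augScore lam acts γ dir q H (Z i w) =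
      ∑ i : Fin n, augScore lam acts γ dir q H (Z i w) :=
    Finset.sum_fiberwise Finset.univ (fold n) fun i : Fin n => augScore lam acts γ dir q H (Z i w)
  rw [asrw, oracleEst, ← mul_sub, ← h1]
  simp only [Finset.sum_sub_distrib]
  rw [← mul_assoc, mul_one_div, Real.sqrt_div_self', one_div]

/-- The cross-fitted estimator is asymptotically equivalent to the oracle estimator if the errors
over each fold are negligible. -/
lemma tendstoInMeasure_asrw_sub_oracleEst (H : (t : Fin T) → Hist X A t → A → ℝ)
    (h : ∀ k : Fin K, ∀ δ : ℝ, 0 < δ →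
      Tendsto (fun n : ℕ => Q {w | δ * √n ≤ |∑ i : Fin n with fold n i = k,
        (augScore lam acts γ dir (LQ.fitted Z n k w) (LH.fitted Z n k w) (Z i w) -
          augScore lam acts γ dir q H (Z i w))|}) atTop (𝓝 0)) :
    TendstoInMeasure Q (fun (n : ℕ) w => √(n : ℝ) * (asrw lam acts γ dir LQ LH Z n w -
      oracleEst lam acts γ dir q H Z n w)) atTop (fun _ => 0) := by
  rw [tendstoInMeasure_iff_norm]
  intro ε hε
  -- If all `K` fold errors stay below `δ √n`, their total stays strictly below `ε √n`; the extra 1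
  -- gives strictness and allows `K = 0`.
  set δ : ℝ := ε / (K + 1) with hδ_def
  have hδ : 0 < δ := by positivity
  have hlim := tendsto_finsetSum Finset.univ fun (k : Fin K) _ => h k δ hδ
  simp only [Finset.sum_const_zero] at hlim
  refine tendsto_of_tendsto_of_tendsto_of_le_of_le' tendsto_const_nhds hlim
    (Eventually.of_forall fun _ => zero_le) ?_
  filter_upwards [eventually_gt_atTop 0] with n hn
  have hs : 0 < √(n : ℝ) := Real.sqrt_pos.2 (Nat.cast_pos.2 hn)
  refine le_trans (measure_mono fun w hw => ?_) (measure_iUnion_fintype_le _ _)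
  have hw : ε ≤ ‖√(n : ℝ) * (asrw lam acts γ dir LQ LH Z n w -
    oracleEst lam acts γ dir q H Z n w) - 0‖ := hw
  rw [sub_zero, sqrt_mul_asrw_sub_oracleEst, norm_mul, norm_inv, Real.norm_eq_abs, Real.norm_eq_abs,
    abs_of_pos hs, inv_mul_eq_div, le_div_iff₀ hs] at hw
  by_contra hcon
  have hlt : ∀ k : Fin K, |∑ i : Fin n with fold n i = k,
      (augScore lam acts γ dir (LQ.fitted Z n k w) (LH.fitted Z n k w) (Z i w) -
        augScore lam acts γ dir q H (Z i w))| ≤ δ * √n := fun k =>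
    (not_le.1 fun hk => hcon (Set.mem_iUnion.2 ⟨k, hk⟩)).le
  have h2 := (Finset.abs_sum_le_sum_abs _ Finset.univ).trans
    (Finset.sum_le_sum fun (k : Fin K) _ => hlt k)
  rw [Finset.sum_const, Finset.card_univ, Fintype.card_fin, nsmul_eq_mul] at h2
  have h3 : (K : ℝ) * (δ * √n) < ε * √n := by
    have h4 : ε = (K + 1) * δ := by
      rw [hδ_def]
      field_simp
    rw [h4]
    nlinarith [mul_pos hδ hs]
  linarith

lemma measurable_asrw (hdir : ∀ t, Measurable (Function.uncurry (dir t)))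
    (hZm : ∀ i, Measurable (Z i)) (n : ℕ) : Measurable (asrw lam acts γ dir LQ LH Z n) := by
  refine (Finset.measurable_fun_sum _ fun k _ => Finset.measurable_fun_sum _ fun i _ =>
    ?_).const_mul _
  have htr : Measurable (trainSample fold Z n k) := measurable_pi_lambda _ fun i => hZm _
  exact (measurable_augScore_param (F := LQ.fit n k) (G := LH.fit n k) hdir
    (LQ.measurable_fit n k) (LH.measurable_fit n k)).comp (htr.prodMk (hZm i))

/-- The mean of the oracle summand is the policy-gradient functional. -/
lemma Model.integral_augScore_oracle (hγ : 0 ≤ γ)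
    (hcons : M.Consistency P) (hSU : M.SequentialUnconfoundedness P)
    (hp : M.FollowsPolicy P (p 0)) (hpath : M.DifferentiablePath P p dir)
    (hq : M.IsActionValue P γ (p 0) q) (hgrad : M.GradientConditions P p dir q)
    (hR : ∀ t, ∀ᵐ ω ∂P, |M.rew t ω| ≤ R) :
    ∫ ω, augScore lam acts γ dir q (dirScore (p 0) dir) (M.traj ω) ∂P =
      M.gradientFunctional P lam acts γ dir q := by
  have hi1 : ∀ t : Fin T, Integrable (fun ω => γ ^ (t : ℕ) *
      ∫ a in acts t, q t (M.state t ω) a * dir t (M.state t ω) a ∂lam) P := fun t => by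
    refine Integrable.const_mul ⟨((measurable_setIntegral_mul (hq t).1
      (hpath.measurable_dir t)).comp (M.measurable_state t)).aestronglyMeasurable, ?_⟩ _
    exact (lintegral_mono fun ω => enorm_integral_le_lintegral_enorm _).trans_lt
      (hgrad.lintegral_q_dir t)
  have hrm : ∀ t, Measurable fun ω => cumReward γ t (M.traj ω) - q t (M.state t ω) (M.act t ω) :=
    fun t => ((measurable_cumReward γ t).comp M.measurable_traj).sub
      ((hq t).1.comp (M.measurable_state_act t))
  have hi2 : ∀ t, Integrable (fun ω => dirScore (p 0) dir t (M.state t ω) (M.act t ω) *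
      (cumReward γ t (M.traj ω) - q t (M.state t ω) (M.act t ω))) P := fun t => by
    refine (hgrad.integrable_score t).mul_bdd (c := 2 * rewardBound T γ R)
      (hrm t).aestronglyMeasurable ?_
    filter_upwards [(hq.ae_bound_and_lintegral hcons hSU hp hγ hR t).1,
      ae_abs_cumReward_le hγ hR t] with ω h1 h2
    rw [Real.norm_eq_abs, abs_le]
    rw [abs_le] at h1 h2
    constructor <;> linarith
  have hform : ∀ ω, augScore lam acts γ dir q (dirScore (p 0) dir) (M.traj ω) =
      ∑ t : Fin T, (γ ^ (t : ℕ) *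
        ∫ a in acts t, q t (M.state t ω) a * dir t (M.state t ω) a ∂lam +
        γ ^ (t : ℕ) * (dirScore (p 0) dir t (M.state t ω) (M.act t ω) *
          (cumReward γ t (M.traj ω) - q t (M.state t ω) (M.act t ω)))) := fun ω =>
    Finset.sum_congr rfl fun t _ => congrArg _ (mul_assoc _ _ _)
  simp_rw [hform]
  refine (integral_finsetSum _ fun t _ => (hi1 t).add ((hi2 t).const_mul _)).trans ?_
  refine Finset.sum_congr rfl fun t _ => ?_
  refine (integral_add (hi1 t) ((hi2 t).const_mul _)).trans ?_
  rw [integral_const_mul, integral_const_mul,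
    hq.integral_mul_sub hcons hSU hp hγ hR t (measurable_dirScore (p 0) (hpath.measurable_dir t))
      (hgrad.integrable_score t), mul_zero, add_zero]

/-- Asymptotic normality of the average of an independent identically distributed sample of a
square-integrable score, and of every estimator equivalent to it. -/
lemma tendstoInDistribution_of_score {α : Type*} [MeasurableSpace α] {Z : ℕ → Ω' → α}
    (hZm : ∀ i, Measurable (Z i)) (hZi : iIndepFun Z Q) {ν : Measure α}
    (hZl : ∀ i, Q.map (Z i) = ν) {f : α → ℝ} (hf : Measurable f) (hf2 : MemLp f 2 ν)
    {Y : ℕ → Ω' → ℝ} (hY : ∀ n, Measurable (Y n))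
    (hequiv : TendstoInMeasure Q (fun (n : ℕ) w =>
      √(n : ℝ) * (Y n w - 1 / (n : ℝ) * ∑ i : Fin n, f (Z i w))) atTop (fun _ => 0)) :
    TendstoInDistribution (fun (n : ℕ) w => √(n : ℝ) * (Y n w - ∫ z, f z ∂ν)) atTop
      (fun x : ℝ => x) (fun _ => Q) (gaussianReal 0 Var[f; ν].toNNReal) := by
  have hvar : Var[fun w => f (Z 0 w); Q] = Var[f; ν] := by
    rw [← hZl 0, variance_map hf.aemeasurable (hZm 0).aemeasurable]
    rfl
  have hmean : ∫ w, f (Z 0 w) ∂Q = ∫ z, f z ∂ν := by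
    rw [← hZl 0, integral_map (hZm 0).aemeasurable hf.aestronglyMeasurable]
  have hX2 : MemLp (fun w => f (Z 0 w)) 2 Q := by
    rw [← hZl 0] at hf2
    exact (memLp_map_measure_iff hf.aestronglyMeasurable (hZm 0).aemeasurable).1 hf2
  have hident : ∀ i, IdentDistrib (fun w => f (Z i w)) (fun w => f (Z 0 w)) Q Q := fun i =>
    (IdentDistrib.mk (hZm i).aemeasurable (hZm 0).aemeasurable
      ((hZl i).trans (hZl 0).symm)).comp hf
  have hlaw : HasLaw (fun x : ℝ => x) (gaussianReal 0 Var[fun w => f (Z 0 w); Q].toNNReal)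
      (gaussianReal 0 Var[f; ν].toNNReal) := by
    rw [hvar]
    exact ⟨aemeasurable_id, Measure.map_id⟩
  have hclt := tendstoInDistribution_inv_sqrt_mul_sum_sub (X := fun i w => f (Z i w)) hlaw hX2
    (hZi.comp (fun _ => f) fun _ => hf) hident
  -- Slutsky: for `n > 0` the distance from the normalized centred sum is `√n` times the difference
  -- between `Y n` and the sample mean, in which the centring cancels.
  refine tendstoInDistribution_of_tendstoInMeasure_sub _ _ hclt ?_ fun n =>
    (((hY n).sub_const _).const_mul _).aemeasurable
  refine hequiv.congr' ?_ (ae_of_all _ fun _ => rfl)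
  filter_upwards [eventually_gt_atTop 0] with n hn
  refine ae_of_all _ fun w => ?_
  simp only [Pi.sub_apply, hmean]
  rw [Finset.sum_range fun k => f (Z k w)]
  generalize ∑ i : Fin n, f (Z i w) = x
  have h1 : (√(n : ℝ))⁻¹ * n = √(n : ℝ) := by
    rw [inv_mul_eq_div, Real.div_sqrt]
  have h2 : √(n : ℝ) * (1 / (n : ℝ)) = (√(n : ℝ))⁻¹ := by
    rw [mul_one_div, Real.sqrt_div_self', one_div]
  linear_combination (-x) * h2 - (∫ z, f z ∂ν) * h1

end

end MPE

end

/-! ### The main theorem -/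

theorem theorem2
    {T : ℕ} {X : ℕ → Type*} {A Ω Ω' : Type*}
    [∀ j, MeasurableSpace (X j)] [MeasurableSpace A] [MeasurableSpace Ω] [MeasurableSpace Ω']
    -- reference measure, action sets and discount factor
    (lam : Measure A) [SigmaFinite lam] (acts : Fin T → Set A)
    (hacts : ∀ t, MeasurableSet (acts t))
    (γ : ℝ) (hγ : 0 < γ) (hγ' : γ ≤ 1)
    -- the causal model of a generic unit
    (P : Measure Ω) [IsProbabilityMeasure P] (M : MPE.Model T X A Ω)
    (hcons : M.Consistency P) (hSU : M.SequentialUnconfoundedness P)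
    -- the policy path, whose baseline generates the observed actions
    (p : ℝ → MPE.Policy T X A lam acts) (hp : M.FollowsPolicy P (p 0))
    (dir : (t : Fin T) → MPE.Hist X A t → A → ℝ) (hpath : M.DifferentiablePath P p dir)
    -- the baseline action-value function and the conditions on it
    (q : (t : Fin T) → MPE.Hist X A t → A → ℝ) (hq : M.IsActionValue P γ (p 0) q)
    (hgrad : M.GradientConditions P p dir q)
    (hmom : MemLp (fun ω => MPE.augScore lam acts γ dir q (MPE.dirScore (p 0) dir) (M.traj ω)) 2 P)
    -- bounded rewards
    (Rmax : ℝ) (hR : ∀ t, ∀ᵐ ω ∂P, |M.rew t ω| ≤ Rmax)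
    -- the sample of independent and identically distributed trajectories
    (Q : Measure Ω') [IsProbabilityMeasure Q] (Z : ℕ → Ω' → MPE.Hist X A T)
    (hZm : ∀ i, Measurable (Z i)) (hZi : iIndepFun Z Q) (hZl : ∀ i, Q.map (Z i) = P.map M.traj)
    -- cross-fitted nuisance estimators
    {K : ℕ} (fold : (n : ℕ) → Fin n → Fin K) (LQ LH : MPE.Learner T X A fold)
    (hbdd : ∀ n, ∀ᵐ w ∂Q, ∀ i : Fin n, ∀ t : Fin T, ∀ a ∈ acts t,
      |LQ.fitted Z n (fold n i) w t (MPE.stateAt t (Z i w)) a|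
        ≤ Rmax * ∑ k ∈ Finset.range T, γ ^ k)
    -- rates
    (αq αH : ℝ) (hαq : 0 ≤ αq) (hαH : 0 ≤ αH) (hα : 1 / 2 ≤ αq + αH)
    (hrateq : ∀ (k : Fin K) (t : Fin T), MPE.IsLittleOp Q
      (fun n w => M.mse P t (LQ.fitted Z n k w t) (q t))
      (fun n => (n : ℝ) ^ (-(2 * αq))))
    (hrateH : ∀ (k : Fin K) (t : Fin T), MPE.IsLittleOp Q
      (fun n w => M.mse P t (LH.fitted Z n k w t) (MPE.dirScore (p 0) dir t))
      (fun n => (n : ℝ) ^ (-(2 * αH)))) :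
    -- first-order equivalence to the oracle estimator
    TendstoInMeasure Q
      (fun (n : ℕ) w => √(n : ℝ) * (MPE.asrw lam acts γ dir LQ LH Z n w
        - MPE.oracleEst lam acts γ dir q (MPE.dirScore (p 0) dir) Z n w))
      atTop (fun _ => 0) ∧
    -- asymptotic normality around the policy-gradient functional
    TendstoInDistribution
      (fun (n : ℕ) w => √(n : ℝ) * (MPE.asrw lam acts γ dir LQ LH Z n w
        - M.gradientFunctional P lam acts γ dir q))
      atTop (fun x : ℝ => x) (fun _ => Q)
      (gaussianReal 0 (M.oracleVariance P γ (p 0) dir q).toNNReal) ∧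
    -- the marginal policy effect exists, with asymptotic normality around it
    (M.DominatedPathBeforeLast P p →
      ∃ Θ : ℝ, HasDerivAt (fun ε : ℝ => M.expectedWelfare P γ (p ε)) Θ 0 ∧
        TendstoInDistribution
          (fun (n : ℕ) w => √(n : ℝ) * (MPE.asrw lam acts γ dir LQ LH Z n w - Θ))
          atTop (fun x : ℝ => x) (fun _ => Q)
          (gaussianReal 0 (M.oracleVariance P γ (p 0) dir q).toNNReal)) := by
  have hγ0 := hγ.le
  have hHm := fun t => MPE.measurable_dirScore (p 0) (hpath.measurable_dir t)
  have hequiv := MPE.tendstoInMeasure_asrw_sub_oracleEst (MPE.dirScore (p 0) dir) fun k δ hδ =>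
    MPE.tendsto_fold_error hacts hγ0 hγ' hcons hSU hp hpath hq hgrad hR hZm hZi hZl hbdd hαq hαH hα
      k (hrateq k) (hrateH k) hδ
  have hfm : Measurable (MPE.augScore lam acts γ dir q (MPE.dirScore (p 0) dir)) :=
    MPE.measurable_augScore hpath.measurable_dir (fun t => (hq t).1) hHm
  have htr := M.measurable_traj
  have hclt := MPE.tendstoInDistribution_of_score hZm hZi hZl hfm
    ((memLp_map_measure_iff hfm.aestronglyMeasurable htr.aemeasurable).2 hmom)
    (fun n => MPE.measurable_asrw hpath.measurable_dir hZm n) hequiv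
  -- The central limit theorem centres at the mean of the oracle score under the law of the
  -- trajectory; that mean is the policy-gradient functional.
  rw [integral_map htr.aemeasurable hfm.aestronglyMeasurable,
    MPE.Model.integral_augScore_oracle hγ0 hcons hSU hp hpath hq hgrad hR,
    variance_map hfm.aemeasurable htr.aemeasurable] at hclt
  -- The derivative is the policy-gradient functional itself, so the third claim reuses the same
  -- limit.
  exact ⟨hequiv, hclt, fun hdom =>
    ⟨_, hpath.hasDerivAt_expectedWelfare hp hcons hSU hq hgrad hγ0 hR hdom, hclt⟩⟩
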